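/- For a finite set $I$, let $\Pi(I)$ be the $\mathbb{Z}$-module generated by the expressions $\pi=\pi_1\otimes\cdots\otimes\pi_p$, where each block $\pi_j=i_{j,1}\wedge\cdots\wedge i_{j,p_j}$ ($p_j\ge 1$) is a wedge of elements of $I$ and each element of $I$ occurs exactly once in exactly one block, modulo the antisymmetry relations of the wedge blocks (exchanging two neighbouring factors of one block changes the sign of the expression). Put $\dim\pi_j=p_j-1$ and $\dim\pi=\sum_j\dim\pi_j$; this grades $\Pi(I)$. Define $$d(\pi)=\sum_{j=1}^{p-1}(-1)^{\dim\pi_1+\cdots+\dim\pi_j}\,\pi_1\otimes\cdots\otimes(\pi_j\wedge\pi_{j+1})\otimes\cdots\otimes\pi_p .$$ For nonempty finite sets $I,J$, $i\in I$, $\pi=\pi_1\otimes\cdots\otimes\pi_p\in\Pi(I)$ and $\mu=\mu_1\otimes\cdots\otimes\mu_q\in\Pi(J)$, let $\pi_\ell$ be the block containing $i$, written, after a change of sign if necessary, as $\pi_\ell=\pi'_\ell\wedge i$ (with $\pi'_\ell\wedge\nu=\nu$ if $\pi_\ell=i$). Define $\pi\circ_i\mu\in\Pi((I\setminus\{i\})\sqcup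 J)$ by $$\pi\circ_i\mu=\sum_\sigma\varepsilon(\sigma)\,\pi_1\otimes\cdots\otimes\pi_{\ell-1}\otimes(\pi'_\ell\wedge\mu_1)\otimes\sigma(\pi_{\ell+1}\otimes\cdots\otimes\pi_p,\ \mu_2\otimes\cdots\otimes\mu_q),$$ where $\sigma$ runs over the shuffles of the sequence $\pi_{\ell+1},\dots,\pi_p$ with the sequence $\mu_2,\dots,\mu_q$, $\sigma(\cdots)$ is the tensor product of these blocks in the order given by $\sigma$, and $\varepsilon(\sigma)$ is the sign given by the Koszul rule (for the grading by dimension) for passing from $\pi_{\ell+1}\otimes\cdots\otimes\pi_p\otimes\mu_1\otimes\cdots\otimes\mu_q$ to $\mu_1\otimes\sigma(\pi_{\ell+1}\otimes\cdots\otimes\pi_p,\mu_2\otimes\cdots\otimes\mu_q)$. Bijections of finite sets act by relabelling. **Proposition.** (a) For every finite set $I$, $\Pi(I)$ is a free $\mathbb{Z}$-module with a basis indexed by the ordered partitions of $I$ into nonempty blocks, such that the class of every expression is, up to sign, the basis vector of its underlying ordered partition. (b) For every finite set $I$ with $n$ elements, let the permutohedron of $I$ be the convex hull in $\mathbb{R}^I$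 of the points $(\sigma(i))_{i\in I}$, for the bijections $\sigma:I\to\{1,\dots,n\}$. The map sending an ordered partition $(B_1,\dots,B_p)$ of $I$ to the convex hull of the points $(\sigma(i))_{i\in I}$ for those $\sigma$ such that $\sigma(x)<\sigma(y)$ whenever $x\in B_r$, $y\in B_s$ and $r<s$, is a bijection from the ordered partitions of $I$ onto the nonempty faces of the permutohedron. (c) With the grading by dimension, the differential $d$, the compositions $\circ_i$, the relabelling action and the element $1\in\Pi(\{1\})$ as unit, $\Pi$ is a differential graded symmetric operad, indexed by nonempty finite sets, in complexes of $\mathbb{Z}$-modules. That is: each $\Pi(I)$ is the direct sum of its homogeneous parts; $d$ has degree $+1$ and $d^2=0$; relabelling is functorial and is an action by morphisms of complexes; the compositions are equivariant and are morphisms of complexes $\Pi(I)\otimes\Pi(J)\to\Pi((I\setminus\{i\})\sqcup J)$, i.e. they add degrees and satisfy $d(a\circ_i b)=da\circ_i b+(-1)^{\dim a}a\circ_i db$ for homogeneous $a$; the unit is a cycle of degree $0$ and is a unit on both sides; and $(a\circ_i b)\circ_j c=a\circ_i(b\circ_j c)$ for $j\in J$, while $(a\circ_i b)\circ_k c=(-1)^{\dim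 b\,\dim c}(a\circ_k c)\circ_i b$ for $k\in I\setminus\{i\}$ and homogeneous $b\in\Pi(J)$, $c\in\Pi(K)$. -/

import Mathlib

universe u v

namespace PermOperad

/-! ## Differential graded symmetric operads

Operads are given by partial compositions and are indexed by finite nonempty sets, in the symmetric
monoidal category of (cochain) complexes of `ℤ`-modules. The finite set `I ∖ {i} ⊔ J` is the type
`{x : I // x ≠ i} ⊕ J`. -/

section Relabelling

variable {I : Type u} {J : Type u} {K : Type u}

/-- The bijection `I ∖ {i} ⊔ J ≃ I' ∖ {e i} ⊔ J'` induced by `e : I ≃ I'` and `f : J ≃ J'`. -/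
def substEquiv {I' J' : Type u} (e : I ≃ I') (i : I) (f : J ≃ J') :
    {x : I // x ≠ i} ⊕ J ≃ {x : I' // x ≠ e i} ⊕ J' :=
  Equiv.sumCongr (e.subtypeEquiv fun x => by simp) f

open Classical in
/-- The bijection `I ∖ {i} ⊔ {*} ≃ I` sending `*` to `i`. -/
noncomputable def unitRightEquiv (i : I) : {x : I // x ≠ i} ⊕ PUnit.{u + 1} ≃ I where
  toFun := Sum.elim (fun x => x.1) (fun _ => i)
  invFun x := if h : x = i then Sum.inr PUnit.unit else Sum.inl ⟨x, h⟩
  left_inv := by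
    rintro (⟨x, hx⟩ | x)
    · simp [hx]
    · simp
  right_inv x := by by_cases h : x = i <;> simp [h]

/-- The bijection `{*} ∖ {*} ⊔ J ≃ J`. -/
def unitLeftEquiv (J : Type u) : {x : PUnit.{u + 1} // x ≠ PUnit.unit} ⊕ J ≃ J where
  toFun := Sum.elim (fun x => absurd rfl x.2) id
  invFun := Sum.inr
  left_inv := by
    rintro (⟨x, hx⟩ | x)
    · exact absurd rfl hx
    · rfl
  right_inv _ := rfl

/-- The identification `(I ∖ {i} ⊔ J) ∖ {j} ⊔ K ≃ I ∖ {i} ⊔ (J ∖ {j} ⊔ K)` for `j : J`. -/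
def seqEquiv (i : I) (j : J) :
    {x : {x : I // x ≠ i} ⊕ J // x ≠ Sum.inr j} ⊕ K ≃ {x : I // x ≠ i} ⊕ ({y : J // y ≠ j} ⊕ K) where
  toFun
    | Sum.inl ⟨Sum.inl x, _⟩ => Sum.inl x
    | Sum.inl ⟨Sum.inr y, h⟩ => Sum.inr (Sum.inl ⟨y, fun e => h (congrArg Sum.inr e)⟩)
    | Sum.inr z => Sum.inr (Sum.inr z)
  invFun
    | Sum.inl x => Sum.inl ⟨Sum.inl x, Sum.inl_ne_inr⟩
    | Sum.inr (Sum.inl y) => Sum.inl ⟨Sum.inr y.1, fun e => y.2 (Sum.inr.inj e)⟩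
    | Sum.inr (Sum.inr z) => Sum.inr z
  left_inv := by rintro (⟨x | y, h⟩ | z) <;> rfl
  right_inv := by rintro (x | y | z) <;> rfl

/-- One direction of `parEquiv`. -/
def parFun (i k : I) (hik : i ≠ k) :
    {x : {x : I // x ≠ i} ⊕ J // x ≠ Sum.inl ⟨k, hik.symm⟩} ⊕ K →
      {x : {x : I // x ≠ k} ⊕ K // x ≠ Sum.inl ⟨i, hik⟩} ⊕ J
  | Sum.inl ⟨Sum.inl x, h⟩ =>
      Sum.inl ⟨Sum.inl ⟨x.1, fun e => h (congrArg Sum.inl (Subtype.ext e))⟩,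
        fun e => x.2 (congrArg Subtype.val (Sum.inl.inj e))⟩
  | Sum.inl ⟨Sum.inr y, _⟩ => Sum.inr y
  | Sum.inr z => Sum.inl ⟨Sum.inr z, Sum.inr_ne_inl⟩

/-- The identification `(I ∖ {i} ⊔ J) ∖ {k} ⊔ K ≃ (I ∖ {k} ⊔ K) ∖ {i} ⊔ J` for `i ≠ k` in `I`. -/
def parEquiv (i k : I) (hik : i ≠ k) :
    {x : {x : I // x ≠ i} ⊕ J // x ≠ Sum.inl ⟨k, hik.symm⟩} ⊕ K ≃
      {x : {x : I // x ≠ k} ⊕ K // x ≠ Sum.inl ⟨i, hik⟩} ⊕ J where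
  toFun := parFun i k hik
  invFun := parFun k i hik.symm
  left_inv := by rintro (⟨x | y, h⟩ | z) <;> rfl
  right_inv := by rintro (⟨x | y, h⟩ | z) <;> rfl

end Relabelling

/-- The data of a differential graded symmetric operad over `ℤ`: for each finite nonempty set `I` a
`ℤ`-module with a family of submodules (the homogeneous parts) and an endomorphism `d`; the action
of bijections; the partial compositions `a ∘_i b`; and an element of arity one. -/
structure DGOperadData where
  obj : (I : Type u) → [Finite I] → [Nonempty I] → Type v
  [grp : ∀ (I : Type u) [Finite I] [Nonempty I], AddCommGroup (obj I)]
  [mod : ∀ (I : Type u) [Finite I] [Nonempty I], Module ℤ (obj I)]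
  grade : ∀ (I : Type u) [Finite I] [Nonempty I], ℤ → Submodule ℤ (obj I)
  d : ∀ (I : Type u) [Finite I] [Nonempty I], obj I →ₗ[ℤ] obj I
  map : ∀ {I J : Type u} [Finite I] [Nonempty I] [Finite J] [Nonempty J],
    (I ≃ J) → obj I →ₗ[ℤ] obj J
  comp : ∀ {I J : Type u} [Finite I] [Nonempty I] [Finite J] [Nonempty J] (i : I),
    obj I →ₗ[ℤ] obj J →ₗ[ℤ] obj ({x : I // x ≠ i} ⊕ J)
  one : obj PUnit.{u + 1}

attribute [instance] DGOperadData.grp DGOperadData.mod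

/-- The axioms of a differential graded symmetric operad. -/
structure DGOperadData.IsDGOperad (P : DGOperadData.{u, v}) : Prop where
  /-- each `P(I)` is the direct sum of its homogeneous parts -/
  isInternal : ∀ (I : Type u) [Finite I] [Nonempty I], DirectSum.IsInternal (P.grade I)
  /-- `d` has degree `+1` -/
  d_mem : ∀ (I : Type u) [Finite I] [Nonempty I] (n : ℤ) (a : P.obj I),
    a ∈ P.grade I n → P.d I a ∈ P.grade I (n + 1)
  /-- `d` has square zero -/
  d_d : ∀ (I : Type u) [Finite I] [Nonempty I] (a : P.obj I), P.d I (P.d I a) = 0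
  /-- `P` is a functor from finite nonempty sets and bijections to complexes -/
  map_id : ∀ (I : Type u) [Finite I] [Nonempty I] (a : P.obj I), P.map (Equiv.refl I) a = a
  map_trans : ∀ {I J K : Type u} [Finite I] [Nonempty I] [Finite J] [Nonempty J] [Finite K]
    [Nonempty K] (e : I ≃ J) (f : J ≃ K) (a : P.obj I), P.map (e.trans f) a = P.map f (P.map e a)
  map_mem : ∀ {I J : Type u} [Finite I] [Nonempty I] [Finite J] [Nonempty J] (e : I ≃ J) (n : ℤ)
    (a : P.obj I), a ∈ P.grade I n → P.map e a ∈ P.grade J n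
  map_d : ∀ {I J : Type u} [Finite I] [Nonempty I] [Finite J] [Nonempty J] (e : I ≃ J)
    (a : P.obj I), P.map e (P.d I a) = P.d J (P.map e a)
  /-- each partial composition is a morphism of complexes `P(I) ⊗ P(J) → P(I ∖ {i} ⊔ J)` -/
  comp_mem : ∀ {I J : Type u} [Finite I] [Nonempty I] [Finite J] [Nonempty J] (i : I) (m n : ℤ)
    (a : P.obj I) (b : P.obj J), a ∈ P.grade I m → b ∈ P.grade J n →
    P.comp i a b ∈ P.grade ({x : I // x ≠ i} ⊕ J) (m + n)
  d_comp : ∀ {I J : Type u} [Finite I] [Nonempty I] [Finite J] [Nonempty J] (i : I) (m : ℤ)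
    (a : P.obj I) (b : P.obj J), a ∈ P.grade I m →
    P.d ({x : I // x ≠ i} ⊕ J) (P.comp i a b) =
      P.comp i (P.d I a) b + (m.negOnePow : ℤ) • P.comp i a (P.d J b)
  /-- equivariance of the compositions -/
  map_comp : ∀ {I J I' J' : Type u} [Finite I] [Nonempty I] [Finite J] [Nonempty J]
    [Finite I'] [Nonempty I'] [Finite J'] [Nonempty J'] (e : I ≃ I') (f : J ≃ J') (i : I)
    (a : P.obj I) (b : P.obj J),
    P.map (substEquiv e i f) (P.comp i a b) = P.comp (e i) (P.map e a) (P.map f b)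
  /-- the unit is a cycle of degree `0` -/
  one_mem : P.one ∈ P.grade PUnit.{u + 1} 0
  d_one : P.d PUnit.{u + 1} P.one = 0
  comp_one : ∀ {I : Type u} [Finite I] [Nonempty I] (i : I) (a : P.obj I),
    P.map (unitRightEquiv i) (P.comp i a P.one) = a
  one_comp : ∀ {J : Type u} [Finite J] [Nonempty J] (b : P.obj J),
    P.map (unitLeftEquiv J) (P.comp PUnit.unit P.one b) = b
  /-- sequential associativity: `(a ∘_i b) ∘_j c = a ∘_i (b ∘_j c)` for `j ∈ J` -/
  assoc_seq : ∀ {I J K : Type u} [Finite I] [Nonempty I] [Finite J] [Nonempty J] [Finite K]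
    [Nonempty K] (i : I) (j : J) (a : P.obj I) (b : P.obj J) (c : P.obj K),
    P.map (seqEquiv i j) (P.comp (Sum.inr j) (P.comp i a b) c) = P.comp i a (P.comp j b c)
  /-- parallel associativity: `(a ∘_i b) ∘_k c = (-1)^{|b||c|} (a ∘_k c) ∘_i b` for `i ≠ k` in `I` -/
  assoc_par : ∀ {I J K : Type u} [Finite I] [Nonempty I] [Finite J] [Nonempty J] [Finite K]
    [Nonempty K] (i k : I) (hik : i ≠ k) (m n : ℤ) (a : P.obj I) (b : P.obj J) (c : P.obj K),
    b ∈ P.grade J m → c ∈ P.grade K n →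
    P.map (parEquiv i k hik) (P.comp (Sum.inl ⟨k, hik.symm⟩) (P.comp i a b) c) =
      ((m * n).negOnePow : ℤ) • P.comp (Sum.inl ⟨i, hik⟩) (P.comp k a c) b

/-! ## The modules `Π(I)` -/

section Modules

variable {I : Type u} {J : Type u}

/-- `L = [π₁, …, π_p]` with `π_j = [i_{j,1}, …, i_{j,p_j}]` is an expression
`π₁ ⊗ ⋯ ⊗ π_p`, `π_j = i_{j,1} ∧ ⋯ ∧ i_{j,p_j}`, if the blocks are nonempty and each
element of `I` occurs exactly once. -/
def IsExpr (L : List (List I)) : Prop :=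
  (∀ b ∈ L, b ≠ []) ∧ L.flatten.Nodup ∧ ∀ i : I, i ∈ L.flatten

variable (I) in
/-- The expressions `π₁ ⊗ ⋯ ⊗ π_p` on the set `I`. -/
def Expr : Type u := {L : List (List I) // IsExpr L}

/-- `L'` arises from `L` by exchanging two neighbouring factors of one wedge block. -/
def Swap (L L' : List (List I)) : Prop :=
  ∃ (A B : List (List I)) (x y : List I) (a b : I),
    L = A ++ (x ++ a :: b :: y) :: B ∧ L' = A ++ (x ++ b :: a :: y) :: B

variable (I) in
/-- The submodule generated by the antisymmetry relations of the wedge blocks. -/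
noncomputable def antisymmetry : Submodule ℤ (Expr I →₀ ℤ) :=
  Submodule.span ℤ {r | ∃ e e' : Expr I, Swap e.1 e'.1 ∧
    r = Finsupp.single e 1 + Finsupp.single e' 1}

variable (I) in
/-- The module `Π(I)`: free on the expressions, modulo antisymmetry. -/
abbrev Perm : Type u := (Expr I →₀ ℤ) ⧸ antisymmetry I

/-- The class in `Π(I)` of an expression. -/
noncomputable def Expr.cls (e : Expr I) : Perm I := (antisymmetry I).mkQ (Finsupp.single e 1)

open Classical in
/-- The class in `Π(I)` of a list of blocks. The value `0` for lists that are not expressions is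
never used: see `isExpr_map`, `isExpr_mergeTerms` and `isExpr_compTerms`. -/
noncomputable def cls (L : List (List I)) : Perm I := if h : IsExpr L then Expr.cls ⟨L, h⟩ else 0

/-- The element `∑ s • [L]` of `Π(I)` given by a list of pairs `(s, L)`. -/
noncomputable def total (T : List (ℤ × List (List I))) : Perm I :=
  (T.map fun t => t.1 • cls t.2).sum

/-- The dimension of a block. -/
def bdim (b : List I) : ℕ := b.length - 1

/-- The dimension of `π₁ ⊗ ⋯ ⊗ π_p`. -/
def dim (L : List (List I)) : ℕ := (L.map bdim).sum

variable (I) in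
/-- The part of `Π(I)` of dimension `n`. -/
noncomputable def grade (n : ℤ) : Submodule ℤ (Perm I) :=
  Submodule.span ℤ {a | ∃ e : Expr I, (dim e.1 : ℤ) = n ∧ a = e.cls}

/-- The terms `(-1)^{dim π₁ + ⋯ + dim π_j} π₁ ⊗ ⋯ ⊗ π_j ∧ π_{j+1} ⊗ ⋯ ⊗ π_p` of the
differential of `π₁ ⊗ ⋯ ⊗ π_p`, for `j = 1, …, p - 1` in this order. -/
def mergeTerms : List (List I) → List (ℤ × List (List I))
  | [] => []
  | [_] => []
  | b :: c :: L =>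
    ((-1) ^ bdim b, (b ++ c) :: L) ::
      (mergeTerms (c :: L)).map fun t => ((-1) ^ bdim b * t.1, b :: t.2)

/-- All shuffles of two sequences of blocks, each with the Koszul sign (for the grading by
dimension) of the corresponding rearrangement of the concatenation. -/
def shuffles : List (List I) → List (List I) → List (ℤ × List (List I))
  | [], M => [(1, M)]
  | b :: L, [] => [(1, b :: L)]
  | b :: L, m :: M =>
    ((shuffles L (m :: M)).map fun t => (t.1, b :: t.2)) ++
      (shuffles (b :: L) M).map fun t => ((-1) ^ (bdim m * dim (b :: L)) * t.1, m :: t.2)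
  termination_by L M => L.length + M.length

open Classical in
/-- Deletes `i` from a block and views the other elements in `I ∖ {i} ⊔ J`. -/
noncomputable def strip (J : Type u) (i : I) (b : List I) : List ({x : I // x ≠ i} ⊕ J) :=
  b.filterMap fun x => if h : x = i then none else some (Sum.inl ⟨x, h⟩)

/-- Views a block of elements of `J` in `I ∖ {i} ⊔ J`. -/
def incl (i : I) (b : List J) : List ({x : I // x ≠ i} ⊕ J) := b.map Sum.inr

open Classical in
/-- The terms of `π ∘_i μ`. The blocks of `π` before the block `π_ℓ` containing `i` stay in
front. If `r` elements follow `i` in `π_ℓ`, then `π_ℓ = (-1)^r π'_ℓ ∧ i`; the block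
`π'_ℓ ∧ μ₁` comes next, and it is followed by the shuffles of the blocks after `π_ℓ` with `μ₂, …, μ_q`. The Koszul sign of
the passage from `π_{ℓ+1} ⊗ ⋯ ⊗ π_p ⊗ μ₁ ⊗ ⋯ ⊗ μ_q` to `μ₁ ⊗ σ(…)` is the product of that of moving
`μ₁` to the front and that of the shuffle. -/
noncomputable def compTerms (i : I) :
    List (List I) → List (List J) → List (ℤ × List (List ({x : I // x ≠ i} ⊕ J)))
  | [], _ => []
  | _ :: _, [] => []
  | b :: L, m :: M =>
    if i ∈ b then
      (shuffles (L.map (strip J i)) (M.map (incl i))).map fun t =>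
        ((-1) ^ (b.length - (b.idxOf i + 1)) * (-1) ^ (bdim m * dim L) * t.1,
          (strip J i b ++ incl i m) :: t.2)
    else (compTerms i L (m :: M)).map fun t => (t.1, strip J i b :: t.2)


/-! Every list produced by these operations is an expression. -/

theorem isExpr_of_perm {L M : List (List I)} (hL : IsExpr L) (h : L.flatten.Perm M.flatten)
    (hM : ∀ b ∈ M, b ≠ []) : IsExpr M :=
  ⟨hM, h.nodup_iff.1 hL.2.1, fun i => h.mem_iff.1 (hL.2.2 i)⟩

theorem isExpr_map {L : List (List I)} (hL : IsExpr L) (e : I ≃ J) :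
    IsExpr (L.map (List.map e)) := by
  refine ⟨?_, ?_, fun j => ?_⟩
  · intro b hb
    obtain ⟨c, hc, rfl⟩ := List.mem_map.1 hb
    simpa using hL.1 c hc
  · rw [← List.map_flatten]
    exact hL.2.1.map e.injective
  · rw [← List.map_flatten]
    exact List.mem_map.2 ⟨e.symm j, hL.2.2 _, by simp⟩

theorem mergeTerms_flatten (L : List (List I)) (hL : ∀ b ∈ L, b ≠ []) :
    ∀ t ∈ mergeTerms L, t.2.flatten = L.flatten ∧ ∀ b ∈ t.2, b ≠ [] := by
  induction L with
  | nil => simp [mergeTerms]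
  | cons b L ih =>
    cases L with
    | nil => simp [mergeTerms]
    | cons c L =>
      intro t ht
      rw [mergeTerms, List.mem_cons, List.mem_map] at ht
      rcases ht with rfl | ⟨s, hs, rfl⟩
      · refine ⟨by simp, fun x hx => ?_⟩
        rcases List.mem_cons.1 hx with rfl | hx
        · have := hL b (by simp)
          simp [this]
        · exact hL x (by simp [hx])
      · obtain ⟨h1, h2⟩ := ih (fun x hx => hL x (List.mem_cons_of_mem _ hx)) s hs
        refine ⟨by simp [h1], fun x hx => ?_⟩
        rcases List.mem_cons.1 hx with rfl | hx
        · exact hL _ (by simp)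
        · exact h2 x hx

theorem isExpr_mergeTerms {L : List (List I)} (hL : IsExpr L) :
    ∀ t ∈ mergeTerms L, IsExpr t.2 := fun t ht => by
  obtain ⟨h1, h2⟩ := mergeTerms_flatten L hL.1 t ht
  exact isExpr_of_perm hL (by rw [h1]) h2

theorem shuffles_perm (L M : List (List I)) : ∀ t ∈ shuffles L M, t.2.Perm (L ++ M) := by
  induction L, M using shuffles.induct with
  | case1 M => simp [shuffles]
  | case2 b L => simp [shuffles]
  | case3 b L m M ih1 ih2 =>
    intro t ht
    rw [shuffles, List.mem_append, List.mem_map, List.mem_map] at ht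
    rcases ht with ⟨s, hs, rfl⟩ | ⟨s, hs, rfl⟩
    · exact (ih1 s hs).cons b
    · exact ((ih2 s hs).cons m).trans List.perm_middle.symm

theorem strip_append (i : I) (x y : List I) : strip J i (x ++ y) = strip J i x ++ strip J i y := by
  simp [strip]

theorem strip_ne_nil {i : I} {b : List I} (hb : b ≠ []) (hi : i ∉ b) : strip J i b ≠ [] := by
  cases b with
  | nil => exact absurd rfl hb
  | cons x b =>
    have : x ≠ i := fun h => hi (by simp [h])
    simp [strip, this]

theorem strip_flatten (i : I) (L : List (List I)) :
    (L.map (strip J i)).flatten = strip J i L.flatten := by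
  induction L with
  | nil => simp [strip]
  | cons b L ih => rw [List.map_cons, List.flatten_cons, List.flatten_cons, ih, strip_append]

theorem incl_flatten (i : I) (L : List (List J)) :
    (L.map (incl i)).flatten = incl i L.flatten := by
  induction L with
  | nil => simp [incl]
  | cons b L ih => rw [List.map_cons, List.flatten_cons, List.flatten_cons, ih]; simp [incl]

theorem compTerms_flatten (i : I) (L : List (List I)) (M : List (List J))
    (hL : ∀ b ∈ L, b ≠ []) (hn : L.flatten.Nodup) (hM : ∀ b ∈ M, b ≠ []) :
    ∀ t ∈ compTerms i L M, t.2.flatten.Perm (strip J i L.flatten ++ incl i M.flatten) ∧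
      ∀ b ∈ t.2, b ≠ [] := by
  induction L with
  | nil => simp [compTerms]
  | cons b L ih =>
    cases M with
    | nil => simp [compTerms]
    | cons m M =>
      intro t ht
      rw [List.flatten_cons, List.nodup_append] at hn
      obtain ⟨_, hn2, hn3⟩ := hn
      rw [compTerms] at ht
      split_ifs at ht with hi
      · obtain ⟨s, hs, rfl⟩ := List.mem_map.1 ht
        have hp := shuffles_perm _ _ s hs
        constructor
        · have := hp.flatten
          rw [List.flatten_append, strip_flatten, incl_flatten] at this
          simp only [List.flatten_cons, strip_append, List.append_assoc]
          refine List.Perm.append_left _ ?_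
          refine (this.append_left _).trans ?_
          have e : incl i (m ++ M.flatten) = incl i m ++ incl i M.flatten := by simp [incl]
          rw [e, ← List.append_assoc, ← List.append_assoc]
          exact List.perm_append_comm.append_right _
        · intro x hx
          rcases List.mem_cons.1 hx with rfl | hx
          · have := hM m (by simp)
            simp [incl, this]
          · rcases List.mem_append.1 (hp.mem_iff.1 hx) with hx | hx
            · obtain ⟨c, hc, rfl⟩ := List.mem_map.1 hx
              refine strip_ne_nil (hL c (by simp [hc])) fun hic => ?_
              exact hn3 i hi i (List.mem_flatten.2 ⟨c, hc, hic⟩) rfl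
            · obtain ⟨c, hc, rfl⟩ := List.mem_map.1 hx
              have := hM c (by simp [hc])
              simp [incl, this]
      · obtain ⟨s, hs, rfl⟩ := List.mem_map.1 ht
        obtain ⟨h1, h2⟩ := ih (fun x hx => hL x (List.mem_cons_of_mem _ hx)) hn2 s hs
        constructor
        · simp only [List.flatten_cons, strip_append, List.append_assoc]
          exact h1.append_left _
        · intro x hx
          rcases List.mem_cons.1 hx with rfl | hx
          · exact strip_ne_nil (hL b (by simp)) hi
          · exact h2 x hx

theorem isExpr_compTerms (i : I) {L : List (List I)} {M : List (List J)}
    (hL : IsExpr L) (hM : IsExpr M) : ∀ t ∈ compTerms i L M, IsExpr t.2 := fun t ht => by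
  obtain ⟨h1, h2⟩ := compTerms_flatten i L M hL.1 hL.2.1 hM.1 t ht
  refine ⟨h2, h1.nodup_iff.2 ?_, fun z => h1.mem_iff.2 ?_⟩
  · refine List.nodup_append.2 ⟨?_, hM.2.1.map Sum.inr_injective, ?_⟩
    · refine hL.2.1.filterMap ?_
      intro x y z hx hy
      by_cases h : x = i <;> by_cases h' : y = i <;> simp_all
      rw [← hy] at hx
      simpa using hx
    · rintro x hx y hy rfl
      simp only [strip, incl, List.mem_filterMap, List.mem_map] at hx hy
      obtain ⟨a, _, ha⟩ := hx
      obtain ⟨c, _, rfl⟩ := hy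
      by_cases h : a = i <;> simp [h] at ha
  · rw [List.mem_append]
    rcases z with ⟨x, hx⟩ | y
    · exact Or.inl (List.mem_filterMap.2 ⟨x, hL.2.2 x, by simp [hx]⟩)
    · exact Or.inr (List.mem_map.2 ⟨y, hM.2.2 y, rfl⟩)

/-! The operations are compatible with the antisymmetry relations. -/

theorem swap_isExpr {L L' : List (List I)} (h : Swap L L') (hL : IsExpr L) : IsExpr L' := by
  obtain ⟨A, B, x, y, a, b, rfl, rfl⟩ := h
  refine isExpr_of_perm hL ?_ ?_
  · simp only [List.flatten_append, List.flatten_cons]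
    exact ((((List.Perm.swap b a y).append_left x).append_right _).append_left _)
  · intro c hc
    simp only [List.mem_append, List.mem_cons] at hc
    rcases hc with hc | rfl | hc
    · exact hL.1 c (by simp [hc])
    · simp
    · exact hL.1 c (by simp [hc])

theorem Swap.symm {L L' : List (List I)} (h : Swap L L') : Swap L' L := by
  obtain ⟨A, B, x, y, a, b, h1, h2⟩ := h
  exact ⟨A, B, x, y, b, a, h2, h1⟩

theorem Swap.cons {L L' : List (List I)} (h : Swap L L') (c : List I) : Swap (c :: L) (c :: L') := by
  obtain ⟨A, B, x, y, a, b, rfl, rfl⟩ := h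
  exact ⟨c :: A, B, x, y, a, b, rfl, rfl⟩

theorem cls_swap {L L' : List (List I)} (h : Swap L L') : cls L' = -cls L := by
  by_cases hL : IsExpr L
  · have hL' := swap_isExpr h hL
    rw [cls, cls, dif_pos hL, dif_pos hL', eq_neg_iff_add_eq_zero]
    unfold Expr.cls
    rw [← map_add, Submodule.mkQ_apply, Submodule.Quotient.mk_eq_zero]
    exact Submodule.subset_span ⟨⟨L', hL'⟩, ⟨L, hL⟩, h.symm, rfl⟩
  · have hL' : ¬ IsExpr L' := fun h' => hL (swap_isExpr h.symm h')
    rw [cls, cls, dif_neg hL, dif_neg hL', neg_zero]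

/-- Two signed lists of blocks represent opposite elements for an evident reason. -/
def Opp (t t' : ℤ × List (List I)) : Prop :=
  (t'.1 = t.1 ∧ Swap t.2 t'.2) ∨ (t'.1 = -t.1 ∧ t'.2 = t.2)

theorem total_opp {T T' : List (ℤ × List (List I))} (h : List.Forall₂ Opp T T') :
    total T' = -total T := by
  induction h with
  | nil => simp [total]
  | @cons t t' T T' h _ ih =>
    have e : t'.1 • cls t'.2 = -(t.1 • cls t.2) := by
      rcases h with ⟨h1, h2⟩ | ⟨h1, h2⟩
      · rw [h1, cls_swap h2, smul_neg]
      · rw [h1, h2, neg_smul]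
    simp only [total, List.map_cons, List.sum_cons] at ih ⊢
    rw [ih, e, neg_add]

theorem Opp.cons {t t' : ℤ × List (List I)} (h : Opp t t') (s : ℤ) (c : List I) :
    Opp (s * t.1, c :: t.2) (s * t'.1, c :: t'.2) := by
  rcases h with ⟨h1, h2⟩ | ⟨h1, h2⟩
  · exact Or.inl ⟨by rw [h1], h2.cons c⟩
  · exact Or.inr ⟨by simp [h1], by simp [h2]⟩

theorem forall₂_opp_cons {T T' : List (ℤ × List (List I))} (h : List.Forall₂ Opp T T') (s : ℤ)
    (c : List I) : List.Forall₂ Opp (T.map fun t => (s * t.1, c :: t.2))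
      (T'.map fun t => (s * t.1, c :: t.2)) := by
  rw [List.forall₂_map_left_iff, List.forall₂_map_right_iff]
  exact h.imp fun _ _ h => h.cons s c

theorem forall₂_of_forall {α β : Type*} {R : β → β → Prop} {f g : α → β} (T : List α)
    (h : ∀ t, R (f t) (g t)) : List.Forall₂ R (T.map f) (T.map g) := by
  rw [List.forall₂_map_left_iff, List.forall₂_map_right_iff]
  exact List.forall₂_same.2 fun t _ => h t

theorem Swap.bdim_eq (x y : List I) (a b : I) :
    bdim (x ++ b :: a :: y) = bdim (x ++ a :: b :: y) := by
  simp [bdim]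

theorem Swap.dim_eq {L L' : List (List I)} (h : Swap L L') : dim L' = dim L := by
  obtain ⟨A, B, x, y, a, b, rfl, rfl⟩ := h
  simp [dim, Swap.bdim_eq x y a b]

theorem swap_cases {b : List I} {L N : List (List I)} (h : Swap (b :: L) N) :
    (∃ x y p q, b = x ++ p :: q :: y ∧ N = (x ++ q :: p :: y) :: L) ∨
      ∃ L', Swap L L' ∧ N = b :: L' := by
  obtain ⟨A, B, x, y, p, q, h1, h2⟩ := h
  cases A with
  | nil =>
    simp only [List.nil_append, List.cons.injEq] at h1 h2
    obtain ⟨rfl, rfl⟩ := h1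
    exact Or.inl ⟨x, y, p, q, rfl, h2⟩
  | cons c A =>
    simp only [List.cons_append, List.cons.injEq] at h1 h2
    obtain ⟨rfl, rfl⟩ := h1
    exact Or.inr ⟨_, ⟨A, B, x, y, p, q, rfl, rfl⟩, h2⟩

theorem not_swap_nil {N : List (List I)} : ¬ Swap [] N := by
  rintro ⟨A, B, x, y, p, q, h1, _⟩
  simp at h1

theorem swap_head (x y : List I) (p q : I) (L : List (List I)) :
    Swap ((x ++ p :: q :: y) :: L) ((x ++ q :: p :: y) :: L) := ⟨[], L, x, y, p, q, rfl, rfl⟩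

theorem mergeTerms_swap {L L' : List (List I)} (h : Swap L L') :
    List.Forall₂ Opp (mergeTerms L) (mergeTerms L') := by
  induction L generalizing L' with
  | nil => exact absurd h not_swap_nil
  | cons b L ih =>
    rcases swap_cases h with ⟨x, y, p, q, rfl, rfl⟩ | ⟨L', hL, rfl⟩
    · cases L with
      | nil => exact List.Forall₂.nil
      | cons c L =>
        rw [mergeTerms, mergeTerms, Swap.bdim_eq x y p q]
        refine List.Forall₂.cons (Or.inl ⟨rfl, ?_⟩) (forall₂_of_forall _ fun t => ?_)
        · simpa using swap_head x (y ++ c) p q L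
        · exact Or.inl ⟨rfl, swap_head x y p q t.2⟩
    · cases L with
      | nil => exact absurd hL not_swap_nil
      | cons c L =>
        have ih' := ih hL
        rcases swap_cases hL with ⟨x, y, p, q, rfl, rfl⟩ | ⟨L', hL', rfl⟩
        · rw [mergeTerms, mergeTerms]
          refine List.Forall₂.cons (Or.inl ⟨rfl, ?_⟩) (forall₂_opp_cons ih' _ _)
          simpa using swap_head (b ++ x) y p q L
        · rw [mergeTerms, mergeTerms]
          exact List.Forall₂.cons (Or.inl ⟨rfl, hL'.cons _⟩) (forall₂_opp_cons ih' _ _)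

theorem map_one_mul (T : List (ℤ × List (List I))) (c : List I) :
    (T.map fun t => (t.1, c :: t.2)) = T.map fun t => (1 * t.1, c :: t.2) := by
  simp

theorem shuffles_swap_left (L M : List (List I)) : ∀ L', Swap L L' →
    List.Forall₂ Opp (shuffles L M) (shuffles L' M) := by
  induction L, M using shuffles.induct with
  | case1 M => exact fun _ h => absurd h not_swap_nil
  | case2 b L =>
    intro L' h
    cases L' with
    | nil => exact absurd h.symm not_swap_nil
    | cons b' L' =>
      rw [shuffles, shuffles]
      exact List.Forall₂.cons (Or.inl ⟨rfl, h⟩) List.Forall₂.nil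
  | case3 b L m M ih1 ih2 =>
    intro N h
    cases N with
    | nil => exact absurd h.symm not_swap_nil
    | cons b' L' =>
      rw [shuffles, shuffles, h.dim_eq]
      refine List.rel_append ?_ (forall₂_opp_cons (ih2 _ h) _ _)
      rcases swap_cases h with ⟨x, y, p, q, rfl, h2⟩ | ⟨L'', hL, h2⟩
      · obtain ⟨rfl, rfl⟩ := List.cons.inj h2
        exact forall₂_of_forall _ fun t => Or.inl ⟨rfl, swap_head x y p q t.2⟩
      · obtain ⟨rfl, rfl⟩ := List.cons.inj h2
        rw [map_one_mul, map_one_mul]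
        exact forall₂_opp_cons (ih1 _ hL) _ _

theorem shuffles_swap_right (L M : List (List I)) : ∀ M', Swap M M' →
    List.Forall₂ Opp (shuffles L M) (shuffles L M') := by
  induction L, M using shuffles.induct with
  | case1 M =>
    intro M' h
    rw [shuffles, shuffles]
    exact List.Forall₂.cons (Or.inl ⟨rfl, h⟩) List.Forall₂.nil
  | case2 b L => exact fun _ h => absurd h not_swap_nil
  | case3 b L m M ih1 ih2 =>
    intro N h
    cases N with
    | nil => exact absurd h.symm not_swap_nil
    | cons m' M' =>
      rw [shuffles, shuffles]
      refine List.rel_append ?_ ?_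
      · rw [map_one_mul, map_one_mul]
        exact forall₂_opp_cons (ih1 _ h) _ _
      rcases swap_cases h with ⟨x, y, p, q, rfl, h2⟩ | ⟨L'', hL, h2⟩
      · obtain ⟨rfl, rfl⟩ := List.cons.inj h2
        rw [Swap.bdim_eq x y p q]
        exact forall₂_of_forall _ fun t => Or.inl ⟨rfl, swap_head x y p q t.2⟩
      · obtain ⟨rfl, rfl⟩ := List.cons.inj h2
        exact forall₂_opp_cons (ih2 _ hL) _ _

theorem swap_map_incl (i : I) {M M' : List (List J)} (h : Swap M M') :
    Swap (M.map (incl i)) (M'.map (incl i)) := by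
  obtain ⟨A, B, x, y, a, b, rfl, rfl⟩ := h
  exact ⟨A.map (incl i), B.map (incl i), x.map Sum.inr, y.map Sum.inr, Sum.inr a, Sum.inr b,
    by simp [incl], by simp [incl]⟩

theorem strip_cons_self (i : I) (b : List I) : strip J i (i :: b) = strip J i b := by
  simp [strip]

theorem strip_cons_of_ne {i a : I} (h : a ≠ i) (b : List I) :
    strip J i (a :: b) = Sum.inl ⟨a, h⟩ :: strip J i b := by
  simp [strip, h]

theorem swap_map_strip {i : I} {L L' : List (List I)} (h : Swap L L') (hi : i ∉ L.flatten) :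
    Swap (L.map (strip J i)) (L'.map (strip J i)) := by
  obtain ⟨A, B, x, y, a, b, rfl, rfl⟩ := h
  have ha : a ≠ i := by rintro rfl; simp at hi
  have hb : b ≠ i := by rintro rfl; simp at hi
  refine ⟨A.map (strip J i), B.map (strip J i), strip J i x, strip J i y, Sum.inl ⟨a, ha⟩,
    Sum.inl ⟨b, hb⟩, ?_, ?_⟩ <;>
  simp [strip_append, strip_cons_of_ne ha, strip_cons_of_ne hb]

theorem compTerms_swap_right (i : I) (L : List (List I)) {M M' : List (List J)} (h : Swap M M') :
    List.Forall₂ Opp (compTerms i L M) (compTerms i L M') := by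
  induction L with
  | nil => simp [compTerms]
  | cons b L ih =>
    cases M with
    | nil => exact absurd h not_swap_nil
    | cons m M =>
      cases M' with
      | nil => exact absurd h.symm not_swap_nil
      | cons m' M' =>
        rw [compTerms, compTerms]
        split_ifs with hi
        · rcases swap_cases h with ⟨x, y, p, q, rfl, h2⟩ | ⟨L'', hL, h2⟩
          · obtain ⟨rfl, rfl⟩ := List.cons.inj h2
            rw [Swap.bdim_eq x y p q]
            refine forall₂_of_forall _ fun t => Or.inl ⟨rfl, ?_⟩
            have hs := swap_head (strip J i b ++ incl i x) (incl i y) (Sum.inr p) (Sum.inr q) t.2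
            rw [List.append_assoc, List.append_assoc] at hs
            simpa [incl] using hs
          · obtain ⟨rfl, rfl⟩ := List.cons.inj h2
            exact forall₂_opp_cons (shuffles_swap_right _ _ _ (swap_map_incl i hL)) _ _
        · rw [map_one_mul, map_one_mul]
          exact forall₂_opp_cons ih _ _

open Classical in
theorem sign_swap {i : I} (x y : List I) (p q : I) (hn : (x ++ p :: q :: y).Nodup) :
    (p ≠ i ∧ q ≠ i ∧ (i ∈ x ++ p :: q :: y →
      (x ++ q :: p :: y).idxOf i = (x ++ p :: q :: y).idxOf i)) ∨
    ((p = i ∨ q = i) ∧ (-1 : ℤ) ^ ((x ++ q :: p :: y).length - ((x ++ q :: p :: y).idxOf i + 1)) =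
      -(-1) ^ ((x ++ p :: q :: y).length - ((x ++ p :: q :: y).idxOf i + 1))) := by
  have hpx : p ∉ x := fun h => (List.nodup_append.1 hn).2.2 p h p (by simp) rfl
  have hqx : q ∉ x := fun h => (List.nodup_append.1 hn).2.2 q h q (by simp) rfl
  have hpq : p ≠ q := by
    have := (List.nodup_append.1 hn).2.1
    simp only [List.nodup_cons, List.mem_cons, not_or] at this
    exact this.1.1
  by_cases hp : p = i
  · subst hp
    right
    refine ⟨Or.inl rfl, ?_⟩
    rw [List.idxOf_append_of_notMem hpx, List.idxOf_append_of_notMem hpx,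
      List.idxOf_cons_ne _ hpq.symm, List.idxOf_cons_self, List.idxOf_cons_self]
    have e1 : (x ++ q :: p :: y).length - (x.length + Nat.succ 0 + 1) = y.length := by
      simp; omega
    have e2 : (x ++ p :: q :: y).length - (x.length + 0 + 1) = y.length + 1 := by
      simp; omega
    rw [e1, e2, pow_succ]; ring
  · by_cases hq : q = i
    · subst hq
      right
      refine ⟨Or.inr rfl, ?_⟩
      rw [List.idxOf_append_of_notMem hqx, List.idxOf_append_of_notMem hqx,
        List.idxOf_cons_ne _ hpq, List.idxOf_cons_self, List.idxOf_cons_self]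
      have e1 : (x ++ q :: p :: y).length - (x.length + 0 + 1) = y.length + 1 := by
        simp; omega
      have e2 : (x ++ p :: q :: y).length - (x.length + Nat.succ 0 + 1) = y.length := by
        simp; omega
      rw [e1, e2, pow_succ]; ring
    · left
      refine ⟨hp, hq, fun _ => ?_⟩
      by_cases hx : i ∈ x
      · rw [List.idxOf_append_of_mem hx, List.idxOf_append_of_mem hx]
      · rw [List.idxOf_append_of_notMem hx, List.idxOf_append_of_notMem hx,
          List.idxOf_cons_ne _ hp, List.idxOf_cons_ne _ hq, List.idxOf_cons_ne _ hp,
          List.idxOf_cons_ne _ hq]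

theorem compTerms_swap_left (i : I) {L L' : List (List I)} (M : List (List J))
    (hn : L.flatten.Nodup) (h : Swap L L') :
    List.Forall₂ Opp (compTerms i L M) (compTerms i L' M) := by
  induction L generalizing L' with
  | nil => exact absurd h not_swap_nil
  | cons b L ih =>
    cases L' with
    | nil => exact absurd h.symm not_swap_nil
    | cons b' L' =>
    cases M with
    | nil => simp [compTerms]
    | cons m M =>
      rw [List.flatten_cons, List.nodup_append] at hn
      obtain ⟨hn1, hn2, hn3⟩ := hn
      rw [compTerms, compTerms]
      rcases swap_cases h with ⟨x, y, p, q, rfl, h2⟩ | ⟨L'', hL, h2⟩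
      · obtain ⟨rfl, rfl⟩ := List.cons.inj h2
        have hmem : i ∈ x ++ q :: p :: y ↔ i ∈ x ++ p :: q :: y := by
          simp only [List.mem_append, List.mem_cons]; tauto
        have hstrip : p ≠ i → q ≠ i → ∀ (z : List ({x : I // x ≠ i} ⊕ J)) T,
            Swap ((strip J i (x ++ p :: q :: y) ++ z) :: T)
              ((strip J i (x ++ q :: p :: y) ++ z) :: T) := by
          intro hp hq z T
          simpa [strip_append, strip_cons_of_ne hp, strip_cons_of_ne hq] using
            swap_head (strip J i x) (strip J i y ++ z) (Sum.inl ⟨p, hp⟩) (Sum.inl ⟨q, hq⟩) T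
        by_cases hi : i ∈ x ++ p :: q :: y
        · rw [if_pos hi, if_pos (hmem.2 hi)]
          refine forall₂_of_forall _ fun t => ?_
          rcases sign_swap (i := i) x y p q hn1 with ⟨hp, hq, hs⟩ | ⟨hpq, hs⟩
          · refine Or.inl ⟨?_, hstrip hp hq _ _⟩
            simp only [hs hi, List.length_append, List.length_cons]
          · refine Or.inr ⟨by simp only [hs]; ring, ?_⟩
            rcases hpq with rfl | rfl
            · by_cases hq : q = p
              · subst hq; rfl
              · simp [strip_append, strip_cons_self, strip_cons_of_ne hq]
            · by_cases hp : p = q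
              · subst hp; rfl
              · simp [strip_append, strip_cons_self, strip_cons_of_ne hp]
        · rw [if_neg hi, if_neg (fun h => hi (hmem.1 h))]
          have hp : p ≠ i := by rintro rfl; simp at hi
          have hq : q ≠ i := by rintro rfl; simp at hi
          refine forall₂_of_forall _ fun t => Or.inl ⟨rfl, ?_⟩
          simpa using hstrip hp hq [] t.2
      · obtain ⟨rfl, rfl⟩ := List.cons.inj h2
        split_ifs with hi
        · rw [hL.dim_eq]
          refine forall₂_opp_cons (shuffles_swap_left _ _ _ (swap_map_strip hL ?_)) _ _
          exact fun h => hn3 i hi i h rfl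
        · rw [map_one_mul, map_one_mul]
          exact forall₂_opp_cons (ih hn2 hL) _ _

/-- A map on expressions that reverses its sign under `Swap` extends to a linear map on `Π(I)`. -/
noncomputable def lift {M : Type v} [AddCommGroup M] [Module ℤ M] (f : Expr I → M)
    (hf : ∀ e e' : Expr I, Swap e.1 e'.1 → f e' = -f e) : Perm I →ₗ[ℤ] M :=
  (antisymmetry I).liftQ (Finsupp.linearCombination ℤ f) (by
    rw [antisymmetry, Submodule.span_le]
    rintro r ⟨e, e', h, rfl⟩
    simp [hf e e' h])

@[simp] theorem lift_cls {M : Type v} [AddCommGroup M] [Module ℤ M] (f : Expr I → M)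
    (hf : ∀ e e' : Expr I, Swap e.1 e'.1 → f e' = -f e) (e : Expr I) :
    lift f hf e.cls = f e := by
  simp only [lift, Expr.cls, Submodule.mkQ_apply, Submodule.liftQ_apply,
    Finsupp.linearCombination_single]
  exact @one_smul ℤ M _ Module.toDistribMulAction.toMulAction (f e)

theorem perm_ext {M : Type v} [AddCommGroup M] [Module ℤ M] {f g : Perm I →ₗ[ℤ] M}
    (h : ∀ e : Expr I, f e.cls = g e.cls) : f = g := by
  refine Submodule.linearMap_qext _ (Finsupp.lhom_ext' fun e => LinearMap.ext_ring ?_)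
  exact h e

/-! ## The structure of `Π` -/

/-- The action of a bijection on `Π`. -/
noncomputable def relabel (σ : I ≃ J) : Perm I →ₗ[ℤ] Perm J :=
  lift (fun e => cls (e.1.map (List.map σ))) (by
    rintro e e' ⟨A, B, x, y, a, b, h1, h2⟩
    refine cls_swap ⟨A.map (List.map σ), B.map (List.map σ), x.map σ, y.map σ, σ a, σ b, ?_, ?_⟩
    · simp [h1]
    · simp [h2])

variable (I) in
/-- The differential
`d(π) = ∑_j (-1)^{dim π₁ + ⋯ + dim π_j} π₁ ⊗ ⋯ ⊗ π_j ∧ π_{j+1} ⊗ ⋯ ⊗ π_p`. -/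
noncomputable def differential : Perm I →ₗ[ℤ] Perm I :=
  lift (fun e => total (mergeTerms e.1)) fun _ _ h => total_opp (mergeTerms_swap h)

/-- The partial composition
`π ∘_i μ = ∑_σ ε(σ) π₁ ⊗ ⋯ ⊗ π_{ℓ-1} ⊗ π'_ℓ ∧ μ₁ ⊗ σ(π_{ℓ+1} ⊗ ⋯ ⊗ π_p, μ₂ ⊗ ⋯ ⊗ μ_q)`
for `π_ℓ = π'_ℓ ∧ i`. -/
noncomputable def compose (i : I) : Perm I →ₗ[ℤ] Perm J →ₗ[ℤ] Perm ({x : I // x ≠ i} ⊕ J) :=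
  lift
    (fun e => lift (fun f => total (compTerms i e.1 f.1))
      fun _ _ h => total_opp (compTerms_swap_right i e.1 h))
    fun e e' h => perm_ext fun f => by
      simpa using total_opp (compTerms_swap_left i f.1 e.2.2.1 h)

end Modules

/-- The differential graded operad `Π`. -/
noncomputable def permOperad : DGOperadData.{u, u} where
  obj I := Perm I
  grade I := grade I
  d I := differential I
  map σ := relabel σ
  comp i := compose i
  one := cls [[PUnit.unit]]

/-! ## Ordered partitions and faces of the permutohedron -/

/-- Ordered partitions `(B₁, …, B_p)` of `I` into nonempty blocks. -/
structure OrderedPartition (I : Type u) where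
  blocks : List (Finset I)
  nonempty : ∀ B ∈ blocks, B.Nonempty
  disjoint : blocks.Pairwise Disjoint
  cover : ∀ i : I, ∃ B ∈ blocks, i ∈ B

open Classical in
/-- The ordered partition of `I` underlying an expression. -/
noncomputable def Expr.partition {I : Type u} (e : Expr I) : OrderedPartition I where
  blocks := e.1.map List.toFinset
  nonempty := by
    intro B hB
    obtain ⟨b, hb, rfl⟩ := List.mem_map.1 hB
    exact List.toFinset_nonempty_iff _ |>.2 (e.2.1 b hb)
  disjoint := by
    have h := (List.nodup_flatten.1 e.2.2.1).2
    refine List.pairwise_map.2 (h.imp fun {b c} hbc => ?_)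
    exact List.disjoint_toFinset_iff_disjoint.2 hbc
  cover i := by
    obtain ⟨b, hb, hi⟩ := List.mem_flatten.1 (e.2.2.2 i)
    exact ⟨_, List.mem_map_of_mem hb, List.mem_toFinset.2 hi⟩

/-- The point of `ℝ^I` whose coordinates are given by a numbering of `I` by `1, …, n`. -/
def vertex {I : Type u} (σ : I ≃ Fin (Nat.card I)) : I → ℝ := fun i => ((σ i : ℕ) : ℝ) + 1

/-- The permutohedron in `ℝ^I`. -/
def permutohedron (I : Type u) : Set (I → ℝ) := convexHull ℝ (Set.range (vertex (I := I)))

/-- The convex hull of the vertices of the permutohedron given by the numberings of `I` that number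
the elements of each block of `P` before those of the later blocks. -/
def faceOf {I : Type u} (P : OrderedPartition I) : Set (I → ℝ) :=
  convexHull ℝ (vertex '' {σ | P.blocks.Pairwise fun B C => ∀ i ∈ B, ∀ j ∈ C, σ i < σ j})

end PermOperad

/-! Part (a): antisymmetry allows each wedge block to be sorted, at the cost of the sign of the
sorting permutation. After a choice of a linear order on `I`, the product of these signs over the
blocks (`blockSign`) changes sign under every generating relation (`blockSign_swap`), so signed
coordinates indexed by ordered partitions are well defined. Conversely, `blockSign_smul` shows that
the signed class of an expression depends only on its underlying ordered partition. The two maps are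
inverse to each other (`basis`).

Part (c): since `Π(I)` is free, two of its elements are equal once all integer-valued functionals
agree on them (`perm_eq_of_dual`). A functional pulled back along `cls` is an alternating function φ
on lists of blocks (`IsAlt`), and each axiom involving the differential or a composition becomes an
identity of integers built from φ by `evalD`, `evalSh` and `evalComp`. These three satisfy
recursions on the first block; that block is absorbed into φ, which is why the inductions run over
all φ at once. The shuffle product is graded commutative, associative and compatible with the
differential (`evalSh_comm`, `evalSh_assoc`, `evalSh_evalD`). A composition fixes the blocks before
the substituted one and shuffles everything after it, so its properties reduce to those of shuffles:
the Leibniz rule (`evalComp_evalD`) to compatibility with the differential, sequential associativity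
(`evalComp_assoc`) to associativity, and parallel associativity (`Exchange.evalComp_comm`) to
commutativity and associativity. Antisymmetry enters when a merged or doubly substituted block has
to be reordered.

Part (b): by the rearrangement inequality, the linear form with coefficients `w` is maximal on
exactly those vertices whose numbering increases with `w`; its maximizers on the permutohedron are
their convex hull (`permutohedron_maximizers`). This set depends only on the ordered partition of
`I` into level sets of `w`, and each ordered partition arises from its own rank function.
Injectivity holds because the vertices of a face recover the order of the blocks
(`rank_lt_rank_iff`). -/

namespace PermOperad

/-! ## Functionals on lists of blocks -/

section Functionals

variable {X Y Z : Type*}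

/-- The value on a signed list of lists of blocks of the linear extension of a function. -/
def evalTerms (φ : List (List X) → ℤ) (T : List (ℤ × List (List X))) : ℤ :=
  (T.map fun t => t.1 * φ t.2).sum

@[simp] theorem evalTerms_nil (φ : List (List X) → ℤ) : evalTerms φ [] = 0 := rfl

@[simp] theorem evalTerms_cons (φ : List (List X) → ℤ) (t : ℤ × List (List X))
    (T : List (ℤ × List (List X))) :
    evalTerms φ (t :: T) = t.1 * φ t.2 + evalTerms φ T := by
  simp [evalTerms]

@[simp] theorem evalTerms_append (φ : List (List X) → ℤ) (T T' : List (ℤ × List (List X))) :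
    evalTerms φ (T ++ T') = evalTerms φ T + evalTerms φ T' := by
  simp [evalTerms]

theorem evalTerms_map (φ : List (List X) → ℤ) (s : ℤ) (h : List (List Y) → List (List X))
    (T : List (ℤ × List (List Y))) :
    evalTerms φ (T.map fun t => (s * t.1, h t.2)) = s * evalTerms (fun L => φ (h L)) T := by
  induction T with
  | nil => simp
  | cons t T ih => rw [List.map_cons, evalTerms_cons, evalTerms_cons, ih]; ring

theorem evalTerms_map_one (φ : List (List X) → ℤ) (h : List (List Y) → List (List X))
    (T : List (ℤ × List (List Y))) :
    evalTerms φ (T.map fun t => (t.1, h t.2)) = evalTerms (fun L => φ (h L)) T := by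
  simpa using evalTerms_map φ 1 h T

theorem evalTerms_add (φ ψ : List (List X) → ℤ) (T : List (ℤ × List (List X))) :
    evalTerms (fun L => φ L + ψ L) T = evalTerms φ T + evalTerms ψ T := by
  induction T with
  | nil => simp
  | cons t T ih => rw [evalTerms_cons, evalTerms_cons, evalTerms_cons, ih]; ring

theorem evalTerms_mul (s : ℤ) (φ : List (List X) → ℤ) (T : List (ℤ × List (List X))) :
    evalTerms (fun L => s * φ L) T = s * evalTerms φ T := by
  induction T with
  | nil => simp
  | cons t T ih => rw [evalTerms_cons, evalTerms_cons, ih]; ring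

theorem evalTerms_congr {φ ψ : List (List X) → ℤ} {T : List (ℤ × List (List X))}
    (h : ∀ t ∈ T, φ t.2 = ψ t.2) : evalTerms φ T = evalTerms ψ T := by
  unfold evalTerms
  exact congrArg List.sum (List.map_congr_left fun t ht => by rw [h t ht])

@[simp] theorem evalTerms_zero (T : List (ℤ × List (List X))) :
    evalTerms (fun _ => 0) T = 0 := by
  simpa using evalTerms_mul 0 (fun _ => 0) T

/-- A function on lists of blocks changes its sign when two neighbouring factors of a block are
exchanged. -/
def IsAlt (φ : List (List X) → ℤ) : Prop := ∀ L L', Swap L L' → φ L' = -φ L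

theorem IsAlt.cons {φ : List (List X) → ℤ} (h : IsAlt φ) (b : List X) :
    IsAlt fun L => φ (b :: L) := fun _ _ hL => h _ _ (hL.cons b)

/-- The factor `a` crosses the factors of `c` one at a time, with one sign for each exchange. -/
theorem IsAlt.move {φ : List (List X) → ℤ} (h : IsAlt φ) (x c y : List X) (a : X)
    (L : List (List X)) :
    φ ((x ++ a :: (c ++ y)) :: L) = (-1) ^ c.length * φ ((x ++ (c ++ a :: y)) :: L) := by
  induction c generalizing x with
  | nil => simp
  | cons p c ih =>
    have h1 := h _ _ (swap_head x (c ++ y) p a L)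
    have h2 := ih (x ++ [p])
    simp only [List.append_assoc, List.cons_append, List.nil_append] at h2
    rw [List.cons_append, h1, h2, List.length_cons, pow_succ, List.cons_append]
    ring

/-- Each factor of `b` crosses all of `c`. The exponent involves lengths, not dimensions: inside a
block each single factor is odd. -/
theorem IsAlt.comm {φ : List (List X) → ℤ} (h : IsAlt φ) (x b c y : List X) (L : List (List X)) :
    φ ((x ++ (b ++ (c ++ y))) :: L) =
      (-1) ^ (b.length * c.length) * φ ((x ++ (c ++ (b ++ y))) :: L) := by
  induction b generalizing x with
  | nil => simp
  | cons a b ih =>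
    have h2 := ih (x ++ [a])
    simp only [List.append_assoc, List.cons_append, List.nil_append] at h2
    rw [List.cons_append, h2, h.move x c (b ++ y) a L, List.length_cons, add_mul, pow_add]
    simp only [List.cons_append]
    ring

theorem IsAlt.comm' {φ : List (List X) → ℤ} (h : IsAlt φ) (x b c : List X) (L : List (List X)) :
    φ ((x ++ b ++ c) :: L) = (-1) ^ (b.length * c.length) * φ ((x ++ c ++ b) :: L) := by
  simpa using h.comm x b c [] L

/-! ### Dimensions -/

@[simp] theorem dim_nil : dim ([] : List (List X)) = 0 := rfl

@[simp] theorem dim_cons (b : List X) (L : List (List X)) : dim (b :: L) = bdim b + dim L := by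
  simp [dim]

@[simp] theorem dim_append (L M : List (List X)) : dim (L ++ M) = dim L + dim M := by
  simp [dim]

theorem length_eq_bdim {b : List X} (hb : b ≠ []) : b.length = bdim b + 1 := by
  have := List.length_pos_iff.2 hb
  unfold bdim; omega

theorem bdim_append {b c : List X} (hb : b ≠ []) (hc : c ≠ []) :
    bdim (b ++ c) = bdim b + bdim c + 1 := by
  have h1 := length_eq_bdim hb
  have h2 := length_eq_bdim hc
  have h3 : bdim (b ++ c) = b.length + c.length - 1 := by simp [bdim]
  omega

theorem dim_perm {L M : List (List X)} (h : L.Perm M) : dim L = dim M :=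
  (h.map bdim).sum_eq

theorem dim_shuffles {L M : List (List X)} : ∀ t ∈ shuffles L M, dim t.2 = dim L + dim M :=
  fun t ht => by rw [dim_perm (shuffles_perm L M t ht), dim_append]

theorem mem_shuffles {L M : List (List X)} : ∀ t ∈ shuffles L M, ∀ b ∈ t.2, b ∈ L ∨ b ∈ M :=
  fun t ht _ hb => List.mem_append.1 ((shuffles_perm L M t ht).mem_iff.1 hb)

theorem dim_mergeTerms {L : List (List X)} (hL : ∀ b ∈ L, b ≠ []) :
    ∀ t ∈ mergeTerms L, dim t.2 = dim L + 1 := by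
  induction L with
  | nil => simp [mergeTerms]
  | cons b L ih =>
    cases L with
    | nil => simp [mergeTerms]
    | cons c L =>
      intro t ht
      rw [mergeTerms, List.mem_cons, List.mem_map] at ht
      rcases ht with rfl | ⟨s, hs, rfl⟩
      · simp only [dim_cons, bdim_append (hL b (by simp)) (hL c (by simp))]; ring
      · simp only [dim_cons, ih (fun x hx => hL x (List.mem_cons_of_mem _ hx)) s hs]; ring

/-! ### The differential -/

/-- The value of a function on the differential of a list of blocks. -/
def evalD (φ : List (List X) → ℤ) (L : List (List X)) : ℤ := evalTerms φ (mergeTerms L)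

/-- The value of a function on the list of blocks obtained by merging a block with the first
block of a list. -/
def mergeHead (b : List X) (φ : List (List X) → ℤ) : List (List X) → ℤ
  | [] => 0
  | c :: L => φ ((b ++ c) :: L)

@[simp] theorem mergeHead_nil (b : List X) (φ : List (List X) → ℤ) : mergeHead b φ [] = 0 := rfl

@[simp] theorem mergeHead_cons (b : List X) (φ : List (List X) → ℤ) (c : List X)
    (L : List (List X)) : mergeHead b φ (c :: L) = φ ((b ++ c) :: L) := rfl

@[simp] theorem evalD_nil (φ : List (List X) → ℤ) : evalD φ [] = 0 := rfl

/-- The sign of the first block is common to its merge with the next block and to all later merges.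
This recursion drives every induction involving the differential. -/
theorem evalD_cons (φ : List (List X) → ℤ) (b : List X) (L : List (List X)) :
    evalD φ (b :: L) = (-1) ^ bdim b * (mergeHead b φ L + evalD (fun N => φ (b :: N)) L) := by
  cases L with
  | nil => simp [evalD, mergeTerms, mergeHead]
  | cons c L =>
    rw [evalD, mergeTerms, evalTerms_cons, evalTerms_map φ ((-1) ^ bdim b) (fun N => b :: N)]
    simp only [mergeHead, evalD]
    ring

/-- Every term of the differential has dimension one higher than its argument, so a sign depending
on that dimension can be treated as a constant. -/
theorem evalD_dim {φ ψ : List (List X) → ℤ} {L : List (List X)} (hL : ∀ b ∈ L, b ≠ [])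
    (h : ∀ N, dim N = dim L + 1 → φ N = ψ N) : evalD φ L = evalD ψ L :=
  evalTerms_congr fun t ht => h _ (dim_mergeTerms hL t ht)

/-- Merges that do not involve the first block `b` cancel by induction. What remains merges `b` with
`c` before or after another merge; the two orders carry opposite signs because `b ∧ c` has dimension
`dim b + dim c + 1`. -/
theorem evalD_evalD (φ : List (List X) → ℤ) (L : List (List X)) (hL : ∀ b ∈ L, b ≠ []) :
    evalD (evalD φ) L = 0 := by
  induction L generalizing φ with
  | nil => rfl
  | cons b L ih =>
    have hL' : ∀ c ∈ L, c ≠ [] := fun c hc => hL c (List.mem_cons_of_mem _ hc)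
    have h1 : evalD (fun N => evalD φ (b :: N)) L = (-1) ^ bdim b * evalD (mergeHead b φ) L := by
      simp only [evalD_cons φ b]
      have := ih (fun N => φ (b :: N)) hL'
      unfold evalD at this ⊢
      rw [evalTerms_mul, evalTerms_add, this, add_zero]
    rw [evalD_cons, h1]
    cases L with
    | nil => simp [mergeHead]
    | cons c L =>
      rw [evalD_cons]
      simp only [mergeHead_cons, evalD_cons φ (b ++ c)]
      have h2 : mergeHead c (mergeHead b φ) L = mergeHead (b ++ c) φ L := by
        cases L <;> simp [mergeHead]
      rw [h2, bdim_append (hL b (by simp)) (hL c (by simp)), pow_succ, pow_add]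
      ring

/-! ### Shuffles -/

/-- The value of a function on the shuffle product of two lists of blocks. -/
def evalSh (φ : List (List X) → ℤ) (L M : List (List X)) : ℤ := evalTerms φ (shuffles L M)

@[simp] theorem evalSh_nil_left (φ : List (List X) → ℤ) (M : List (List X)) :
    evalSh φ [] M = φ M := by
  simp [evalSh, shuffles]

@[simp] theorem evalSh_nil_right (φ : List (List X) → ℤ) (L : List (List X)) :
    evalSh φ L [] = φ L := by
  cases L <;> simp [evalSh, shuffles]

theorem evalSh_cons (φ : List (List X) → ℤ) (b m : List X) (L M : List (List X)) :
    evalSh φ (b :: L) (m :: M) = evalSh (fun N => φ (b :: N)) L (m :: M) +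
      (-1) ^ (bdim m * (bdim b + dim L)) * evalSh (fun N => φ (m :: N)) (b :: L) M := by
  rw [evalSh, shuffles, evalTerms_append, evalTerms_map_one φ (fun N => b :: N),
    evalTerms_map φ _ (fun N => m :: N), dim_cons]
  rfl

theorem evalSh_add (φ ψ : List (List X) → ℤ) (L M : List (List X)) :
    evalSh (fun N => φ N + ψ N) L M = evalSh φ L M + evalSh ψ L M := evalTerms_add _ _ _

theorem evalSh_mul (s : ℤ) (φ : List (List X) → ℤ) (L M : List (List X)) :
    evalSh (fun N => s * φ N) L M = s * evalSh φ L M := evalTerms_mul _ _ _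

/-- Shuffling only permutes blocks, so a Koszul sign depending on the total dimension is constant
over all shuffles and can be pulled out of the sum. -/
theorem evalSh_congr {φ ψ : List (List X) → ℤ} {L M : List (List X)}
    (h : ∀ N, dim N = dim L + dim M → (∀ b ∈ N, b ∈ L ∨ b ∈ M) → φ N = ψ N) :
    evalSh φ L M = evalSh ψ L M :=
  evalTerms_congr fun t ht => h _ (dim_shuffles t ht) (mem_shuffles t ht)

theorem neg_one_pow_mul_neg_one_pow (n : ℕ) : ((-1 : ℤ) ^ n) * (-1) ^ n = 1 := by
  rw [← mul_pow]; simp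

/-- Graded commutativity, by comparing which argument supplies the first block. Interchanging the
roles of `L` and `M` leaves the set of interleavings unchanged and alters only the Koszul signs. -/
theorem evalSh_comm (φ : List (List X) → ℤ) (L M : List (List X)) :
    evalSh φ L M = (-1) ^ (dim L * dim M) * evalSh φ M L := by
  induction L generalizing φ M with
  | nil => simp
  | cons b L ihL =>
    induction M generalizing φ with
    | nil => simp
    | cons m M ihM =>
      rw [evalSh_cons, evalSh_cons, ihL, ihM]
      simp only [dim_cons, mul_add, add_mul, pow_add, mul_comm (bdim m)]
      -- From here on only the relation `s * s = 1` for each sign is needed, so the signs are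
      -- replaced by independent variables.
      have h1 := neg_one_pow_mul_neg_one_pow (bdim b * bdim m)
      have h2 := neg_one_pow_mul_neg_one_pow (bdim b * dim M)
      have h3 := neg_one_pow_mul_neg_one_pow (dim L * bdim m)
      generalize (-1 : ℤ) ^ (bdim b * bdim m) = s1 at *
      generalize (-1 : ℤ) ^ (bdim b * dim M) = s2 at *
      generalize (-1 : ℤ) ^ (dim L * bdim m) = s3 at *
      grind

/-- Both sides sum over the interleavings of three lists. Split by the list supplying the first
block; the Koszul signs for that block agree because they depend only on the dimension of what it
jumps over. -/
theorem evalSh_assoc (φ : List (List X) → ℤ) (L M N : List (List X)) :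
    evalSh (fun T => evalSh φ T N) L M = evalSh (fun T => evalSh φ L T) M N := by
  induction L generalizing φ M N with
  | nil => simp
  | cons b L ihL =>
    induction M generalizing φ N with
    | nil => simp
    | cons m M ihM =>
      induction N generalizing φ with
      | nil => simp
      | cons n N ihN =>
        have e1 : evalSh (fun T => evalSh φ (b :: T) (n :: N)) L (m :: M) =
            evalSh (fun T => evalSh (fun S => φ (b :: S)) T (n :: N)) L (m :: M) +
            (-1) ^ (bdim n * (bdim b + (dim L + (bdim m + dim M)))) *
              evalSh (fun T => evalSh (fun S => φ (n :: S)) (b :: T) N) L (m :: M) := by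
          simp only [evalSh_cons φ b n, evalSh_add]
          rw [← evalSh_mul]
          congr 1
          refine evalSh_congr fun T hT _ => ?_
          rw [hT, dim_cons]
        have e2 : evalSh (fun T => evalSh φ (m :: T) (n :: N)) (b :: L) M =
            evalSh (fun T => evalSh (fun S => φ (m :: S)) T (n :: N)) (b :: L) M +
            (-1) ^ (bdim n * (bdim b + (dim L + (bdim m + dim M)))) *
              evalSh (fun T => evalSh (fun S => φ (n :: S)) (m :: T) N) (b :: L) M := by
          simp only [evalSh_cons φ m n, evalSh_add]
          rw [← evalSh_mul]
          congr 1
          refine evalSh_congr fun T hT _ => ?_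
          rw [hT, dim_cons]
          congr 2
          ring
        have e3 : evalSh (fun T => evalSh φ (b :: L) (m :: T)) M (n :: N) =
            evalSh (fun T => evalSh (fun S => φ (b :: S)) L (m :: T)) M (n :: N) +
            (-1) ^ (bdim m * (bdim b + dim L)) *
              evalSh (fun T => evalSh (fun S => φ (m :: S)) (b :: L) T) M (n :: N) := by
          simp only [evalSh_cons φ b m, evalSh_add, evalSh_mul]
        have e4 : evalSh (fun T => evalSh φ (b :: L) (n :: T)) (m :: M) N =
            evalSh (fun T => evalSh (fun S => φ (b :: S)) L (n :: T)) (m :: M) N +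
            (-1) ^ (bdim n * (bdim b + dim L)) *
              evalSh (fun T => evalSh (fun S => φ (n :: S)) (b :: L) T) (m :: M) N := by
          simp only [evalSh_cons φ b n, evalSh_add, evalSh_mul]
        -- One induction hypothesis for each list that can supply the first block.
        have h1 := ihL (fun S => φ (b :: S)) (m :: M) (n :: N)
        have h2 := ihM (fun S => φ (m :: S)) (n :: N)
        have h3 := ihN (fun S => φ (n :: S))
        rw [evalSh_cons] at h3
        rw [evalSh_cons _ m n] at h1
        rw [evalSh_cons, evalSh_cons _ m n, e1, e2, e3, e4, h1, h2, ← h3]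
        simp only [mul_add, pow_add]
        ring

/-- The shuffle product is a morphism of complexes. -/
theorem evalSh_evalD {φ : List (List X) → ℤ} (hφ : IsAlt φ) (L M : List (List X))
    (hL : ∀ b ∈ L, b ≠ []) (hM : ∀ b ∈ M, b ≠ []) :
    evalSh (evalD φ) L M = evalD (fun N => evalSh φ N M) L +
      (-1) ^ dim L * evalD (fun N => evalSh φ L N) M := by
  induction L generalizing φ M with
  | nil => simp
  | cons b L ihL =>
    induction M generalizing φ with
    | nil => simp
    | cons m M ihM =>
      have hb : b ≠ [] := hL b (by simp)
      have hm : m ≠ [] := hM m (by simp)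
      have hL' : ∀ c ∈ L, c ≠ [] := fun c hc => hL c (List.mem_cons_of_mem _ hc)
      have hM' : ∀ c ∈ M, c ≠ [] := fun c hc => hM c (List.mem_cons_of_mem _ hc)
      have i1 := ihL (hφ.cons b) (m :: M) hL' hM
      have i2 := ihM (hφ.cons m) hM'
      have d1 : evalD (fun N => evalSh φ (b :: N) (m :: M)) L =
          evalD (fun N => evalSh (fun S => φ (b :: S)) N (m :: M)) L +
          (-1) ^ (bdim m * (bdim b + (dim L + 1))) *
            evalD (fun N => evalSh (fun S => φ (m :: S)) (b :: N) M) L := by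
        unfold evalD
        rw [← evalTerms_mul, ← evalTerms_add]
        refine evalD_dim hL' fun N hN => ?_
        rw [evalSh_cons, hN]
      have d2 : evalD (fun N => evalSh φ (b :: L) (m :: N)) M =
          evalD (fun N => evalSh (fun S => φ (b :: S)) L (m :: N)) M +
          (-1) ^ (bdim m * (bdim b + dim L)) *
            evalD (fun N => evalSh (fun S => φ (m :: S)) (b :: L) N) M := by
        unfold evalD
        rw [← evalTerms_mul, ← evalTerms_add]
        simp only [evalSh_cons]
      -- A shuffle starting with `b` continues with the next block of `L` (contributing `x`, common
      -- to both sides) or with `m`. The merge `b ∧ m` of blocks from different lists has no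
      -- counterpart on the right.
      have k1 : ∃ x, evalSh (mergeHead b φ) L (m :: M) =
            x + (-1) ^ (bdim m * dim L) * evalSh (fun S => φ ((b ++ m) :: S)) L M ∧
          mergeHead b (fun N => evalSh φ N (m :: M)) L =
            x + (-1) ^ (bdim m * (bdim b + dim L + 1)) *
              mergeHead b (fun N => evalSh (fun S => φ (m :: S)) N M) L := by
        cases L with
        | nil => exact ⟨0, by simp [mergeHead], by simp [mergeHead]⟩
        | cons c L =>
          refine ⟨evalSh (fun S => φ ((b ++ c) :: S)) L (m :: M), ?_, ?_⟩
          · rw [evalSh_cons]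
            simp only [mergeHead, dim_cons]
          · simp only [mergeHead]
            rw [evalSh_cons, bdim_append hb (hL c (by simp)), dim_cons]
            congr 3
            ring
      -- The same splitting for shuffles starting with `m`; the foreign term is now the merge `m ∧
      -- b`.
      have k2 : ∃ y, evalSh (mergeHead m φ) (b :: L) M =
            evalSh (fun S => φ ((m ++ b) :: S)) L M + y ∧
          mergeHead m (fun N => evalSh φ (b :: L) N) M =
            mergeHead m (fun N => evalSh (fun S => φ (b :: S)) L N) M +
            (-1) ^ ((bdim m + 1) * (bdim b + dim L)) * y := by
        cases M with
        | nil => exact ⟨0, by simp [mergeHead], by simp [mergeHead]⟩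
        | cons n M =>
          refine ⟨(-1) ^ (bdim n * (bdim b + dim L)) *
            evalSh (fun S => φ ((m ++ n) :: S)) (b :: L) M, ?_, ?_⟩
          · rw [evalSh_cons]
            simp only [mergeHead]
          · simp only [mergeHead]
            rw [evalSh_cons, bdim_append hm (hM n (by simp)), ← mul_assoc, ← pow_add]
            congr 3
            ring
      obtain ⟨x, hx1, hx2⟩ := k1
      obtain ⟨y, hy1, hy2⟩ := k2
      -- The two foreign terms agree up to sign by antisymmetry, with block lengths `dim + 1`, and
      -- then cancel. This is the only use of the alternation of φ outside the induction hypotheses.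
      have hc : evalSh (fun S => φ ((m ++ b) :: S)) L M =
          (-1) ^ ((bdim m + 1) * (bdim b + 1)) * evalSh (fun S => φ ((b ++ m) :: S)) L M := by
        rw [← evalSh_mul]
        refine evalSh_congr fun S _ _ => ?_
        have := hφ.comm' [] m b S
        rwa [length_eq_bdim hb, length_eq_bdim hm] at this
      have l1 : evalSh (fun N => evalD φ (b :: N)) L (m :: M) =
          (-1) ^ bdim b * (evalSh (mergeHead b φ) L (m :: M) +
            evalSh (evalD fun N => φ (b :: N)) L (m :: M)) := by
        simp only [evalD_cons φ b, evalSh_mul, evalSh_add]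
      have l2 : evalSh (fun N => evalD φ (m :: N)) (b :: L) M =
          (-1) ^ bdim m * (evalSh (mergeHead m φ) (b :: L) M +
            evalSh (evalD fun N => φ (m :: N)) (b :: L) M) := by
        simp only [evalD_cons φ m, evalSh_mul, evalSh_add]
      rw [evalD_cons _ m] at i1
      rw [evalD_cons _ b] at i2
      rw [evalSh_cons, l1, l2, i1, i2, evalD_cons _ b, evalD_cons _ m, d1, d2, hx1, hx2, hy1, hy2,
        hc]
      simp only [dim_cons, mul_add, add_mul, pow_add, mul_one, one_mul, pow_one]
      have h1 := neg_one_pow_mul_neg_one_pow (bdim b)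
      have h2 := neg_one_pow_mul_neg_one_pow (bdim m)
      have h3 := neg_one_pow_mul_neg_one_pow (dim L)
      have h4 := neg_one_pow_mul_neg_one_pow (bdim m * bdim b)
      have h5 := neg_one_pow_mul_neg_one_pow (bdim m * dim L)
      generalize (-1 : ℤ) ^ (bdim b) = s1 at *
      generalize (-1 : ℤ) ^ (bdim m) = s2 at *
      generalize (-1 : ℤ) ^ (dim L) = s3 at *
      generalize (-1 : ℤ) ^ (bdim m * bdim b) = s4 at *
      generalize (-1 : ℤ) ^ (bdim m * dim L) = s5 at *
      clear hx1 hx2 hy1 hy2 hc l1 l2 i1 i2 d1 d2 ihL ihM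
      grind

end Functionals

/-! ## Partial compositions of lists of blocks -/

section Compositions

variable {I J K X Y Z W : Type*}

/-! ### Relabelling of blocks along partial maps -/

theorem length_filterMap_of_ne_none {f : X → Option Y} {b : List X} (h : ∀ x ∈ b, f x ≠ none) :
    (b.filterMap f).length = b.length := by
  induction b with
  | nil => rfl
  | cons x b ih =>
    obtain ⟨y, hy⟩ := Option.ne_none_iff_exists'.1 (h x (by simp))
    rw [List.filterMap_cons_some hy, List.length_cons, List.length_cons,
      ih fun z hz => h z (List.mem_cons_of_mem _ hz)]

theorem bdim_filterMap {f : X → Option Y} {b : List X} (h : ∀ x ∈ b, f x ≠ none) :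
    bdim (b.filterMap f) = bdim b := by
  simp only [bdim, length_filterMap_of_ne_none h]

@[simp] theorem bdim_map (g : X → Y) (b : List X) : bdim (b.map g) = bdim b := by simp [bdim]

theorem dim_map_of_bdim {h : List X → List Y} {L : List (List X)}
    (hb : ∀ b ∈ L, bdim (h b) = bdim b) : dim (L.map h) = dim L := by
  simp only [dim, List.map_map]
  exact congrArg List.sum (List.map_congr_left hb)

@[simp] theorem dim_map_map (g : X → Y) (L : List (List X)) : dim (L.map (List.map g)) = dim L :=
  dim_map_of_bdim fun b _ => bdim_map g b

theorem dim_map_filterMap {f : X → Option Y} {L : List (List X)}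
    (h : ∀ x ∈ L.flatten, f x ≠ none) : dim (L.map (List.filterMap f)) = dim L :=
  dim_map_of_bdim fun b hb => bdim_filterMap fun x hx => h x (List.mem_flatten.2 ⟨b, hb, hx⟩)

/-- Koszul signs depend only on the dimensions of the blocks, so every dimension-preserving map of
blocks commutes with shuffling. -/
theorem evalSh_map (φ : List (List Y) → ℤ) {h : List X → List Y} {L M : List (List X)}
    (hL : ∀ b ∈ L, bdim (h b) = bdim b) (hM : ∀ b ∈ M, bdim (h b) = bdim b) :
    evalSh φ (L.map h) (M.map h) = evalSh (fun N => φ (N.map h)) L M := by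
  induction L generalizing φ M with
  | nil => simp
  | cons b L ihL =>
    induction M generalizing φ with
    | nil => simp
    | cons m M ihM =>
      have h1 := ihL (fun N => φ (h b :: N)) (fun c hc => hL c (List.mem_cons_of_mem _ hc)) hM
      have h2 := ihM (fun N => φ (h m :: N)) (fun c hc => hM c (List.mem_cons_of_mem _ hc))
      have h3 : dim (L.map h) = dim L :=
        dim_map_of_bdim fun c hc => hL c (List.mem_cons_of_mem _ hc)
      rw [List.map_cons, List.map_cons] at *
      rw [evalSh_cons, evalSh_cons, h1, h2, h3, hL b (by simp), hM m (by simp)]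
      rfl

theorem evalD_map (φ : List (List Y) → ℤ) {h : List X → List Y} {L : List (List X)}
    (happ : ∀ x y, h (x ++ y) = h x ++ h y) (hL : ∀ b ∈ L, bdim (h b) = bdim b) :
    evalD φ (L.map h) = evalD (fun N => φ (N.map h)) L := by
  induction L generalizing φ with
  | nil => simp
  | cons b L ih =>
    rw [List.map_cons, evalD_cons, evalD_cons, hL b (by simp),
      ih _ fun c hc => hL c (List.mem_cons_of_mem _ hc)]
    congr 2
    cases L with
    | nil => simp
    | cons c L => simp [happ]

/-! ### The position of the substitution point and compositions with relabellings built in -/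

open Classical in
/-- The number of factors of a block that follow a given element. -/
noncomputable def tailCount (i : I) (b : List I) : ℕ := b.length - (b.idxOf i + 1)

theorem tailCount_eq {i : I} {x : List I} (hx : i ∉ x) (y : List I) :
    tailCount i (x ++ i :: y) = y.length := by
  classical
  unfold tailCount
  rw [List.idxOf_append_of_notMem hx, List.idxOf_cons_self, List.length_append, List.length_cons]
  omega

theorem tailCount_append_left {i : I} {b : List I} (hb : i ∈ b) (c : List I) :
    tailCount i (b ++ c) = tailCount i b + c.length := by
  obtain ⟨x, y, rfl, hx⟩ := List.eq_append_cons_of_mem hb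
  rw [List.append_assoc, List.cons_append, tailCount_eq hx, tailCount_eq hx, List.length_append]

theorem tailCount_append_right {i : I} {b c : List I} (hb : i ∉ b) (hc : i ∈ c) :
    tailCount i (b ++ c) = tailCount i c := by
  obtain ⟨x, y, rfl, hx⟩ := List.eq_append_cons_of_mem hc
  rw [← List.append_assoc, tailCount_eq hx, tailCount_eq]
  simp [hb, hx]

theorem mem_filterMap_iff {h : I → Option Y} {k : I} {k' : Y} (hk : ∀ x, h x = some k' ↔ x = k)
    (b : List I) : k' ∈ b.filterMap h ↔ k ∈ b := by
  rw [List.mem_filterMap]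
  constructor
  · rintro ⟨x, hx, h1⟩
    rwa [(hk x).1 h1] at hx
  · exact fun hb => ⟨k, hb, (hk k).2 rfl⟩

theorem tailCount_filterMap_eq {h : I → Option Y} {k : I} {k' : Y}
    (hk : ∀ x, h x = some k' ↔ x = k) {x y : List I} (hx : k ∉ x) :
    tailCount k' ((x ++ k :: y).filterMap h) = (y.filterMap h).length := by
  rw [List.filterMap_append, List.filterMap_cons_some ((hk k).2 rfl),
    tailCount_eq (mt (mem_filterMap_iff hk x).1 hx)]

theorem tailCount_filterMap {h : I → Option Y} {k : I} {k' : Y}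
    (hk : ∀ x, h x = some k' ↔ x = k) {b : List I} (hb : k ∈ b) (hn : ∀ x ∈ b, h x ≠ none) :
    tailCount k' (b.filterMap h) = tailCount k b := by
  obtain ⟨x, y, rfl, hx⟩ := List.eq_append_cons_of_mem hb
  rw [tailCount_filterMap_eq hk hx, tailCount_eq hx,
    length_filterMap_of_ne_none fun z hz => hn z (by simp [hz])]

open Classical in
/-- The terms of the partial composition at `i`, for given relabellings of the two arguments. The
partial map `f` is meant to be undefined exactly at `i`. -/
noncomputable def compTermsVia (f : I → Option Z) (g : J → Z) (i : I) :
    List (List I) → List (List J) → List (ℤ × List (List Z))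
  | [], _ => []
  | _ :: _, [] => []
  | b :: L, m :: M =>
    if i ∈ b then
      (shuffles (L.map (List.filterMap f)) (M.map (List.map g))).map fun t =>
        ((-1) ^ tailCount i b * (-1) ^ (bdim m * dim L) * t.1,
          (b.filterMap f ++ m.map g) :: t.2)
    else (compTermsVia f g i L (m :: M)).map fun t => (t.1, b.filterMap f :: t.2)

/-- The value of a function on a partial composition of lists of blocks. -/
noncomputable def evalComp (f : I → Option Z) (g : J → Z) (i : I) (φ : List (List Z) → ℤ)
    (L : List (List I)) (M : List (List J)) : ℤ := evalTerms φ (compTermsVia f g i L M)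

variable {f : I → Option Z} {g : J → Z} {i : I}

@[simp] theorem evalComp_nil_left (φ : List (List Z) → ℤ) (M : List (List J)) :
    evalComp f g i φ [] M = 0 := by
  simp [evalComp, compTermsVia]

@[simp] theorem evalComp_nil_right (φ : List (List Z) → ℤ) (L : List (List I)) :
    evalComp f g i φ L [] = 0 := by
  cases L <;> simp [evalComp, compTermsVia]

theorem evalComp_of_mem (φ : List (List Z) → ℤ) {b : List I} (hb : i ∈ b) (L : List (List I))
    (m : List J) (M : List (List J)) :
    evalComp f g i φ (b :: L) (m :: M) = (-1) ^ tailCount i b * (-1) ^ (bdim m * dim L) *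
      evalSh (fun N => φ ((b.filterMap f ++ m.map g) :: N)) (L.map (List.filterMap f))
        (M.map (List.map g)) := by
  rw [evalComp, compTermsVia, if_pos hb,
    evalTerms_map φ _ (fun N => (b.filterMap f ++ m.map g) :: N)]
  rfl

theorem evalComp_of_notMem (φ : List (List Z) → ℤ) {b : List I} (hb : i ∉ b) (L : List (List I))
    (M : List (List J)) :
    evalComp f g i φ (b :: L) M = evalComp f g i (fun N => φ (b.filterMap f :: N)) L M := by
  cases M with
  | nil => simp
  | cons m M =>
    rw [evalComp, compTermsVia, if_neg hb, evalTerms_map_one φ (fun N => b.filterMap f :: N)]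
    rfl

theorem evalComp_add (φ ψ : List (List Z) → ℤ) (L : List (List I)) (M : List (List J)) :
    evalComp f g i (fun N => φ N + ψ N) L M = evalComp f g i φ L M + evalComp f g i ψ L M :=
  evalTerms_add _ _ _

theorem evalComp_mul (s : ℤ) (φ : List (List Z) → ℤ) (L : List (List I)) (M : List (List J)) :
    evalComp f g i (fun N => s * φ N) L M = s * evalComp f g i φ L M :=
  evalTerms_mul _ _ _

/-- Substitution removes the single factor `i` and adds the `dim m + 1` factors of `m`. Hence
compositions add dimensions. -/
theorem bdim_comp (hf : ∀ x, f x = none ↔ x = i) {b : List I} (hb : i ∈ b) (hn : b.Nodup)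
    {m : List J} (hm : m ≠ []) : bdim (b.filterMap f ++ m.map g) = bdim b + bdim m := by
  obtain ⟨x, y, rfl, hx⟩ := List.eq_append_cons_of_mem hb
  have hy : i ∉ y := by
    have := (List.nodup_append.1 hn).2.1
    simp only [List.nodup_cons] at this
    exact this.1
  have h1 : ∀ z ∈ x, f z ≠ none := fun z hz h => hx ((hf z).1 h ▸ hz)
  have h2 : ∀ z ∈ y, f z ≠ none := fun z hz h => hy ((hf z).1 h ▸ hz)
  have h3 := length_eq_bdim hm
  rw [List.filterMap_append, List.filterMap_cons_none ((hf i).2 rfl)]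
  simp only [bdim, List.length_append, List.length_map, length_filterMap_of_ne_none h1,
    length_filterMap_of_ne_none h2, List.length_cons]
  unfold bdim at h3
  omega

theorem ne_none_of_notMem (hf : ∀ x, f x = none ↔ x = i) {b : List I} (hb : i ∉ b) :
    ∀ x ∈ b, f x ≠ none := fun x hx h => hb ((hf x).1 h ▸ hx)

theorem dim_compTermsVia (hf : ∀ x, f x = none ↔ x = i) {L : List (List I)} {M : List (List J)}
    (hL : L.flatten.Nodup) (hM : ∀ b ∈ M, b ≠ []) :
    ∀ t ∈ compTermsVia f g i L M, dim t.2 = dim L + dim M := by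
  induction L with
  | nil => simp [compTermsVia]
  | cons b L ih =>
    cases M with
    | nil => simp [compTermsVia]
    | cons m M =>
      intro t ht
      rw [List.flatten_cons, List.nodup_append] at hL
      rw [compTermsVia] at ht
      split_ifs at ht with hi
      · obtain ⟨s, hs, rfl⟩ := List.mem_map.1 ht
        have hiL : i ∉ L.flatten := fun h => hL.2.2 i hi i h rfl
        rw [dim_cons, dim_shuffles s hs, bdim_comp hf hi hL.1 (hM m (by simp)),
          dim_map_filterMap (ne_none_of_notMem hf hiL), dim_map_map, dim_cons, dim_cons]
        ring
      · obtain ⟨s, hs, rfl⟩ := List.mem_map.1 ht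
        rw [dim_cons, ih hL.2.1 s hs, bdim_filterMap (ne_none_of_notMem hf hi), dim_cons b]
        ring

theorem evalComp_congr (hf : ∀ x, f x = none ↔ x = i) {L : List (List I)} {M : List (List J)}
    (hL : L.flatten.Nodup) (hM : ∀ b ∈ M, b ≠ []) {φ ψ : List (List Z) → ℤ}
    (h : ∀ N, dim N = dim L + dim M → φ N = ψ N) :
    evalComp f g i φ L M = evalComp f g i ψ L M :=
  evalTerms_congr fun t ht => h _ (dim_compTermsVia hf hL hM t ht)

/-- Relabelling a composition afterwards is absorbed into `f` and `g`. The map `h` may be partial,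
provided that it loses none of the surviving elements; then dimensions and signs are unaffected. -/
theorem evalComp_filterMap {h : Z → Option W} {G : J → W}
    (hg : ∀ y, h (g y) = some (G y)) (φ : List (List W) → ℤ) {L : List (List I)}
    (hL : L.flatten.Nodup) (hk : ∀ x ∈ L.flatten, x ≠ i → (f x).bind h ≠ none)
    (M : List (List J)) :
    evalComp f g i (fun N => φ (N.map (List.filterMap h))) L M =
      evalComp (fun x => (f x).bind h) G i φ L M := by
  induction L generalizing φ with
  | nil => simp
  | cons b L ih =>
    rw [List.flatten_cons, List.nodup_append] at hL
    have hk' : ∀ x ∈ L.flatten, x ≠ i → (f x).bind h ≠ none := fun x hx =>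
      hk x (by rw [List.flatten_cons]; exact List.mem_append_right _ hx)
    by_cases hi : i ∈ b
    · cases M with
      | nil => simp
      | cons m M =>
        have hG : ∀ c : List J, (c.map g).filterMap h = c.map G := fun c => by
          rw [List.filterMap_map, ← List.filterMap_eq_map]
          exact List.filterMap_congr fun x _ => hg x
        have hiL : ∀ c ∈ L, ∀ x ∈ c, x ≠ i := fun c hc x hx e =>
          hL.2.2 i hi i (List.mem_flatten.2 ⟨c, hc, e ▸ hx⟩) rfl
        rw [evalComp_of_mem _ hi, evalComp_of_mem _ hi]
        simp only [List.map_cons]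
        rw [← evalSh_map (fun N => φ (((b.filterMap f ++ m.map g).filterMap h) :: N))]
        · simp only [List.map_map, List.filterMap_append, List.filterMap_filterMap, hG]
          congr 2
          · exact List.map_congr_left fun c _ => by simp [List.filterMap_filterMap]
          · exact List.map_congr_left fun c _ => by simpa using hG c
        · intro c hc
          obtain ⟨c, hc', rfl⟩ := List.mem_map.1 hc
          refine bdim_filterMap fun z hz hz' => ?_
          obtain ⟨x, hx, hxz⟩ := List.mem_filterMap.1 hz
          refine hk' x (List.mem_flatten.2 ⟨c, hc', hx⟩) (hiL c hc' x hx) ?_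
          rw [hxz, Option.bind_some, hz']
        · intro c hc
          obtain ⟨c, hc', rfl⟩ := List.mem_map.1 hc
          rw [hG, bdim_map, bdim_map]
    · rw [evalComp_of_notMem _ hi, evalComp_of_notMem _ hi]
      simp only [List.map_cons, List.filterMap_filterMap]
      exact ih (fun N => φ (b.filterMap (fun x => (f x).bind h) :: N)) hL.2.1 hk'

/-- Since `k'` comes only from `k` and nothing in `L` is lost, relabelling the outer argument
beforehand changes neither the position of the substitution point nor the signs. -/
theorem evalComp_map_left {h : I → Option Y} {f : Y → Option Z} {k : I} {k' : Y}
    (hk : ∀ x, h x = some k' ↔ x = k) (φ : List (List Z) → ℤ) {L : List (List I)}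
    (hL : ∀ x ∈ L.flatten, h x ≠ none) (M : List (List J)) :
    evalComp f g k' φ (L.map (List.filterMap h)) M =
      evalComp (fun x => (h x).bind f) g k φ L M := by
  induction L generalizing φ with
  | nil => simp
  | cons b L ih =>
    have hL1 : ∀ x ∈ b, h x ≠ none := fun x hx =>
      hL x (by rw [List.flatten_cons]; exact List.mem_append_left _ hx)
    have hL2 : ∀ x ∈ L.flatten, h x ≠ none := fun x hx =>
      hL x (by rw [List.flatten_cons]; exact List.mem_append_right _ hx)
    rw [List.map_cons]
    by_cases hb : k ∈ b
    · cases M with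
      | nil => simp
      | cons m M =>
        rw [evalComp_of_mem _ hb, evalComp_of_mem _ ((mem_filterMap_iff hk b).2 hb),
          dim_map_filterMap hL2, tailCount_filterMap hk hb hL1]
        simp only [List.map_map, List.filterMap_filterMap]
        congr 2
        exact List.map_congr_left fun c _ => by simp [List.filterMap_filterMap]
    · rw [evalComp_of_notMem _ hb, evalComp_of_notMem _ (mt (mem_filterMap_iff hk b).1 hb),
        ih _ hL2, List.filterMap_filterMap]

theorem evalComp_map_right (h : K → J) (φ : List (List Z) → ℤ) (L : List (List I))
    (M : List (List K)) :
    evalComp f g i φ L (M.map (List.map h)) = evalComp f (fun x => g (h x)) i φ L M := by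
  induction L generalizing φ with
  | nil => simp
  | cons b L ih =>
    by_cases hb : i ∈ b
    · cases M with
      | nil => simp
      | cons m M =>
        rw [List.map_cons, evalComp_of_mem _ hb, evalComp_of_mem _ hb]
        simp only [List.map_map, bdim_map]
        congr 2
        exact List.map_congr_left fun c _ => by simp
    · rw [evalComp_of_notMem _ hb, evalComp_of_notMem _ hb, ih]

/-! ### Compositions and shuffles -/

/-- Substituting `N` at a point of the right factor commutes with shuffling without a sign, as `L`,
`M`, `N` keep their order. Iterated compositions reduce to this when the second substitution happens
inside the shuffled tail of the first. -/
theorem evalSh_evalComp_right (hf : ∀ x, f x = none ↔ x = i) (φ : List (List Z) → ℤ)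
    (L M : List (List I)) (N : List (List J)) (hL : i ∉ L.flatten) (hM : i ∈ M.flatten)
    (hn : M.flatten.Nodup) (hN : ∀ b ∈ N, b ≠ []) :
    evalSh (fun T => evalComp f g i φ T N) L M =
      evalComp f g i (fun T => evalSh φ (L.map (List.filterMap f)) T) M N := by
  cases N with
  | nil => simp [evalSh]
  | cons n N =>
  have hn0 : n ≠ [] := hN n (by simp)
  induction L generalizing φ M with
  | nil => simp
  | cons b L ihL =>
    rw [List.flatten_cons, List.mem_append, not_or] at hL
    induction M generalizing φ with
    | nil => simp at hM
    | cons m M ihM =>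
      have hd : dim (L.map (List.filterMap f)) = dim L :=
        dim_map_filterMap (ne_none_of_notMem hf hL.2)
      have hbd : bdim (b.filterMap f) = bdim b := bdim_filterMap (ne_none_of_notMem hf hL.1)
      have i1 := ihL (fun S => φ (b.filterMap f :: S)) (m :: M) hL.2 hM hn
      rw [evalSh_cons]
      have l1 : (fun T => evalComp f g i φ (b :: T) (n :: N)) = fun T =>
          evalComp f g i (fun S => φ (b.filterMap f :: S)) T (n :: N) :=
        funext fun T => evalComp_of_notMem _ hL.1 _ _
      rw [l1, i1]
      rw [List.flatten_cons, List.nodup_append] at hn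
      rw [List.map_cons]
      by_cases hm : i ∈ m
      · have hiM : i ∉ M.flatten := fun h => hn.2.2 i hm i h rfl
        have hdM : dim (M.map (List.filterMap f)) = dim M :=
          dim_map_filterMap (ne_none_of_notMem hf hiM)
        -- The substitution takes place in the first block `m`; the remaining blocks form a triple
        -- shuffle of `b :: L`, `M` and `N`, regrouped by associativity.
        have l2 : evalSh (fun T => evalComp f g i φ (m :: T) (n :: N)) (b :: L) M =
            (-1) ^ tailCount i m * (-1) ^ (bdim n * (bdim b + dim L + dim M)) *
            evalSh (fun T => evalSh (fun S => φ ((m.filterMap f ++ n.map g) :: S))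
              ((b :: L).map (List.filterMap f)) T) (M.map (List.filterMap f))
                (N.map (List.map g)) := by
          rw [← evalSh_assoc, evalSh_map, ← evalSh_mul]
          · refine evalSh_congr fun T hT _ => ?_
            rw [evalComp_of_mem _ hm, hT, dim_cons]
          · intro c hc
            refine bdim_filterMap (ne_none_of_notMem hf fun h => ?_)
            rcases List.mem_cons.1 hc with rfl | hc
            · exact hL.1 h
            · exact hL.2 (List.mem_flatten.2 ⟨c, hc, h⟩)
          · intro c hc
            exact bdim_filterMap (ne_none_of_notMem hf fun h =>
              hiM (List.mem_flatten.2 ⟨c, hc, h⟩))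
        rw [l2, evalComp_of_mem _ hm, evalComp_of_mem _ hm, List.map_cons]
        simp only [evalSh_cons φ, evalSh_add, evalSh_mul, bdim_comp hf hm hn.1 hn0, hd, hbd]
        simp only [mul_add, add_mul, pow_add]
        ring
      · have hM' : i ∈ M.flatten := by
          rw [List.flatten_cons, List.mem_append] at hM
          exact hM.resolve_left hm
        have i2 := ihM (fun S => φ (m.filterMap f :: S)) hM' hn.2.1
        have l2 : (fun T => evalComp f g i φ (m :: T) (n :: N)) = fun T =>
            evalComp f g i (fun S => φ (m.filterMap f :: S)) T (n :: N) :=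
          funext fun T => evalComp_of_notMem _ hm _ _
        rw [l2, i2, evalComp_of_notMem _ hm, evalComp_of_notMem _ hm, List.map_cons]
        simp only [evalSh_cons φ, evalComp_add, evalComp_mul, hd, hbd,
          bdim_filterMap (ne_none_of_notMem hf hm)]

/-- Reduced to the right factor by commuting the shuffle before and after substitution. The net
effect is that `N` moves past `M`, which accounts for the sign. -/
theorem evalSh_evalComp_left (hf : ∀ x, f x = none ↔ x = i) (φ : List (List Z) → ℤ)
    (L M : List (List I)) (N : List (List J)) (hM : i ∉ M.flatten) (hL : i ∈ L.flatten)
    (hn : L.flatten.Nodup) (hN : ∀ b ∈ N, b ≠ []) :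
    evalSh (fun T => evalComp f g i φ T N) L M = (-1) ^ (dim M * dim N) *
      evalComp f g i (fun T => evalSh φ T (M.map (List.filterMap f))) L N := by
  rw [evalSh_comm, evalSh_evalComp_right hf φ M L N hM hL hn hN]
  have : evalComp f g i (fun T => evalSh φ (M.map (List.filterMap f)) T) L N =
      (-1) ^ (dim M * (dim L + dim N)) *
        evalComp f g i (fun T => evalSh φ T (M.map (List.filterMap f))) L N := by
    rw [← evalComp_mul]
    refine evalComp_congr hf hn hN fun T hT => ?_
    rw [evalSh_comm, dim_map_filterMap (ne_none_of_notMem hf hM), hT]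
  rw [this, mul_add, pow_add, mul_comm (dim L)]
  have h := neg_one_pow_mul_neg_one_pow (dim M * dim L)
  linear_combination ((-1) ^ (dim M * dim N) *
    evalComp f g i (fun T => evalSh φ T (M.map (List.filterMap f))) L N) * h

/-! ### Compositions and the differential -/

/-- The Leibniz rule. If `i` lies in a later block, the first block is split off. If it lies in the
first block, what follows the substituted block is a shuffle product, for which the rule is
`evalSh_evalD`; it remains to match the merges of the substituted block with its successor. -/
theorem evalComp_evalD (hf : ∀ x, f x = none ↔ x = i) {φ : List (List Z) → ℤ} (hφ : IsAlt φ)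
    (L : List (List I)) (M : List (List J)) (hL : ∀ b ∈ L, b ≠ []) (hM : ∀ b ∈ M, b ≠ [])
    (hn : L.flatten.Nodup) :
    evalComp f g i (evalD φ) L M = evalD (fun N => evalComp f g i φ N M) L +
      (-1) ^ dim L * evalD (fun N => evalComp f g i φ L N) M := by
  cases M with
  | nil => simp [evalD, mergeTerms]
  | cons m M =>
  have hm : m ≠ [] := hM m (by simp)
  have hM' : ∀ c ∈ M, c ≠ [] := fun c hc => hM c (List.mem_cons_of_mem _ hc)
  induction L generalizing φ with
  | nil => simp [evalD, mergeTerms]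
  | cons b L ih =>
    have hb : b ≠ [] := hL b (by simp)
    have hL' : ∀ c ∈ L, c ≠ [] := fun c hc => hL c (List.mem_cons_of_mem _ hc)
    rw [List.flatten_cons, List.nodup_append] at hn
    rw [evalD_cons _ b]
    by_cases hi : i ∈ b
    · have hiL : i ∉ L.flatten := fun h => hn.2.2 i hi i h rfl
      have hiL' : ∀ c ∈ L, ∀ x ∈ c, f x ≠ none := fun c hc x hx =>
        ne_none_of_notMem hf hiL x (List.mem_flatten.2 ⟨c, hc, hx⟩)
      have hd : dim (L.map (List.filterMap f)) = dim L :=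
        dim_map_filterMap (ne_none_of_notMem hf hiL)
      have hB := bdim_comp (g := g) hf hi hn.1 hm
      have l0 := evalSh_evalD (hφ.cons (b.filterMap f ++ m.map g)) (L.map (List.filterMap f))
        (M.map (List.map g)) (by
          intro c hc
          obtain ⟨c, hc', rfl⟩ := List.mem_map.1 hc
          rw [← List.length_pos_iff, length_filterMap_of_ne_none (hiL' c hc'), List.length_pos_iff]
          exact hL' c hc') (by
          intro c hc
          obtain ⟨c, hc', rfl⟩ := List.mem_map.1 hc
          simpa using hM' c hc')
      rw [evalD_map _ (fun _ _ => List.filterMap_append) fun c hc => bdim_filterMap (hiL' c hc),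
        evalD_map _ (fun _ _ => List.map_append) fun c _ => bdim_map g c, hd] at l0
      -- The successor of the substituted block comes from `L` (part `x`, from the differential of
      -- the left argument) or from `M` (part `y`, from that of the right argument).
      have l1 : ∃ x y, evalSh (mergeHead (b.filterMap f ++ m.map g) φ) (L.map (List.filterMap f))
            (M.map (List.map g)) = x + y ∧
          mergeHead b (fun N => evalComp f g i φ N (m :: M)) L =
            (-1) ^ tailCount i b * (-1) ^ (bdim m * (dim L + 1)) * x ∧
          mergeHead m (fun N => evalComp f g i φ (b :: L) N) M =
            (-1) ^ tailCount i b * (-1) ^ ((bdim m + 1) * dim L) * y := by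
        have hx : ∃ x, mergeHead b (fun N => evalComp f g i φ N (m :: M)) L =
              (-1) ^ tailCount i b * (-1) ^ (bdim m * (dim L + 1)) * x ∧
            ((L = [] ∧ x = 0) ∨ ∃ c L', L = c :: L' ∧ x = evalSh (fun N => φ ((b.filterMap f ++
              m.map g ++ c.filterMap f) :: N)) (L'.map (List.filterMap f))
                (M.map (List.map g))) := by
          cases L with
          | nil => exact ⟨0, by simp, Or.inl ⟨rfl, rfl⟩⟩
          | cons c L =>
            refine ⟨_, ?_, Or.inr ⟨c, L, rfl, rfl⟩⟩
            -- In `b ∧ c` the factors of `c` follow `i`, so they lengthen the tail of `i`, and `m`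
            -- is substituted behind them. Antisymmetry moves `m` in front of `c`.
            rw [mergeHead_cons, evalComp_of_mem _ (List.mem_append_left _ hi),
              tailCount_append_left hi, ← evalSh_mul, ← evalSh_mul]
            refine evalSh_congr fun N _ _ => ?_
            rw [hφ.comm', List.filterMap_append,
              length_filterMap_of_ne_none (hiL' c (by simp)), List.length_map,
              length_eq_bdim (hL' c (by simp)), length_eq_bdim hm, dim_cons]
            simp only [mul_add, add_mul, pow_add, mul_one, one_mul, pow_one]
            have h1 := neg_one_pow_mul_neg_one_pow (bdim c)
            have h2 := neg_one_pow_mul_neg_one_pow (bdim m)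
            generalize (-1 : ℤ) ^ (bdim c) = s1 at *
            generalize (-1 : ℤ) ^ (bdim m) = s2 at *
            generalize φ _ = z
            generalize (-1 : ℤ) ^ (tailCount i b) = s3 at *
            have h3 := neg_one_pow_mul_neg_one_pow (bdim m * bdim c)
            generalize (-1 : ℤ) ^ (bdim m * bdim c) = s4 at *
            generalize (-1 : ℤ) ^ (bdim m * dim L) = s5 at *
            clear * - h1 h2 h3
            grind
        have hy : ∃ y, mergeHead m (fun N => evalComp f g i φ (b :: L) N) M =
              (-1) ^ tailCount i b * (-1) ^ ((bdim m + 1) * dim L) * y ∧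
            ((M = [] ∧ y = 0) ∨ ∃ c M', M = c :: M' ∧ y = (-1) ^ (bdim c * dim L) *
              evalSh (fun N => φ ((b.filterMap f ++ m.map g ++ c.map g) :: N))
                (L.map (List.filterMap f)) (M'.map (List.map g))) := by
          cases M with
          | nil => exact ⟨0, by simp, Or.inl ⟨rfl, rfl⟩⟩
          | cons c M =>
            refine ⟨_, ?_, Or.inr ⟨c, M, rfl, rfl⟩⟩
            rw [mergeHead_cons, evalComp_of_mem _ hi, bdim_append hm (hM' c (by simp)),
              List.map_append]
            simp only [add_mul, pow_add, one_mul, List.append_assoc]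
            ring
        obtain ⟨x, hx1, hx2⟩ := hx
        obtain ⟨y, hy1, hy2⟩ := hy
        refine ⟨x, y, ?_, hx1, hy1⟩
        rcases hx2 with ⟨rfl, rfl⟩ | ⟨c, L', rfl, rfl⟩ <;>
          rcases hy2 with ⟨rfl, rfl⟩ | ⟨d, M', rfl, rfl⟩
        · simp
        · simp
        · simp
        · rw [List.map_cons, List.map_cons, evalSh_cons]
          simp only [mergeHead_cons]
          rw [bdim_map, bdim_filterMap (hiL' c (by simp)), dim_cons,
            dim_map_filterMap fun x hx => ?_]
          obtain ⟨e, he, hx⟩ := List.mem_flatten.1 hx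
          exact hiL' e (by simp [he]) x hx
      obtain ⟨x, y, h1, h2, h3⟩ := l1
      have l2 : evalD (fun N => evalComp f g i φ (b :: N) (m :: M)) L =
          (-1) ^ tailCount i b * (-1) ^ (bdim m * (dim L + 1)) *
          evalD (fun N => evalSh (fun S => φ ((b.filterMap f ++ m.map g) :: S))
            (N.map (List.filterMap f)) (M.map (List.map g))) L := by
        unfold evalD
        rw [← evalTerms_mul]
        refine evalD_dim hL' fun N hN => ?_
        rw [evalComp_of_mem _ hi, hN]
      have l3 : evalD (fun N => evalComp f g i φ (b :: L) (m :: N)) M =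
          (-1) ^ tailCount i b * (-1) ^ (bdim m * dim L) *
          evalD (fun N => evalSh (fun S => φ ((b.filterMap f ++ m.map g) :: S))
            (L.map (List.filterMap f)) (N.map (List.map g))) M := by
        unfold evalD
        rw [← evalTerms_mul]
        simp only [evalComp_of_mem _ hi]
      rw [evalComp_of_mem _ hi]
      simp only [evalD_cons φ, evalSh_mul, evalSh_add]
      rw [h1, l0, evalD_cons _ m, h2, h3, l2, l3, hB, dim_cons]
      simp only [mul_add, add_mul, pow_add, mul_one, one_mul]
      have e1 := neg_one_pow_mul_neg_one_pow (bdim m)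
      have e2 := neg_one_pow_mul_neg_one_pow (dim L)
      generalize (-1 : ℤ) ^ (bdim m) = s1 at *
      generalize (-1 : ℤ) ^ (dim L) = s2 at *
      have e3 := neg_one_pow_mul_neg_one_pow (bdim b)
      generalize (-1 : ℤ) ^ (bdim b) = s3 at *
      generalize (-1 : ℤ) ^ (tailCount i b) = s4 at *
      generalize (-1 : ℤ) ^ (bdim m * dim L) = s5 at *
      clear l0 l2 l3 h1 h2 h3 ih
      generalize evalD _ L = u1
      generalize mergeHead m _ M = u2
      generalize evalD _ M = u3
      clear * - e1 e2 e3
      grind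
    · have i1 := ih (hφ.cons (b.filterMap f)) hL' hn.2.1
      rw [evalComp_of_notMem _ hi]
      simp only [evalComp_of_notMem _ hi, evalD_cons φ, evalComp_mul, evalComp_add]
      rw [i1, bdim_filterMap (ne_none_of_notMem hf hi), dim_cons, pow_add]
      have l1 : mergeHead b (fun N => evalComp f g i φ N (m :: M)) L =
          evalComp f g i (mergeHead (b.filterMap f) φ) L (m :: M) := by
        cases L with
        | nil => simp
        | cons c L =>
          rw [mergeHead_cons]
          by_cases hc : i ∈ c
          · rw [evalComp_of_mem _ hc, evalComp_of_mem _ (List.mem_append_right _ hc),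
              tailCount_append_right hi hc]
            simp only [mergeHead_cons, List.filterMap_append, List.append_assoc]
          · rw [evalComp_of_notMem _ hc, evalComp_of_notMem _ (by simp [hi, hc])]
            simp only [mergeHead_cons, List.filterMap_append]
      rw [l1]
      ring

end Compositions

/-! ### Sequential and parallel associativity for lists of blocks -/

section Associativity

variable {I J K X Y Z W : Type*}

theorem evalComp_map_target {f : I → Option Z} {g : J → Z} {i : I}
    (hf : ∀ x, f x = none ↔ x = i) (h : Z → W) (φ : List (List W) → ℤ) {L : List (List I)}
    (hL : L.flatten.Nodup) (M : List (List J)) :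
    evalComp f g i (fun N => φ (N.map (List.map h))) L M =
      evalComp (fun x => (f x).map h) (fun y => h (g y)) i φ L M := by
  have h1 := evalComp_filterMap (f := f) (g := g) (i := i) (h := fun x => some (h x))
    (G := fun y => h (g y)) (fun _ => rfl) φ hL (fun x _ hx => by
      cases hfx : f x with
      | none => exact absurd ((hf x).1 hfx) hx
      | some z => simp) M
  have h2 : (List.filterMap fun x => some (h x)) = List.map h := List.filterMap_eq_map
  have h3 : (fun x => (f x).bind fun z => some (h z)) = fun x => (f x).map h :=
    funext fun x => by cases f x <;> rfl
  rwa [h2, h3] at h1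

theorem evalComp_map_source {h : I → Y} (hh : Function.Injective h) {f : Y → Option Z} {g : J → Z}
    {i : I} (φ : List (List Z) → ℤ) (L : List (List I)) (M : List (List J)) :
    evalComp f g (h i) φ (L.map (List.map h)) M = evalComp (fun x => f (h x)) g i φ L M := by
  have h1 := evalComp_map_left (h := fun x => some (h x)) (f := f) (g := g) (k := i) (k' := h i)
    (fun x => by simp [hh.eq_iff]) φ (L := L) (fun _ _ => by simp) M
  have h2 : (List.filterMap fun x => some (h x)) = List.map h := List.filterMap_eq_map
  rw [h2] at h1
  exact h1

/-- If `i` and `j` lie in the first blocks, both sides produce the block `b' ∧ m' ∧ n` followed by a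
triple shuffle, and `evalSh_assoc` applies. If `j` lies in a later block of `M`, the second
substitution happens inside the shuffle, handled by `evalSh_evalComp_right`. Substituted blocks
always stand at the right end, in the same order on both sides, so φ need not be alternating. -/
theorem evalComp_assoc {f₁ : I → Option Y} {g₁ : J → Y} {f₂ : Y → Option Z} {g₂ : K → Z}
    {f₃ : J → Option W} {g₃ : K → W} {F : I → Option Z} {G : W → Z} {i : I} {j : J}
    (hf₁ : ∀ x, f₁ x = none ↔ x = i) (hf₂ : ∀ y, f₂ y = none ↔ y = g₁ j)
    (hf₃ : ∀ y, f₃ y = none ↔ y = j) (hg₁ : Function.Injective g₁)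
    (hF : ∀ x, (f₁ x).bind f₂ = F x) (hFi : ∀ x, F x = none ↔ x = i)
    (hG : ∀ y, f₂ (g₁ y) = (f₃ y).map G) (hg : ∀ z, G (g₃ z) = g₂ z)
    (φ : List (List Z) → ℤ) (L : List (List I)) (M : List (List J)) (N : List (List K))
    (hL : L.flatten.Nodup) (hM : M.flatten.Nodup) (hjM : j ∈ M.flatten)
    (hM0 : ∀ b ∈ M, b ≠ []) (hN0 : ∀ b ∈ N, b ≠ []) :
    evalComp f₁ g₁ i (fun T => evalComp f₂ g₂ (g₁ j) φ T N) L M =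
      evalComp f₃ g₃ j (fun T => evalComp F G i φ L T) M N := by
  have hA : ∀ c : List J, (c.map g₁).filterMap f₂ = (c.filterMap f₃).map G := fun c => by
    rw [List.filterMap_map, List.map_filterMap]
    exact List.filterMap_congr fun x _ => hG x
  have hB : ∀ c : List I, (c.filterMap f₁).filterMap f₂ = c.filterMap F := fun c => by
    rw [List.filterMap_filterMap]
    exact List.filterMap_congr fun x _ => hF x
  have hC : ∀ c : List K, (c.map g₃).map G = c.map g₂ := fun c => by
    rw [List.map_map]
    exact List.map_congr_left fun x _ => hg x
  -- The second substitution point comes from `J`, never from what is left of `I`.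
  have hj1 : ∀ c : List I, g₁ j ∉ c.filterMap f₁ := fun c hc => by
    obtain ⟨x, _, hx⟩ := List.mem_filterMap.1 hc
    have h1 := hF x
    rw [hx, Option.bind_some, (hf₂ _).2 rfl] at h1
    rw [(hf₁ x).2 ((hFi x).1 h1.symm)] at hx
    exact absurd hx (by simp)
  have hj2 : ∀ c : List J, g₁ j ∈ c.map g₁ ↔ j ∈ c := fun c => List.mem_map_of_injective hg₁
  cases M with
  | nil => simp
  | cons m M =>
  cases N with
  | nil =>
    rw [evalComp_nil_right]
    simp only [evalComp_nil_right]
    simp [evalComp]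
  | cons n N =>
  induction L generalizing φ with
  | nil =>
    simp only [evalComp_nil_left]
    simp [evalComp]
  | cons b L ih =>
    rw [List.flatten_cons, List.nodup_append] at hL
    by_cases hi : i ∈ b
    · rw [evalComp_of_mem _ hi]
      simp only [List.flatten_cons, List.nodup_append] at hM
      have hiL : i ∉ L.flatten := fun h => hL.2.2 i hi i h rfl
      have hLF : (L.map (List.filterMap f₁)).map (List.filterMap f₂) =
          L.map (List.filterMap F) := by
        rw [List.map_map]
        exact List.map_congr_left fun c _ => hB c
      by_cases hj : j ∈ m
      · have hjM' : j ∉ M.flatten := fun h => hM.2.2 j hj j h rfl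
        have hMG : (M.map (List.map g₁)).map (List.filterMap f₂) =
            (M.map (List.filterMap f₃)).map (List.map G) := by
          rw [List.map_map, List.map_map]
          exact List.map_congr_left fun c _ => hA c
        have hNG : N.map (List.map g₂) = (N.map (List.map g₃)).map (List.map G) := by
          rw [List.map_map]
          exact List.map_congr_left fun c _ => (hC c).symm
        rw [evalComp_of_mem _ hj]
        have l1 : evalSh (fun T => evalComp f₂ g₂ (g₁ j) φ ((b.filterMap f₁ ++ m.map g₁) :: T)
              (n :: N)) (L.map (List.filterMap f₁)) (M.map (List.map g₁)) =
            (-1) ^ tailCount j m * (-1) ^ (bdim n * (dim L + dim M)) *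
              evalSh (fun T => evalSh (fun S => φ ((b.filterMap F ++ (m.filterMap f₃).map G ++
                n.map g₂) :: S)) T (N.map (List.map g₂))) (L.map (List.filterMap F))
                  ((M.map (List.filterMap f₃)).map (List.map G)) := by
          rw [← hLF, ← hMG, evalSh_map, ← evalSh_mul]
          · refine evalSh_congr fun T hT _ => ?_
            rw [evalComp_of_mem _ (List.mem_append_right _ ((hj2 m).2 hj)),
              tailCount_append_right (hj1 b) ((hj2 m).2 hj), hT, dim_map_map,
              dim_map_filterMap (ne_none_of_notMem hf₁ hiL), List.filterMap_append, hB, hA]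
            congr 3
            rw [← List.filterMap_eq_map]
            exact tailCount_filterMap (fun x => by simp [hg₁.eq_iff]) hj fun _ _ => by simp
          · intro c hc
            obtain ⟨c, _, rfl⟩ := List.mem_map.1 hc
            exact bdim_filterMap (ne_none_of_notMem hf₂ (hj1 c))
          · intro c hc
            obtain ⟨c, hc', rfl⟩ := List.mem_map.1 hc
            refine bdim_filterMap (ne_none_of_notMem hf₂ fun h => hjM' ?_)
            exact List.mem_flatten.2 ⟨c, hc', (hj2 c).1 h⟩
        have l2 : evalSh (fun T => evalComp F G i φ (b :: L) ((m.filterMap f₃ ++ n.map g₃) :: T))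
              (M.map (List.filterMap f₃)) (N.map (List.map g₃)) =
            (-1) ^ tailCount i b * (-1) ^ ((bdim m + bdim n) * dim L) *
              evalSh (fun T => evalSh (fun S => φ ((b.filterMap F ++ (m.filterMap f₃).map G ++
                n.map g₂) :: S)) (L.map (List.filterMap F)) T)
                  ((M.map (List.filterMap f₃)).map (List.map G)) (N.map (List.map g₂)) := by
          rw [hNG, evalSh_map _ (fun c _ => bdim_map G c) (fun c _ => bdim_map G c), ← evalSh_mul]
          refine evalSh_congr fun T _ _ => ?_
          rw [evalComp_of_mem _ hi, bdim_comp hf₃ hj hM.1 (hN0 n (by simp)), List.map_append, hC,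
            List.append_assoc]
        rw [l1, l2, evalSh_assoc]
        simp only [mul_add, add_mul, pow_add]
        ring
      · have hjM' : j ∈ M.flatten := by
          rw [List.flatten_cons, List.mem_append] at hjM
          exact hjM.resolve_left hj
        have hjm : g₁ j ∉ b.filterMap f₁ ++ m.map g₁ := by
          rw [List.mem_append, not_or]
          exact ⟨hj1 b, mt (hj2 m).1 hj⟩
        simp only [evalComp_of_notMem _ hjm]
        have hflat : (M.map (List.map g₁)).flatten = M.flatten.map g₁ := by
          rw [List.map_flatten]
        rw [evalSh_evalComp_right hf₂ _ _ _ _ (by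
            intro h
            obtain ⟨c, hc, h⟩ := List.mem_flatten.1 h
            obtain ⟨c, _, rfl⟩ := List.mem_map.1 hc
            exact hj1 c h) (by rw [hflat]; exact (hj2 _).2 hjM')
            (by rw [hflat]; exact hM.2.1.map hg₁) hN0, evalComp_map_source hg₁,
          evalComp_of_notMem _ hj]
        simp only [evalComp_of_mem _ hi, evalComp_mul, bdim_filterMap (ne_none_of_notMem hf₃ hj)]
        congr 1
        rw [evalComp_map_target hf₃ G (fun T => evalSh (fun S => φ ((b.filterMap F ++
          (m.filterMap f₃).map G) :: S)) (L.map (List.filterMap F)) T) hM.2.1]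
        simp only [List.filterMap_append, hB, hA, hLF, hG, hg]
    · rw [evalComp_of_notMem _ hi]
      simp only [evalComp_of_notMem _ hi, evalComp_of_notMem _ (hj1 b), hB]
      exact ih (fun S => φ (b.filterMap F :: S)) hL.2.1

/-- The relations between the relabellings that occur in the two iterated compositions at distinct
elements `i` and `k`. -/
structure Exchange (f₁ : I → Option Y) (g₁ : J → Y) (f₂ : Y → Option Z) (g₂ : K → Z)
    (f₃ : I → Option W) (g₃ : K → W) (f₄ : W → Option Z) (g₄ : J → Z) (i k : I) (k' : Y)
    (i' : W) : Prop where
  ne : i ≠ k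
  eq_none₁ : ∀ x, f₁ x = none ↔ x = i
  eq_none₂ : ∀ x, f₂ x = none ↔ x = k'
  eq_none₃ : ∀ x, f₃ x = none ↔ x = k
  eq_none₄ : ∀ x, f₄ x = none ↔ x = i'
  eq_some₁ : ∀ x, f₁ x = some k' ↔ x = k
  eq_some₃ : ∀ x, f₃ x = some i' ↔ x = i
  inj₁ : ∀ x y z, z ∈ f₁ x → z ∈ f₁ y → x = y
  inj₃ : ∀ x y z, z ∈ f₃ x → z ∈ f₃ y → x = y
  bind_eq : ∀ x, (f₁ x).bind f₂ = (f₃ x).bind f₄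
  map_left : ∀ y, f₂ (g₁ y) = some (g₄ y)
  map_right : ∀ z, f₄ (g₃ z) = some (g₂ z)

/-! ### Two substitutions at distinct elements of the same set -/

section Exchange

variable {f₁ : I → Option Y} {g₁ : J → Y} {f₂ : Y → Option Z} {g₂ : K → Z}
    {f₃ : I → Option W} {g₃ : K → W} {f₄ : W → Option Z} {g₄ : J → Z} {i k : I} {k' : Y} {i' : W}

theorem Exchange.symm (E : Exchange f₁ g₁ f₂ g₂ f₃ g₃ f₄ g₄ i k k' i') :
    Exchange f₃ g₃ f₄ g₄ f₁ g₁ f₂ g₂ k i i' k' :=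
  ⟨E.ne.symm, E.eq_none₃, E.eq_none₄, E.eq_none₁, E.eq_none₂, E.eq_some₃, E.eq_some₁, E.inj₃,
    E.inj₁, fun x => (E.bind_eq x).symm, E.map_right, E.map_left⟩

theorem Exchange.filterMap_map (E : Exchange f₁ g₁ f₂ g₂ f₃ g₃ f₄ g₄ i k k' i') (c : List J) :
    (c.map g₁).filterMap f₂ = c.map g₄ := by
  rw [List.filterMap_map, ← List.filterMap_eq_map]
  exact List.filterMap_congr fun x _ => E.map_left x

theorem Exchange.filterMap_filterMap (E : Exchange f₁ g₁ f₂ g₂ f₃ g₃ f₄ g₄ i k k' i')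
    (c : List I) : (c.filterMap f₁).filterMap f₂ = (c.filterMap f₃).filterMap f₄ := by
  rw [List.filterMap_filterMap, List.filterMap_filterMap]
  exact List.filterMap_congr fun x _ => E.bind_eq x

theorem Exchange.notMem_map (E : Exchange f₁ g₁ f₂ g₂ f₃ g₃ f₄ g₄ i k k' i') (c : List J) :
    k' ∉ c.map g₁ := by
  intro h
  obtain ⟨y, _, hy⟩ := List.mem_map.1 h
  have := E.map_left y
  rw [hy, (E.eq_none₂ k').2 rfl] at this
  exact absurd this (by simp)

/-- The substitution at `k` takes place in the tail that is shuffled with `M`, so moving `N` past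
`M` gives the sign by `evalSh_evalComp_left`. The first block of `M` contributes its share because
it jumps over a tail enlarged by `dim N`. No block is reordered. -/
theorem Exchange.evalComp_of_mem_of_notMem (E : Exchange f₁ g₁ f₂ g₂ f₃ g₃ f₄ g₄ i k k' i')
    (φ : List (List Z) → ℤ) (b : List I) (L : List (List I)) (M : List (List J))
    (N : List (List K)) (hL : (b :: L).flatten.Nodup) (hi : i ∈ b) (hk : k ∉ b)
    (hkL : k ∈ L.flatten) (hM : ∀ b ∈ M, b ≠ []) (hN : ∀ b ∈ N, b ≠ []) :
    evalComp f₁ g₁ i (fun T => evalComp f₂ g₂ k' φ T N) (b :: L) M = (-1) ^ (dim M * dim N) *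
      evalComp f₃ g₃ k (fun T => evalComp f₄ g₄ i' φ T M) (b :: L) N := by
  cases M with
  | nil =>
    rw [evalComp_nil_right]
    simp only [evalComp_nil_right]
    simp [evalComp]
  | cons m M =>
  rw [List.flatten_cons, List.nodup_append] at hL
  have hiL : i ∉ L.flatten := fun h => hL.2.2 i hi i h rfl
  have hB : k' ∉ b.filterMap f₁ ++ m.map g₁ := by
    rw [List.mem_append, mem_filterMap_iff E.eq_some₁, not_or]
    exact ⟨hk, E.notMem_map m⟩
  have hi' : i' ∈ b.filterMap f₃ := (mem_filterMap_iff E.eq_some₃ b).2 hi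
  rw [evalComp_of_mem _ hi, evalComp_of_notMem _ hk]
  simp only [evalComp_of_notMem _ hB, evalComp_of_mem _ hi']
  have hflat : (L.map (List.filterMap f₁)).flatten = L.flatten.filterMap f₁ := by
    rw [List.filterMap_flatten]
  have l1 : evalComp f₃ g₃ k (fun T => (-1) ^ tailCount i' (b.filterMap f₃) *
        (-1) ^ (bdim m * dim T) * evalSh (fun S => φ (((b.filterMap f₃).filterMap f₄ ++
          m.map g₄) :: S)) (T.map (List.filterMap f₄)) (M.map (List.map g₄))) L N =
      (-1) ^ tailCount i b * (-1) ^ (bdim m * (dim L + dim N)) *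
        evalComp (fun x => (f₃ x).bind f₄) g₂ k (fun T => evalSh (fun S =>
          φ (((b.filterMap f₃).filterMap f₄ ++ m.map g₄) :: S)) T (M.map (List.map g₄))) L N := by
    rw [← evalComp_filterMap (h := f₄) E.map_right (fun T => evalSh (fun S =>
          φ (((b.filterMap f₃).filterMap f₄ ++ m.map g₄) :: S)) T (M.map (List.map g₄))) hL.2.1,
      ← evalComp_mul]
    · refine evalComp_congr E.eq_none₃ hL.2.1 hN fun T hT => ?_
      rw [hT, tailCount_filterMap E.eq_some₃ hi (ne_none_of_notMem E.eq_none₃ hk)]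
    · intro x hx hxk
      cases h3 : f₃ x with
      | none => exact absurd ((E.eq_none₃ x).1 h3) hxk
      | some w =>
        rw [Option.bind_some, Ne, E.eq_none₄]
        rintro rfl
        exact hiL ((E.eq_some₃ x).1 h3 ▸ hx)
  rw [l1, evalSh_evalComp_left E.eq_none₂ _ _ _ _ _ _ _ hN,
    evalComp_map_left E.eq_some₁ _ (ne_none_of_notMem E.eq_none₁ hiL)]
  · simp only [List.filterMap_append, E.filterMap_filterMap, E.filterMap_map, E.bind_eq,
      List.map_map, Function.comp_def, dim_map_map, dim_cons]
    simp only [mul_add, add_mul, pow_add]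
    have h1 := neg_one_pow_mul_neg_one_pow (bdim m * dim N)
    generalize (-1 : ℤ) ^ (bdim m * dim N) = s1 at *
    generalize evalComp _ _ _ _ _ _ = u
    clear * - h1
    grind
  · intro h
    obtain ⟨c, hc, h⟩ := List.mem_flatten.1 h
    obtain ⟨c, _, rfl⟩ := List.mem_map.1 hc
    exact E.notMem_map c h
  · rw [hflat]
    exact (mem_filterMap_iff E.eq_some₁ _).2 hkL
  · rw [hflat]
    exact hL.2.1.filterMap E.inj₁

/-- Deleting `i` does not change the number of factors after `k`, whereas deleting `k` shortens the
tail of the earlier `i` by one. -/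
theorem Exchange.tailCount_of_before (E : Exchange f₁ g₁ f₂ g₂ f₃ g₃ f₄ g₄ i k k' i')
    {x y z : List I} (hb : (x ++ i :: (y ++ k :: z)).Nodup) :
    (-1 : ℤ) ^ tailCount i (x ++ i :: (y ++ k :: z)) *
        (-1) ^ tailCount k' ((x ++ i :: (y ++ k :: z)).filterMap f₁) =
      -((-1) ^ tailCount k (x ++ i :: (y ++ k :: z)) *
        (-1) ^ tailCount i' ((x ++ i :: (y ++ k :: z)).filterMap f₃)) := by
  have hp : (x ++ i :: (y ++ k :: z)).Perm (i :: k :: (x ++ y ++ z)) := by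
    refine List.perm_middle.trans (List.Perm.cons _ ?_)
    rw [← List.append_assoc]
    exact List.perm_middle
  have hn := hp.nodup_iff.1 hb
  simp only [List.nodup_cons, List.mem_cons, List.mem_append, not_or] at hn
  obtain ⟨⟨hik, ⟨hix, hiy⟩, hiz⟩, ⟨⟨hkx, hky⟩, hkz⟩, _⟩ := hn
  have e : x ++ i :: (y ++ k :: z) = (x ++ i :: y) ++ k :: z := by simp
  have hk : k ∉ x ++ i :: y := by simp [hkx, hky, Ne.symm hik]
  rw [tailCount_eq hix, tailCount_filterMap_eq E.eq_some₃ hix, e, tailCount_eq hk,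
    tailCount_filterMap_eq E.eq_some₁ hk,
    length_filterMap_of_ne_none (ne_none_of_notMem E.eq_none₁ hiz), List.filterMap_append,
    List.filterMap_cons_none ((E.eq_none₃ k).2 rfl), List.length_append, List.length_append,
    length_filterMap_of_ne_none (ne_none_of_notMem E.eq_none₃ hky),
    length_filterMap_of_ne_none (ne_none_of_notMem E.eq_none₃ hkz), List.length_cons]
  simp only [pow_add, pow_one]
  ring

theorem Exchange.sign_tailCount (E : Exchange f₁ g₁ f₂ g₂ f₃ g₃ f₄ g₄ i k k' i') {b : List I}
    (hb : b.Nodup) (hi : i ∈ b) (hk : k ∈ b) :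
    (-1 : ℤ) ^ tailCount i b * (-1) ^ tailCount k' (b.filterMap f₁) =
      -((-1) ^ tailCount k b * (-1) ^ tailCount i' (b.filterMap f₃)) := by
  obtain ⟨x, y, rfl, _⟩ := List.eq_append_cons_of_mem hi
  rcases List.mem_append.1 hk with h | h
  · obtain ⟨u, v, rfl, _⟩ := List.eq_append_cons_of_mem h
    rw [List.append_assoc, List.cons_append] at *
    rw [E.symm.tailCount_of_before hb, neg_neg]
  · obtain ⟨u, v, rfl, _⟩ :=
      List.eq_append_cons_of_mem ((List.mem_cons.1 h).resolve_left E.ne.symm)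
    exact E.tailCount_of_before hb

/-- With both points in `b`, the result begins with `b'' ∧ m ∧ n`. The factor `(-1) ^ m.length`
arises because `m`, placed at the end of the block, now follows `k'`; the first block `n` of the
other argument then jumps over the tails of both `L` and `M`. -/
theorem Exchange.evalComp_of_mem_of_mem (E : Exchange f₁ g₁ f₂ g₂ f₃ g₃ f₄ g₄ i k k' i')
    (φ : List (List Z) → ℤ) (b : List I) (L : List (List I)) (m : List J) (M : List (List J))
    (n : List K) (N : List (List K)) (hL : (b :: L).flatten.Nodup) (hi : i ∈ b) (hk : k ∈ b) :
    evalComp f₁ g₁ i (fun T => evalComp f₂ g₂ k' φ T (n :: N)) (b :: L) (m :: M) =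
      (-1) ^ tailCount i b * (-1) ^ tailCount k' (b.filterMap f₁) * (-1) ^ m.length *
        (-1) ^ (bdim m * dim L) * (-1) ^ (bdim n * (dim L + dim M)) *
        evalSh (fun T => evalSh (fun S => φ (((b.filterMap f₁).filterMap f₂ ++ m.map g₄ ++
          n.map g₂) :: S)) T (N.map (List.map g₂)))
            (L.map fun c => (c.filterMap f₁).filterMap f₂) (M.map (List.map g₄)) := by
  rw [List.flatten_cons, List.nodup_append] at hL
  have hiL : i ∉ L.flatten := fun h => hL.2.2 i hi i h rfl
  have hkL : k ∉ L.flatten := fun h => hL.2.2 k hk k h rfl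
  have hk' : k' ∈ b.filterMap f₁ := (mem_filterMap_iff E.eq_some₁ b).2 hk
  have h1 : (L.map fun c => (c.filterMap f₁).filterMap f₂) =
      (L.map (List.filterMap f₁)).map (List.filterMap f₂) := by
    rw [List.map_map]; rfl
  have h2 : M.map (List.map g₄) = (M.map (List.map g₁)).map (List.filterMap f₂) := by
    rw [List.map_map]
    exact List.map_congr_left fun c _ => (E.filterMap_map c).symm
  rw [evalComp_of_mem _ hi, h1, h2, evalSh_map, ← evalSh_mul, ← evalSh_mul]
  · refine evalSh_congr fun T hT _ => ?_
    rw [evalComp_of_mem _ (List.mem_append_left _ hk'), tailCount_append_left hk', hT,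
      dim_map_map, dim_map_filterMap (ne_none_of_notMem E.eq_none₁ hiL), List.filterMap_append,
      E.filterMap_map, List.length_map, pow_add]
    ring
  · intro c hc
    obtain ⟨c, hc', rfl⟩ := List.mem_map.1 hc
    refine bdim_filterMap (ne_none_of_notMem E.eq_none₂ fun h => hkL ?_)
    exact List.mem_flatten.2 ⟨c, hc', (mem_filterMap_iff E.eq_some₁ c).1 h⟩
  · intro c hc
    obtain ⟨c, _, rfl⟩ := List.mem_map.1 hc
    exact bdim_filterMap (ne_none_of_notMem E.eq_none₂ (E.notMem_map c))

/-- The delicate case has both points in one block, where the results begin with `b'' ∧ m ∧ n` and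
`b'' ∧ n ∧ m`. The reordering sign, the two tail signs and the minus sign of
`Exchange.sign_tailCount` combine to the exponent `(|m| + 1) * (|n| + 1)`, which has the parity of
`dim m * dim n`. The other signs come from moving first blocks past tails and commuting the shuffled
tails. -/
theorem Exchange.evalComp_comm (E : Exchange f₁ g₁ f₂ g₂ f₃ g₃ f₄ g₄ i k k' i')
    {φ : List (List Z) → ℤ} (hφ : IsAlt φ) (L : List (List I)) (M : List (List J))
    (N : List (List K)) (hL : L.flatten.Nodup) (hi : i ∈ L.flatten) (hk : k ∈ L.flatten)
    (hM : ∀ b ∈ M, b ≠ []) (hN : ∀ b ∈ N, b ≠ []) :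
    evalComp f₁ g₁ i (fun T => evalComp f₂ g₂ k' φ T N) L M = (-1) ^ (dim M * dim N) *
      evalComp f₃ g₃ k (fun T => evalComp f₄ g₄ i' φ T M) L N := by
  induction L generalizing φ with
  | nil => simp
  | cons b L ih =>
    have hL' := hL
    rw [List.flatten_cons, List.nodup_append] at hL
    by_cases hib : i ∈ b
    · by_cases hkb : k ∈ b
      · cases M with
        | nil =>
          rw [evalComp_nil_right]
          simp only [evalComp_nil_right]
          simp [evalComp]
        | cons m M =>
        cases N with
        | nil =>
          rw [evalComp_nil_right]
          simp only [evalComp_nil_right]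
          simp [evalComp]
        | cons n N =>
        rw [E.evalComp_of_mem_of_mem φ b L m M n N hL' hib hkb,
          E.symm.evalComp_of_mem_of_mem φ b L n N m M hL' hkb hib, E.sign_tailCount hL.1 hib hkb]
        simp only [E.filterMap_filterMap]
        set LF := L.map fun c => (c.filterMap f₃).filterMap f₄
        set B := (b.filterMap f₃).filterMap f₄
        have l1 : evalSh (fun T => evalSh (fun S => φ ((B ++ n.map g₂ ++ m.map g₄) :: S)) T
              (M.map (List.map g₄))) LF (N.map (List.map g₂)) =
            (-1) ^ (m.length * n.length) * (-1) ^ (dim M * dim N) *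
              evalSh (fun T => evalSh (fun S => φ ((B ++ m.map g₄ ++ n.map g₂) :: S)) T
                (N.map (List.map g₂))) LF (M.map (List.map g₄)) := by
          rw [evalSh_assoc, evalSh_assoc, evalSh_comm]
          simp only [dim_map_map]
          have : (fun S => φ ((B ++ n.map g₂ ++ m.map g₄) :: S)) = fun S =>
              (-1) ^ (m.length * n.length) * φ ((B ++ m.map g₄ ++ n.map g₂) :: S) := by
            funext S
            rw [hφ.comm', List.length_map, List.length_map, mul_comm m.length]
          rw [this]
          simp only [evalSh_mul]
          rw [mul_comm (dim M)]
          ring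
        rw [l1]
        generalize evalSh _ _ _ = u
        rw [length_eq_bdim (hM m (by simp)), length_eq_bdim (hN n (by simp)), dim_cons, dim_cons]
        simp only [mul_add, add_mul, pow_add, mul_one, one_mul, pow_one]
        rw [mul_comm (bdim n) (dim M)]
        have h1 := neg_one_pow_mul_neg_one_pow (bdim m)
        have h2 := neg_one_pow_mul_neg_one_pow (bdim n)
        have h3 := neg_one_pow_mul_neg_one_pow (bdim m * bdim n)
        have h4 := neg_one_pow_mul_neg_one_pow (bdim m * dim N)
        have h5 := neg_one_pow_mul_neg_one_pow (dim M * dim N)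
        generalize (-1 : ℤ) ^ (bdim m) = s1 at *
        generalize (-1 : ℤ) ^ (bdim n) = s2 at *
        generalize (-1 : ℤ) ^ (bdim m * bdim n) = s3 at *
        generalize (-1 : ℤ) ^ (bdim m * dim N) = s4 at *
        generalize (-1 : ℤ) ^ (dim M * dim N) = s5 at *
        clear * - h1 h2 h3 h4 h5
        grind
      · rw [List.flatten_cons, List.mem_append] at hk
        exact E.evalComp_of_mem_of_notMem φ b L M N hL' hib hkb (hk.resolve_left hkb) hM hN
    · rw [List.flatten_cons, List.mem_append] at hi
      by_cases hkb : k ∈ b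
      · rw [E.symm.evalComp_of_mem_of_notMem φ b L N M hL' hkb hib (hi.resolve_left hib) hN hM,
          ← mul_assoc, mul_comm (dim N), neg_one_pow_mul_neg_one_pow, one_mul]
      · rw [List.flatten_cons, List.mem_append] at hk
        rw [evalComp_of_notMem _ hib, evalComp_of_notMem _ hkb]
        simp only [evalComp_of_notMem _ (mt (mem_filterMap_iff E.eq_some₁ b).1 hkb),
          evalComp_of_notMem _ (mt (mem_filterMap_iff E.eq_some₃ b).1 hib), E.filterMap_filterMap]
        exact ih (hφ.cons _) hL.2.1 (hi.resolve_left hib) (hk.resolve_left hkb)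

end Exchange

end Associativity

/-! ## The basis of `Π(I)` -/

section Basis

variable {I : Type u}

/-- The number of inversions of a list. -/
def invCount [LinearOrder I] : List I → ℕ
  | [] => 0
  | a :: l => l.countP (· < a) + invCount l

/-- The sign of the permutation that sorts all blocks. -/
def blockSign [LinearOrder I] (L : List (List I)) : ℤ := (L.map fun b => (-1) ^ invCount b).prod

theorem blockSign_cons [LinearOrder I] (b : List I) (L : List (List I)) :
    blockSign (b :: L) = (-1) ^ invCount b * blockSign L := by
  simp [blockSign]

theorem blockSign_eq_or [LinearOrder I] (L : List (List I)) :
    blockSign L = 1 ∨ blockSign L = -1 := by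
  induction L with
  | nil => simp [blockSign]
  | cons b L ih =>
    rw [blockSign_cons]
    rcases ih with h | h <;> rcases neg_one_pow_eq_or ℤ (invCount b) with h' | h' <;> simp [h, h']

theorem blockSign_mul_self [LinearOrder I] (L : List (List I)) :
    blockSign L * blockSign L = 1 := by
  rcases blockSign_eq_or L with h | h <;> simp [h]

/-- An adjacent exchange changes the number of inversions by one and the sign of `ψ`, so the signed
value is constant along a permutation of a list without repetitions. -/
theorem sign_perm [LinearOrder I] {A : Type*} [AddCommGroup A] {l l' : List I} (h : l.Perm l')
    (hl : l.Nodup) (ψ : List I → A)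
    (hψ : ∀ x y a b, ψ (x ++ b :: a :: y) = -ψ (x ++ a :: b :: y)) :
    (-1 : ℤ) ^ invCount l • ψ l = (-1 : ℤ) ^ invCount l' • ψ l' := by
  induction h generalizing ψ with
  | nil => rfl
  | @cons a l l' h ih =>
    have := ih (List.nodup_cons.1 hl).2 (fun x => ψ (a :: x)) fun x y p q => hψ (a :: x) y p q
    simp only [invCount, pow_add, mul_smul, this, h.countP_eq]
  | swap a b l =>
    have hab : b ≠ a := fun e => (List.nodup_cons.1 hl).1 (by simp [e])
    have h1 := hψ [] l a b
    simp only [List.nil_append] at h1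
    rw [h1]
    simp only [invCount, List.countP_cons]
    rcases lt_or_gt_of_ne hab with h | h
    · simp only [h, not_lt_of_gt h, decide_true, decide_false, if_true, pow_add]
      simp [smul_neg]
      congr 1
      ring
    · simp only [h, not_lt_of_gt h, decide_true, decide_false, if_true, pow_add]
      simp [smul_neg]
      congr 1
      ring
  | trans h₁ _ ih₁ ih₂ => exact (ih₁ hl ψ hψ).trans (ih₂ (h₁.nodup_iff.1 hl) ψ hψ)

/-- The signed value of an alternating function depends only on the blocks as sets. With `ψ = cls`
this shows that one expression for each ordered partition suffices to span `Π(I)`. -/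
theorem blockSign_smul [LinearOrder I] {A : Type*} [AddCommGroup A] {L L' : List (List I)}
    (h : List.Forall₂ List.Perm L L') (hL : ∀ b ∈ L, b.Nodup) (ψ : List (List I) → A)
    (hψ : ∀ L L', Swap L L' → ψ L' = -ψ L) : blockSign L • ψ L = blockSign L' • ψ L' := by
  induction h generalizing ψ with
  | nil => rfl
  | @cons b b' L L' hb h ih =>
    have h1 := ih (fun c hc => hL c (List.mem_cons_of_mem _ hc)) (fun N => ψ (b :: N))
      fun _ _ hN => hψ _ _ (hN.cons b)
    have h2 := sign_perm hb (hL b (by simp)) (fun c => ψ (c :: L')) fun x y p q =>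
      hψ _ _ (swap_head x y p q L')
    rw [blockSign_cons, blockSign_cons, mul_smul, h1, smul_comm, h2, smul_comm, ← mul_smul]

/-- This sign rule makes `coordinates` well defined on the quotient by antisymmetry, and so gives
linear independence. -/
theorem blockSign_swap [LinearOrder I] {L L' : List (List I)} (h : Swap L L')
    (hL : ∀ b ∈ L, b.Nodup) : blockSign L' = -blockSign L := by
  induction L generalizing L' with
  | nil => exact absurd h not_swap_nil
  | cons b L ih =>
    rcases swap_cases h with ⟨x, y, p, q, rfl, rfl⟩ | ⟨L'', hL', rfl⟩
    · have hn : (x ++ p :: q :: y).Nodup := hL _ (by simp)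
      have key : ∀ x : List I, (x ++ p :: q :: y).Nodup →
          (-1 : ℤ) ^ invCount (x ++ q :: p :: y) = -(-1) ^ invCount (x ++ p :: q :: y) := by
        intro x hx
        induction x with
        | nil =>
          have hpq : p ≠ q := fun e => (List.nodup_cons.1 hx).1 (by simp [e])
          simp only [List.nil_append, invCount, List.countP_cons, pow_add]
          rcases lt_or_gt_of_ne hpq with h | h
          · simp [h, not_lt_of_gt h]; ring
          · simp [h, not_lt_of_gt h]; ring
        | cons a x ih =>
          have hp : List.Perm (x ++ p :: q :: y) (x ++ q :: p :: y) :=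
            (List.Perm.swap q p y).append_left x
          rw [List.cons_append] at hx
          simp only [List.cons_append, invCount, pow_add, ih (List.nodup_cons.1 hx).2,
            hp.countP_eq]
          ring
      rw [blockSign_cons, blockSign_cons, key x hn]
      ring
    · rw [blockSign_cons, blockSign_cons,
        ih hL' fun c hc => hL c (List.mem_cons_of_mem _ hc)]
      ring

theorem OrderedPartition.ext_blocks {P Q : OrderedPartition I} (h : P.blocks = Q.blocks) :
    P = Q := by
  cases P; cases Q; cases h; rfl

theorem Expr.partition_swap {e e' : Expr I} (h : Swap e.1 e'.1) : e'.partition = e.partition := by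
  classical
  refine OrderedPartition.ext_blocks ?_
  obtain ⟨A, B, x, y, a, b, h1, h2⟩ := h
  simp only [Expr.partition, h1, h2, List.map_append, List.map_cons]
  congr 2
  exact List.toFinset_eq_of_perm _ _ ((List.Perm.swap a b y).append_left x)

/-- An expression whose underlying ordered partition is given. -/
noncomputable def OrderedPartition.toExpr (P : OrderedPartition I) : Expr I :=
  ⟨P.blocks.map Finset.toList, by
    refine ⟨?_, ?_, ?_⟩
    · intro b hb
      obtain ⟨B, hB, rfl⟩ := List.mem_map.1 hb
      rw [Ne, Finset.toList_eq_nil]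
      exact (P.nonempty B hB).ne_empty
    · rw [List.nodup_flatten]
      refine ⟨?_, ?_⟩
      · intro b hb
        obtain ⟨B, _, rfl⟩ := List.mem_map.1 hb
        exact B.nodup_toList
      · refine List.pairwise_map.2 (P.disjoint.imp fun {B C} h x hx hy => ?_)
        exact Finset.disjoint_left.1 h (Finset.mem_toList.1 hx) (Finset.mem_toList.1 hy)
    · intro i
      obtain ⟨B, hB, hi⟩ := P.cover i
      exact List.mem_flatten.2 ⟨_, List.mem_map_of_mem hB, Finset.mem_toList.2 hi⟩⟩

theorem OrderedPartition.partition_toExpr (P : OrderedPartition I) : P.toExpr.partition = P := by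
  refine OrderedPartition.ext_blocks ?_
  simp [Expr.partition, OrderedPartition.toExpr, Function.comp_def]

theorem Expr.forall₂_toExpr (e : Expr I) :
    List.Forall₂ List.Perm e.1 e.partition.toExpr.1 := by
  classical
  simp only [Expr.partition, OrderedPartition.toExpr, List.map_map]
  rw [List.forall₂_map_right_iff]
  refine List.forall₂_same.2 fun b hb => ?_
  have hn := (List.nodup_flatten.1 e.2.2.1).1 b hb
  refine (List.perm_ext_iff_of_nodup hn (Finset.nodup_toList _)).2 fun x => ?_
  simp

theorem cls_of_isExpr {L : List (List I)} (h : IsExpr L) : cls L = Expr.cls ⟨L, h⟩ := dif_pos h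

theorem Expr.cls_eq (e : Expr I) : e.cls = PermOperad.cls e.1 := (cls_of_isExpr e.2).symm

theorem Expr.blockSign_smul_toExpr [LinearOrder I] (e : Expr I) :
    blockSign e.1 • blockSign e.partition.toExpr.1 • e.partition.toExpr.cls = e.cls := by
  have h := blockSign_smul e.forall₂_toExpr (List.nodup_flatten.1 e.2.2.1).1 PermOperad.cls
    fun _ _ => cls_swap
  rw [← Expr.cls_eq, ← Expr.cls_eq] at h
  rw [← h, ← mul_smul, blockSign_mul_self, one_smul]

/-- The coordinates of the elements of `Π(I)` with respect to the ordered partitions. -/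
noncomputable def coordinates [LinearOrder I] : Perm I →ₗ[ℤ] (OrderedPartition I →₀ ℤ) :=
  lift (fun e => Finsupp.single e.partition (blockSign e.1)) fun e e' h => by
    rw [Expr.partition_swap h, blockSign_swap h (List.nodup_flatten.1 e.2.2.1).1,
      Finsupp.single_neg]

/-- The basis of `Π(I)` indexed by the ordered partitions of `I`. -/
noncomputable def basis [LinearOrder I] : Module.Basis (OrderedPartition I) ℤ (Perm I) :=
  Module.Basis.ofRepr <| LinearEquiv.ofLinearMap coordinates
    (Finsupp.linearCombination ℤ fun P => blockSign P.toExpr.1 • P.toExpr.cls)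
    (by
      refine Finsupp.lhom_ext' fun P => LinearMap.ext_ring ?_
      simp [coordinates, OrderedPartition.partition_toExpr, blockSign_mul_self])
    (by
      refine perm_ext fun e => ?_
      rw [LinearMap.comp_apply, coordinates, lift_cls, Finsupp.linearCombination_single,
        LinearMap.id_apply, e.blockSign_smul_toExpr])

theorem basis_apply [LinearOrder I] (P : OrderedPartition I) :
    basis P = blockSign P.toExpr.1 • P.toExpr.cls := by
  simp [basis, Module.Basis.coe_ofRepr]

theorem Expr.cls_eq_basis [LinearOrder I] (e : Expr I) :
    e.cls = blockSign e.1 • basis e.partition := by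
  rw [basis_apply, e.blockSign_smul_toExpr]

variable (I) in
theorem exists_basis : ∃ b : Module.Basis (OrderedPartition I) ℤ (Perm I),
    ∀ e : Expr I, e.cls = b e.partition ∨ e.cls = -b e.partition := by
  classical
  -- The choice of order only affects the signs of the basis vectors.
  let _ : LinearOrder I := linearOrderOfSTO WellOrderingRel
  refine ⟨basis, fun e => ?_⟩
  have h := e.cls_eq_basis
  rcases blockSign_eq_or e.1 with h' | h' <;> rw [h'] at h <;> simp [h]

/-- The functionals of a free module separate its points. This turns the operad identities into
identities of integers. -/
theorem perm_eq_of_dual {a b : Perm I} (h : ∀ Λ : Perm I →ₗ[ℤ] ℤ, Λ a = Λ b) : a = b := by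
  obtain ⟨B, -⟩ := exists_basis I
  have : Module.Free ℤ (Perm I) := Module.Free.of_basis B
  rw [← sub_eq_zero, ← Module.forall_dual_apply_eq_zero_iff ℤ]
  intro Λ
  rw [map_sub, h, sub_self]

end Basis

/-! ## The operad axioms -/

section Operad

variable {I J K : Type u}

/-! ### Translation of the operations of `Π` into functionals on lists of blocks -/

theorem map_total {A : Type*} [AddCommGroup A] (F : Perm I →ₗ[ℤ] A)
    (T : List (ℤ × List (List I))) : F (total T) = (T.map fun t => t.1 • F (cls t.2)).sum := by
  simp only [total, map_list_sum, List.map_map]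
  congr 1
  refine List.map_congr_left fun t _ => ?_
  simp

theorem dual_total (Λ : Perm I →ₗ[ℤ] ℤ) (T : List (ℤ × List (List I))) :
    Λ (total T) = evalTerms (fun L => Λ (cls L)) T := by
  rw [map_total]; rfl

theorem isAlt_dual (Λ : Perm I →ₗ[ℤ] ℤ) : IsAlt fun L => Λ (cls L) := fun _ _ h => by
  simp only [cls_swap h, map_neg]

theorem IsExpr.ne_nil [Nonempty I] {L : List (List I)} (h : IsExpr L) : L ≠ [] := by
  rintro rfl
  have := h.2.2 (Classical.arbitrary I)
  simp at this

theorem relabel_cls (σ : I ≃ J) {L : List (List I)} (h : IsExpr L) :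
    relabel σ (cls L) = cls (L.map (List.map σ)) := by
  rw [cls_of_isExpr h]
  exact lift_cls _ _ ⟨L, h⟩

theorem differential_cls {L : List (List I)} (h : IsExpr L) :
    differential I (cls L) = total (mergeTerms L) := by
  rw [cls_of_isExpr h]
  exact lift_cls _ _ ⟨L, h⟩

theorem compose_cls (i : I) {L : List (List I)} {M : List (List J)} (hL : IsExpr L)
    (hM : IsExpr M) : compose i (cls L) (cls M) = total (compTerms i L M) := by
  rw [cls_of_isExpr hL, cls_of_isExpr hM]
  exact (LinearMap.congr_fun (lift_cls _ _ ⟨L, hL⟩) _).trans (lift_cls _ _ ⟨M, hM⟩)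

open Classical in
/-- The inclusion of `I ∖ {i}` into `I ∖ {i} ⊔ J`, as a partial map on `I`. -/
noncomputable def stripMap (J : Type u) (i x : I) : Option ({x : I // x ≠ i} ⊕ J) :=
  if h : x = i then none else some (Sum.inl ⟨x, h⟩)

@[simp] theorem stripMap_self (i : I) : stripMap J i i = none := by simp [stripMap]

theorem stripMap_of_ne {i x : I} (h : x ≠ i) : stripMap J i x = some (Sum.inl ⟨x, h⟩) := by
  simp [stripMap, h]

theorem stripMap_eq_none (i x : I) : stripMap J i x = none ↔ x = i := by
  by_cases h : x = i <;> simp [stripMap, h]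

theorem compTerms_eq_compTermsVia (i : I) (L : List (List I)) (M : List (List J)) :
    compTerms i L M = compTermsVia (stripMap J i) Sum.inr i L M := by
  induction L with
  | nil => cases M <;> rfl
  | cons b L ih =>
    cases M with
    | nil => rfl
    | cons m M =>
      rw [compTerms, compTermsVia, ih]
      rfl

theorem dual_differential (Λ : Perm I →ₗ[ℤ] ℤ) {L : List (List I)} (hL : IsExpr L) :
    Λ (differential I (cls L)) = evalD (fun N => Λ (cls N)) L := by
  rw [differential_cls hL, dual_total]; rfl

theorem dual_compose (Λ : Perm ({x : I // x ≠ i} ⊕ J) →ₗ[ℤ] ℤ) {L : List (List I)}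
    {M : List (List J)} (hL : IsExpr L) (hM : IsExpr M) :
    Λ (compose i (cls L) (cls M)) =
      evalComp (stripMap J i) Sum.inr i (fun N => Λ (cls N)) L M := by
  rw [compose_cls i hL hM, dual_total, compTerms_eq_compTermsVia]; rfl

theorem dual_relabel_compose (σ : {x : I // x ≠ i} ⊕ J ≃ K) (Λ : Perm K →ₗ[ℤ] ℤ)
    {L : List (List I)} {M : List (List J)} (hL : IsExpr L) (hM : IsExpr M) :
    Λ (relabel σ (compose i (cls L) (cls M))) =
      evalComp (fun x => (stripMap J i x).map σ) (fun y => σ (Sum.inr y)) i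
        (fun N => Λ (cls N)) L M := by
  rw [← evalComp_map_target (stripMap_eq_none i) σ (fun N => Λ (cls N)) hL.2.1 M,
    compose_cls i hL hM, ← LinearMap.comp_apply, dual_total, evalComp,
    ← compTerms_eq_compTermsVia]
  exact evalTerms_congr fun t ht => by
    rw [LinearMap.comp_apply, relabel_cls σ (isExpr_compTerms i hL hM t ht)]

/-- Every term of a composition is again an expression, so a further operation `F` has to be
computed on expressions only. Iterated compositions are evaluated by repeating this. -/
theorem dual_map_compose {A : Type*} [AddCommGroup A] (F : Perm ({x : I // x ≠ i} ⊕ J) →ₗ[ℤ] A)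
    (Λ : A →ₗ[ℤ] ℤ) (ψ : List (List ({x : I // x ≠ i} ⊕ J)) → ℤ)
    {L : List (List I)} {M : List (List J)} (hL : IsExpr L) (hM : IsExpr M)
    (h : ∀ N, IsExpr N → Λ (F (cls N)) = ψ N) :
    Λ (F (compose i (cls L) (cls M))) = evalComp (stripMap J i) Sum.inr i ψ L M := by
  rw [compose_cls i hL hM, ← LinearMap.comp_apply, dual_total, evalComp,
    ← compTerms_eq_compTermsVia]
  exact evalTerms_congr fun t ht => h _ (isExpr_compTerms i hL hM t ht)

theorem dual_map_differential {A : Type*} [AddCommGroup A] (F : Perm I →ₗ[ℤ] A)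
    (Λ : A →ₗ[ℤ] ℤ) (ψ : List (List I) → ℤ) {L : List (List I)} (hL : IsExpr L)
    (h : ∀ N, IsExpr N → Λ (F (cls N)) = ψ N) :
    Λ (F (differential I (cls L))) = evalD ψ L := by
  rw [differential_cls hL, ← LinearMap.comp_apply, dual_total]
  exact evalTerms_congr fun t ht => h _ (isExpr_mergeTerms hL t ht)

/-! ### The grading -/

theorem cls_mem_grade (L : List (List I)) : cls L ∈ grade I (dim L) := by
  by_cases h : IsExpr L
  · rw [cls_of_isExpr h]
    exact Submodule.subset_span ⟨⟨L, h⟩, rfl, rfl⟩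
  · rw [cls, dif_neg h]
    exact zero_mem _

theorem total_mem_grade {n : ℤ} {T : List (ℤ × List (List I))}
    (h : ∀ t ∈ T, (dim t.2 : ℤ) = n) : total T ∈ grade I n := by
  refine list_sum_mem fun a ha => ?_
  obtain ⟨t, ht, rfl⟩ := List.mem_map.1 ha
  exact Submodule.smul_mem _ _ (h t ht ▸ cls_mem_grade t.2)

theorem map_mem_of_grade {A : Type*} [AddCommGroup A] (F : Perm I →ₗ[ℤ] A) (S : Submodule ℤ A)
    {n : ℤ} (h : ∀ L, IsExpr L → (dim L : ℤ) = n → F (cls L) ∈ S) {a : Perm I}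
    (ha : a ∈ grade I n) : F a ∈ S := by
  have : grade I n ≤ S.comap F := Submodule.span_le.2 (by
    rintro _ ⟨e, he, rfl⟩
    rw [Expr.cls_eq]
    exact h e.1 e.2 he)
  exact this ha

theorem eq_of_grade {A : Type*} [AddCommGroup A] (F G : Perm I →ₗ[ℤ] A)
    {n : ℤ} (h : ∀ L, IsExpr L → (dim L : ℤ) = n → F (cls L) = G (cls L)) {a : Perm I}
    (ha : a ∈ grade I n) : F a = G a := by
  have := map_mem_of_grade (F - G) ⊥ (fun L hL hn => by simp [h L hL hn]) ha
  simpa [sub_eq_zero] using this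

theorem eq_of_cls {A : Type*} [AddCommGroup A] (F G : Perm I →ₗ[ℤ] A)
    (h : ∀ L, IsExpr L → F (cls L) = G (cls L)) (a : Perm I) : F a = G a :=
  LinearMap.congr_fun (perm_ext fun e => by rw [Expr.cls_eq]; exact h e.1 e.2) a

/-- The decomposition of the elements of `Π(I)` into homogeneous parts. -/
noncomputable def decomposeGrade (I : Type u) : Perm I →ₗ[ℤ] DirectSum ℤ fun n => grade I n :=
  lift (fun e => DirectSum.lof ℤ ℤ (fun n => grade I n) (dim e.1)
    ⟨e.cls, Submodule.subset_span ⟨e, rfl, rfl⟩⟩) fun e e' h => by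
    -- Exchanging two factors preserves the dimension only propositionally, while the summand
    -- depends on it; the statement is generalized so that both equalities can be substituted.
    have key : ∀ (k : ℤ) (_ : k = dim e.1) (x : Perm I) (hx : x ∈ grade I k), x = -e.cls →
        DirectSum.lof ℤ ℤ (fun n => grade I n) k ⟨x, hx⟩ =
          -DirectSum.lof ℤ ℤ (fun n => grade I n) (dim e.1)
            ⟨e.cls, Submodule.subset_span ⟨e, rfl, rfl⟩⟩ := by
      rintro _ rfl _ _ rfl
      rw [← map_neg]
      rfl
    refine key _ (by rw [h.dim_eq]) _ _ ?_
    rw [Expr.cls_eq, Expr.cls_eq, cls_swap h]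

theorem isInternal_grade (I : Type u) : DirectSum.IsInternal (grade I) := by
  let D : DirectSum.Decomposition (grade I) := DirectSum.Decomposition.ofLinearMap _
    (decomposeGrade I)
    (perm_ext fun e => by
      rw [LinearMap.comp_apply, decomposeGrade, lift_cls, DirectSum.coeLinearMap_lof]
      rfl)
    (DirectSum.linearMap_ext _ fun n => LinearMap.ext fun x => by
      obtain ⟨x, hx⟩ := x
      simp only [LinearMap.comp_apply, DirectSum.coeLinearMap_lof, LinearMap.id_apply]
      induction hx using Submodule.span_induction with
      | mem x h =>
        obtain ⟨e, rfl, rfl⟩ := h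
        rw [decomposeGrade, lift_cls]
      | zero => rw [map_zero]; exact (map_zero _).symm
      | add x y hx hy h1 h2 => rw [map_add, h1, h2, ← map_add]; rfl
      | smul c x hx h1 => rw [map_smul, h1, ← map_smul]; rfl)
  exact DirectSum.Decomposition.isInternal _

/-! ### The axioms -/

theorem differential_mem {n : ℤ} {a : Perm I} (ha : a ∈ grade I n) :
    differential I a ∈ grade I (n + 1) := by
  refine map_mem_of_grade _ _ (fun L hL hn => ?_) ha
  rw [differential_cls hL]
  refine total_mem_grade fun t ht => ?_
  rw [dim_mergeTerms hL.1 t ht, ← hn]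
  push_cast
  rfl

theorem differential_differential (a : Perm I) : differential I (differential I a) = 0 := by
  refine eq_of_cls (differential I ∘ₗ differential I) 0 (fun L hL => ?_) a
  refine perm_eq_of_dual fun Λ => ?_
  rw [LinearMap.comp_apply, LinearMap.zero_apply, map_zero,
    dual_map_differential _ _ _ hL fun N hN => dual_differential Λ hN, evalD_evalD _ _ hL.1]

theorem relabel_refl (a : Perm I) : relabel (Equiv.refl I) a = a := by
  refine eq_of_cls (relabel (Equiv.refl I)) LinearMap.id (fun L hL => ?_) a
  rw [relabel_cls _ hL]
  simp

theorem relabel_trans (e : I ≃ J) (f : J ≃ K) (a : Perm I) :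
    relabel (e.trans f) a = relabel f (relabel e a) := by
  refine eq_of_cls (relabel (e.trans f)) (relabel f ∘ₗ relabel e) (fun L hL => ?_) a
  rw [LinearMap.comp_apply, relabel_cls _ hL, relabel_cls _ hL, relabel_cls _ (isExpr_map hL e)]
  simp

theorem relabel_mem (e : I ≃ J) {n : ℤ} {a : Perm I} (ha : a ∈ grade I n) :
    relabel e a ∈ grade J n := by
  refine map_mem_of_grade _ _ (fun L hL hn => ?_) ha
  rw [relabel_cls e hL, ← hn, ← dim_map_map e L]
  exact cls_mem_grade _

theorem relabel_differential (e : I ≃ J) (a : Perm I) :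
    relabel e (differential I a) = differential J (relabel e a) := by
  refine eq_of_cls (relabel e ∘ₗ differential I) (differential J ∘ₗ relabel e) (fun L hL => ?_) a
  refine perm_eq_of_dual fun Λ => ?_
  rw [LinearMap.comp_apply, LinearMap.comp_apply, relabel_cls e hL,
    dual_differential Λ (isExpr_map hL e),
    dual_map_differential _ _ (fun N => Λ (cls (N.map (List.map e)))) hL fun N hN => by
      rw [relabel_cls e hN],
    evalD_map _ (fun _ _ => List.map_append) fun b _ => bdim_map e b]

theorem compose_mem (i : I) {m n : ℤ} {a : Perm I} {b : Perm J} (ha : a ∈ grade I m)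
    (hb : b ∈ grade J n) : compose i a b ∈ grade ({x : I // x ≠ i} ⊕ J) (m + n) := by
  refine map_mem_of_grade ((compose i).flip b) _ (fun L hL hm => ?_) ha
  rw [LinearMap.flip_apply]
  refine map_mem_of_grade (compose i (cls L)) _ (fun M hM hn => ?_) hb
  rw [compose_cls i hL hM]
  refine total_mem_grade fun t ht => ?_
  rw [compTerms_eq_compTermsVia] at ht
  rw [dim_compTermsVia (stripMap_eq_none i) hL.2.1 hM.1 t ht, ← hm, ← hn]
  push_cast
  rfl

theorem differential_compose (i : I) {m : ℤ} {a : Perm I} (ha : a ∈ grade I m) (b : Perm J) :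
    differential _ (compose i a b) = compose i (differential I a) b +
      (m.negOnePow : ℤ) • compose i a (differential J b) := by
  refine eq_of_grade (differential _ ∘ₗ (compose i).flip b)
    ((compose i).flip b ∘ₗ differential I +
      (m.negOnePow : ℤ) • (compose i).flip (differential J b)) (fun L hL hm => ?_) ha
  simp only [LinearMap.comp_apply, LinearMap.add_apply, LinearMap.smul_apply,
    LinearMap.flip_apply]
  refine eq_of_cls (differential _ ∘ₗ compose i (cls L)) (compose i (differential I (cls L)) +
    (m.negOnePow : ℤ) • (compose i (cls L) ∘ₗ differential J)) (fun M hM => ?_) b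
  simp only [LinearMap.comp_apply, LinearMap.add_apply, LinearMap.smul_apply]
  refine perm_eq_of_dual fun Λ => ?_
  have h1 := dual_map_differential ((compose i).flip (cls M)) Λ
    (fun N => evalComp (stripMap J i) Sum.inr i (fun T => Λ (cls T)) N M) hL fun N hN => by
      rw [LinearMap.flip_apply, dual_compose Λ hN hM]
  rw [LinearMap.flip_apply] at h1
  rw [map_add, map_smul, h1,
    dual_map_differential (compose i (cls L)) Λ
      (fun N => evalComp (stripMap J i) Sum.inr i (fun T => Λ (cls T)) L N) hM fun N hN =>
        dual_compose Λ hL hN,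
    dual_map_compose _ Λ _ hL hM fun N hN => dual_differential Λ hN,
    evalComp_evalD (stripMap_eq_none i) (isAlt_dual Λ) L M hL.1 hM.1 hL.2.1, ← hm,
    Int.coe_negOnePow_natCast]
  simp

theorem relabel_compose {I' J' : Type u} (e : I ≃ I') (f : J ≃ J') (i : I) (a : Perm I)
    (b : Perm J) :
    relabel (substEquiv e i f) (compose i a b) = compose (e i) (relabel e a) (relabel f b) := by
  refine eq_of_cls (relabel (substEquiv e i f) ∘ₗ (compose i).flip b)
    ((compose (e i)).flip (relabel f b) ∘ₗ relabel e) (fun L hL => ?_) a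
  simp only [LinearMap.comp_apply, LinearMap.flip_apply]
  refine eq_of_cls (relabel (substEquiv e i f) ∘ₗ compose i (cls L))
    (compose (e i) (relabel e (cls L)) ∘ₗ relabel f) (fun M hM => ?_) b
  simp only [LinearMap.comp_apply]
  refine perm_eq_of_dual fun Λ => ?_
  rw [dual_relabel_compose _ Λ hL hM, relabel_cls e hL, relabel_cls f hM,
    dual_compose Λ (isExpr_map hL e) (isExpr_map hM f), evalComp_map_source e.injective,
    evalComp_map_right]
  congr 1
  funext x
  by_cases h : x = i
  · subst h; simp
  · have h' : e x ≠ e i := fun h' => h (e.injective h')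
    rw [stripMap_of_ne h, stripMap_of_ne h']
    rfl

/-! ### The unit -/

theorem one_mem_grade : cls [[PUnit.unit]] ∈ grade PUnit.{u + 1} 0 := by
  simpa [bdim] using cls_mem_grade [[PUnit.unit.{u + 1}]]

theorem isExpr_one : IsExpr [[PUnit.unit.{u + 1}]] := by
  refine ⟨by simp, by simp, fun i => by simp⟩

theorem differential_one : differential PUnit.{u + 1} (cls [[PUnit.unit]]) = 0 := by
  rw [differential_cls isExpr_one]; rfl

/-- Substituting a single point puts it at the end of the block of `i`; moving it back to the place
of `i` produces the same sign as the tail count, so the two cancel. The one-element block has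
dimension zero and there is nothing to shuffle. -/
theorem evalComp_one {f : I → Option I} {g : J → I} {i : I} (hf : ∀ x, x ≠ i → f x = some x)
    (hi : f i = none) (y : J) (hg : g y = i) {φ : List (List I) → ℤ} (hφ : IsAlt φ)
    (L : List (List I)) (hL : L.flatten.Nodup) (hiL : i ∈ L.flatten) :
    evalComp f g i φ L [[y]] = φ L := by
  have hid : ∀ c : List I, i ∉ c → c.filterMap f = c := fun c hc => by
    conv_rhs => rw [← List.filterMap_some (l := c)]
    exact List.filterMap_congr fun x hx => hf x fun e => hc (e ▸ hx)
  induction L generalizing φ with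
  | nil => simp at hiL
  | cons b L ih =>
    rw [List.flatten_cons, List.nodup_append] at hL
    by_cases hb : i ∈ b
    · have hLi : i ∉ L.flatten := fun h => hL.2.2 i hb i h rfl
      obtain ⟨x, z, rfl, hx⟩ := List.eq_append_cons_of_mem hb
      have hz : i ∉ z := (List.nodup_cons.1 (List.nodup_append.1 hL.1).2.1).1
      have hm : L.map (List.filterMap f) = L := by
        conv_rhs => rw [← List.map_id L]
        exact List.map_congr_left fun c hc => hid c fun h => hLi (List.mem_flatten.2 ⟨c, hc, h⟩)
      have h1 := hφ.move x z [] i L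
      rw [evalComp_of_mem _ hb, tailCount_eq hx, hm, List.filterMap_append,
        List.filterMap_cons_none hi, hid x hx, hid z hz]
      simp only [List.append_nil] at h1
      rw [h1]
      simp [bdim, hg]
    · rw [evalComp_of_notMem _ hb, hid b hb]
      rw [List.flatten_cons, List.mem_append] at hiL
      exact ih (hφ.cons b) hL.2.1 (hiL.resolve_left hb)

theorem compose_one (i : I) (a : Perm I) :
    relabel (unitRightEquiv i) (compose i a (cls [[PUnit.unit]])) = a := by
  refine eq_of_cls (relabel (unitRightEquiv i) ∘ₗ (compose i).flip (cls [[PUnit.unit]]))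
    LinearMap.id (fun L hL => ?_) a
  refine perm_eq_of_dual fun Λ => ?_
  simp only [LinearMap.comp_apply, LinearMap.flip_apply, LinearMap.id_apply]
  rw [dual_relabel_compose _ Λ hL isExpr_one]
  refine evalComp_one (fun x hx => ?_) (by simp) _ (by simp [unitRightEquiv]) (isAlt_dual Λ) L
    hL.2.1 (hL.2.2 i)
  rw [stripMap_of_ne hx]
  simp [unitRightEquiv]

theorem one_compose [Nonempty J] (b : Perm J) :
    relabel (unitLeftEquiv J) (compose PUnit.unit (cls [[PUnit.unit]]) b) = b := by
  refine eq_of_cls (relabel (unitLeftEquiv J) ∘ₗ compose PUnit.unit (cls [[PUnit.unit]]))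
    LinearMap.id (fun M hM => ?_) b
  refine perm_eq_of_dual fun Λ => ?_
  simp only [LinearMap.comp_apply, LinearMap.id_apply]
  rw [dual_relabel_compose _ Λ isExpr_one hM]
  -- Nonemptiness of `J` is essential: on an empty list of blocks the composition has no terms.
  have h := hM.ne_nil
  cases M with
  | nil => exact absurd rfl h
  | cons m M =>
    rw [evalComp_of_mem _ (by simp)]
    have h1 : (fun y => unitLeftEquiv J (Sum.inr y)) = id := rfl
    simp [h1, tailCount]

/-! ### Associativity in `Π` -/

theorem compose_assoc (i : I) (j : J) (a : Perm I) (b : Perm J) (c : Perm K) :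
    relabel (seqEquiv i j) (compose (Sum.inr j) (compose i a b) c) =
      compose i a (compose j b c) := by
  refine eq_of_cls (relabel (seqEquiv i j) ∘ₗ (compose (Sum.inr j)).flip c ∘ₗ (compose i).flip b)
    ((compose i).flip (compose j b c)) (fun L hL => ?_) a
  simp only [LinearMap.comp_apply, LinearMap.flip_apply]
  refine eq_of_cls (relabel (seqEquiv i j) ∘ₗ (compose (Sum.inr j)).flip c ∘ₗ compose i (cls L))
    (compose i (cls L) ∘ₗ (compose j).flip c) (fun M hM => ?_) b
  simp only [LinearMap.comp_apply, LinearMap.flip_apply]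
  refine eq_of_cls (relabel (seqEquiv i j) ∘ₗ compose (Sum.inr j) (compose i (cls L) (cls M)))
    (compose i (cls L) ∘ₗ compose j (cls M)) (fun N hN => ?_) c
  simp only [LinearMap.comp_apply]
  refine perm_eq_of_dual fun Λ => ?_
  have h1 := dual_map_compose (relabel (seqEquiv i j) ∘ₗ (compose (Sum.inr j)).flip (cls N)) Λ _
    hL hM fun T hT => dual_relabel_compose (seqEquiv i j) Λ hT hN
  simp only [LinearMap.comp_apply, LinearMap.flip_apply] at h1
  rw [h1, dual_map_compose (compose i (cls L)) Λ _ hM hN fun T hT => dual_compose Λ hL hT]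
  refine evalComp_assoc (stripMap_eq_none i) (fun y => ?_) (stripMap_eq_none j)
    Sum.inr_injective (fun x => ?_) (stripMap_eq_none i) (fun y => ?_) (fun z => rfl) _ L M N
    hL.2.1 hM.2.1 (hM.2.2 j) hM.1 hN.1
  · rw [Option.map_eq_none_iff, stripMap_eq_none]
  · by_cases h : x = i
    · subst h; simp
    · rw [stripMap_of_ne h, stripMap_of_ne h, Option.bind_some, stripMap_of_ne Sum.inl_ne_inr]
      rfl
  · by_cases h : y = j
    · subst h; simp
    · rw [stripMap_of_ne h, stripMap_of_ne (fun e => h (Sum.inr.inj e))]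
      rfl

/-- The concrete relabellings of the two iterated compositions; the identification `parEquiv` is
built into the outer maps of the first, so that both land in the same set. -/
theorem exchange_stripMap (i k : I) (hik : i ≠ k) :
    Exchange (stripMap J i) Sum.inr
      (fun x => (stripMap K (Sum.inl ⟨k, hik.symm⟩ : {x : I // x ≠ i} ⊕ J) x).map
        (parEquiv i k hik))
      (fun z => parEquiv i k hik (Sum.inr z)) (stripMap K k) Sum.inr
      (stripMap J (Sum.inl ⟨i, hik⟩ : {x : I // x ≠ k} ⊕ K)) Sum.inr i k
      (Sum.inl ⟨k, hik.symm⟩) (Sum.inl ⟨i, hik⟩) where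
  ne := hik
  eq_none₁ := stripMap_eq_none i
  eq_none₂ x := by rw [Option.map_eq_none_iff, stripMap_eq_none]
  eq_none₃ := stripMap_eq_none k
  eq_none₄ := stripMap_eq_none _
  eq_some₁ x := by
    by_cases h : x = i
    · subst h; simp [hik]
    · simp [stripMap_of_ne h]
  eq_some₃ x := by
    by_cases h : x = k
    · subst h; simp [hik.symm]
    · simp [stripMap_of_ne h]
  inj₁ x y z hx hy := by
    by_cases h : x = i
    · subst h; simp at hx
    · by_cases h' : y = i
      · subst h'; simp at hy
      · rw [stripMap_of_ne h, Option.mem_some] at hx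
        rw [stripMap_of_ne h', Option.mem_some, ← hx] at hy
        simpa using hy.symm
  inj₃ x y z hx hy := by
    by_cases h : x = k
    · subst h; simp at hx
    · by_cases h' : y = k
      · subst h'; simp at hy
      · rw [stripMap_of_ne h, Option.mem_some] at hx
        rw [stripMap_of_ne h', Option.mem_some, ← hx] at hy
        simpa using hy.symm
  bind_eq x := by
    by_cases h : x = i
    · subst h; rw [stripMap_of_ne hik]; simp
    · by_cases h' : x = k
      · subst h'; rw [stripMap_of_ne h]; simp
      · rw [stripMap_of_ne h, stripMap_of_ne h', Option.bind_some, Option.bind_some,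
          stripMap_of_ne (by simpa using h'), stripMap_of_ne (by simpa using h)]
        rfl
  map_left y := by rw [stripMap_of_ne Sum.inr_ne_inl]; rfl
  map_right z := by rw [stripMap_of_ne Sum.inr_ne_inl]; rfl

theorem compose_comm (i k : I) (hik : i ≠ k) {m n : ℤ} (a : Perm I) {b : Perm J} {c : Perm K}
    (hb : b ∈ grade J m) (hc : c ∈ grade K n) :
    relabel (parEquiv i k hik) (compose (Sum.inl ⟨k, hik.symm⟩ : {x : I // x ≠ i} ⊕ J) (compose i a b) c) =
      ((m * n).negOnePow : ℤ) • compose (Sum.inl ⟨i, hik⟩ : {x : I // x ≠ k} ⊕ K) (compose k a c) b := by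
  refine eq_of_cls (relabel (parEquiv i k hik) ∘ₗ (compose (Sum.inl ⟨k, hik.symm⟩ : {x : I // x ≠ i} ⊕ J)).flip c ∘ₗ
      (compose i).flip b)
    (((m * n).negOnePow : ℤ) • ((compose (Sum.inl ⟨i, hik⟩ : {x : I // x ≠ k} ⊕ K)).flip b ∘ₗ (compose k).flip c))
    (fun L hL => ?_) a
  simp only [LinearMap.comp_apply, LinearMap.flip_apply, LinearMap.smul_apply]
  refine eq_of_grade (relabel (parEquiv i k hik) ∘ₗ (compose (Sum.inl ⟨k, hik.symm⟩ : {x : I // x ≠ i} ⊕ J)).flip c ∘ₗ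
      compose i (cls L))
    (((m * n).negOnePow : ℤ) • (compose (Sum.inl ⟨i, hik⟩ : {x : I // x ≠ k} ⊕ K) (compose k (cls L) c)))
    (fun M hM hm => ?_) hb
  simp only [LinearMap.comp_apply, LinearMap.flip_apply, LinearMap.smul_apply]
  refine eq_of_grade (relabel (parEquiv i k hik) ∘ₗ
      compose (Sum.inl ⟨k, hik.symm⟩ : {x : I // x ≠ i} ⊕ J) (compose i (cls L) (cls M)))
    (((m * n).negOnePow : ℤ) • ((compose (Sum.inl ⟨i, hik⟩ : {x : I // x ≠ k} ⊕ K)).flip (cls M) ∘ₗ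
      compose k (cls L))) (fun N hN hn => ?_) hc
  simp only [LinearMap.comp_apply, LinearMap.flip_apply, LinearMap.smul_apply]
  refine perm_eq_of_dual fun Λ => ?_
  have h1 := dual_map_compose (relabel (parEquiv i k hik) ∘ₗ
    (compose (Sum.inl ⟨k, hik.symm⟩ : {x : I // x ≠ i} ⊕ J)).flip (cls N)) Λ _ hL hM fun T hT =>
      dual_relabel_compose (parEquiv i k hik) Λ hT hN
  have h2 := dual_map_compose ((compose (Sum.inl ⟨i, hik⟩ : {x : I // x ≠ k} ⊕ K)).flip (cls M)) Λ _ hL hN fun T hT =>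
      dual_compose Λ hT hM
  simp only [LinearMap.comp_apply, LinearMap.flip_apply] at h1 h2
  rw [map_smul, h1, h2, (exchange_stripMap i k hik).evalComp_comm (isAlt_dual Λ) L M N hL.2.1
    (hL.2.2 i) (hL.2.2 k) hM.1 hN.1, ← hm, ← hn, ← Nat.cast_mul, Int.coe_negOnePow_natCast]
  rfl

theorem isDGOperad_permOperad : permOperad.{u}.IsDGOperad where
  isInternal I _ _ := isInternal_grade I
  d_mem _ _ _ _ _ ha := differential_mem ha
  d_d _ _ _ a := differential_differential a
  map_id _ _ _ a := relabel_refl a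
  map_trans e f a := relabel_trans e f a
  map_mem e _ _ ha := relabel_mem e ha
  map_d e a := relabel_differential e a
  comp_mem i _ _ _ _ ha hb := compose_mem i ha hb
  d_comp i _ _ b ha := differential_compose i ha b
  map_comp e f i a b := relabel_compose e f i a b
  one_mem := one_mem_grade
  d_one := differential_one
  comp_one i a := compose_one i a
  one_comp b := one_compose b
  assoc_seq i j a b c := compose_assoc i j a b c
  assoc_par i k hik _ _ a _ _ hb hc := compose_comm i k hik a hb hc

end Operad

/-! ## Faces of the permutohedron -/

section Permutohedron

/-- A point of the hull of `S` is a convex combination of a point over `T`, where `l = c`, and one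
over `S \ T`, where `l < c`. At level `c` the second coefficient must vanish. -/
theorem convexHull_inter_level {E : Type*} [AddCommGroup E] [Module ℝ E] (l : E →ₗ[ℝ] ℝ)
    {S T : Set E} (hTS : T ⊆ S) {c : ℝ} (hT : ∀ x ∈ T, l x = c) (hS : ∀ x ∈ S, x ∉ T → l x < c) :
    {x ∈ convexHull ℝ S | l x = c} = convexHull ℝ T := by
  have h1 : convexHull ℝ T ⊆ {x | l x = c} :=
    convexHull_min hT (convex_hyperplane l.isLinear c)
  have h2 : convexHull ℝ (S \ T) ⊆ {x | l x < c} :=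
    convexHull_min (fun x hx => hS x hx.1 hx.2) (convex_halfSpace_lt l.isLinear c)
  refine Set.Subset.antisymm ?_ fun x hx => ⟨convexHull_mono hTS hx, h1 hx⟩
  rintro x ⟨hx, hxc⟩
  rcases T.eq_empty_or_nonempty with rfl | hTn
  · rw [Set.sdiff_empty] at h2
    exact absurd hxc (h2 hx).ne
  rcases (S \ T).eq_empty_or_nonempty with he | hSn
  · exact convexHull_mono (Set.sdiff_eq_empty.1 he) hx
  rw [← Set.union_sdiff_cancel hTS, convexHull_union hTn hSn, mem_convexJoin] at hx
  obtain ⟨a, ha, b, hb, s, t, hs, ht, hst, rfl⟩ := hx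
  have ha' : l a = c := h1 ha
  have hb' : l b < c := h2 hb
  have ht0 : t = 0 := by
    by_contra hne
    have htp : 0 < t := lt_of_le_of_ne ht (Ne.symm hne)
    rw [map_add, map_smul, map_smul, ha', smul_eq_mul, smul_eq_mul] at hxc
    have : t * l b < t * c := mul_lt_mul_of_pos_left hb' htp
    have hs' : s * c = c - t * c := by rw [← eq_sub_iff_add_eq] at hst; rw [hst]; ring
    linarith
  have hs1 : s = 1 := by linarith
  rw [ht0, hs1, one_smul, zero_smul, add_zero]
  exact ha

/-! ### Maximizing linear forms on the permutohedron -/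

variable {I : Type u}

/-- The numberings of `I` that are increasing with respect to a weight. -/
def increasing {R : Type*} [LT R] (w : I → R) : Set (I ≃ Fin (Nat.card I)) :=
  {σ | ∀ i j, w i < w j → σ i < σ j}

/-- Sorting the elements by weight, with ties broken arbitrarily, gives such a numbering. -/
theorem increasing_nonempty [Finite I] {R : Type*} [LinearOrder R] (w : I → R) :
    (increasing w).Nonempty := by
  let e := Finite.equivFin I
  have hm := Tuple.monotone_sort (w ∘ e.symm)
  refine ⟨e.trans (Tuple.sort (w ∘ e.symm)).symm, fun i j hij => ?_⟩
  by_contra h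
  have := hm (not_lt.1 h)
  simp only [Function.comp_apply, Equiv.trans_apply, Equiv.apply_symm_apply,
    Equiv.symm_apply_apply] at this
  exact absurd hij (not_lt.2 this)

theorem vertex_lt_iff (σ : I ≃ Fin (Nat.card I)) (i j : I) :
    vertex σ i < vertex σ j ↔ σ i < σ j := by
  simp [vertex]

theorem monovary_vertex_iff (w : I → ℝ) (σ : I ≃ Fin (Nat.card I)) :
    Monovary w (vertex σ) ↔ σ ∈ increasing w := by
  constructor
  · intro h i j hij
    refine lt_of_le_of_ne (not_lt.1 fun hlt => ?_) fun e => ?_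
    · exact absurd hij (not_lt.2 (h ((vertex_lt_iff σ j i).2 hlt)))
    · rw [σ.injective e] at hij
      exact lt_irrefl _ hij
  · intro h i j hij
    rw [vertex_lt_iff] at hij
    by_contra hlt
    exact absurd (h j i (not_le.1 hlt)) (not_lt.2 hij.le)

/-- The rearrangement inequality with its equality case, applied to the permutation relating the two
numberings. -/
theorem sum_mul_vertex_le [Fintype I] (w : I → ℝ) {σ : I ≃ Fin (Nat.card I)}
    (hσ : σ ∈ increasing w) (τ : I ≃ Fin (Nat.card I)) :
    ∑ i, w i * vertex τ i ≤ ∑ i, w i * vertex σ i ∧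
      (∑ i, w i * vertex τ i = ∑ i, w i * vertex σ i ↔ τ ∈ increasing w) := by
  have hm := (monovary_vertex_iff w σ).2 hσ
  have hc : vertex σ ∘ (τ.trans σ.symm) = vertex τ := by
    funext i
    simp [vertex]
  have h1 := hm.sum_mul_comp_perm_le_sum_mul (σ := τ.trans σ.symm)
  have h2 := hm.sum_mul_comp_perm_eq_sum_mul_iff (σ := τ.trans σ.symm)
  rw [hc, monovary_vertex_iff] at h2
  simp only [← hc, Function.comp_apply]
  exact ⟨h1, h2⟩

/-- The points of the permutohedron where a linear form is maximal. -/
theorem permutohedron_maximizers [Fintype I] (w : I → ℝ) (l : (I → ℝ) →ₗ[ℝ] ℝ)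
    (hl : ∀ x, l x = ∑ i, w i * x i) :
    {x ∈ permutohedron I | ∀ y ∈ permutohedron I, l y ≤ l x} =
      convexHull ℝ (vertex '' increasing w) := by
  obtain ⟨σ, hσ⟩ := increasing_nonempty w
  have hle : ∀ y ∈ permutohedron I, l y ≤ l (vertex σ) := fun y hy => by
    have : permutohedron I ⊆ {y | l y ≤ l (vertex σ)} :=
      convexHull_min (by
        rintro _ ⟨τ, rfl⟩
        rw [Set.mem_ofPred_eq, hl, hl]
        exact (sum_mul_vertex_le w hσ τ).1) (convex_halfSpace_le l.isLinear _)
    exact this hy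
  have hmem : vertex σ ∈ permutohedron I := subset_convexHull ℝ _ ⟨σ, rfl⟩
  rw [← convexHull_inter_level l (Set.image_subset_range _ _) (c := l (vertex σ))]
  · ext x
    constructor
    · exact fun h => ⟨h.1, le_antisymm (hle x h.1) (h.2 _ hmem)⟩
    · exact fun h => ⟨h.1, fun y hy => (hle y hy).trans h.2.ge⟩
  · rintro _ ⟨τ, hτ, rfl⟩
    rw [hl, hl]
    exact (sum_mul_vertex_le w hσ τ).2.2 hτ
  · rintro _ ⟨τ, rfl⟩ hτ
    rw [hl, hl]
    refine lt_of_le_of_ne (sum_mul_vertex_le w hσ τ).1 fun e => hτ ?_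
    exact ⟨τ, (sum_mul_vertex_le w hσ τ).2.1 e, rfl⟩

/-- A vertex in the hull maximizes the form `w`, and the equality case of the rearrangement
inequality then makes its numbering increasing. Thus a face determines its set of numberings. -/
theorem vertex_mem_iff [Finite I] (w : I → ℝ) (τ : I ≃ Fin (Nat.card I)) :
    vertex τ ∈ convexHull ℝ (vertex '' increasing w) ↔ τ ∈ increasing w := by
  have := Fintype.ofFinite I
  refine ⟨fun h => ?_, fun h => subset_convexHull ℝ _ ⟨τ, h, rfl⟩⟩
  obtain ⟨σ, hσ⟩ := increasing_nonempty w
  rw [← permutohedron_maximizers w (Fintype.linearCombination ℝ w) fun x => by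
    simp [Fintype.linearCombination_apply, mul_comm]] at h
  have h1 := h.2 (vertex σ) (subset_convexHull ℝ _ ⟨σ, rfl⟩)
  simp only [Fintype.linearCombination_apply, smul_eq_mul, mul_comm (vertex _ _)] at h1
  exact (sum_mul_vertex_le w hσ τ).2.1 (le_antisymm (sum_mul_vertex_le w hσ τ).1 h1)

/-! ### Ordered partitions as rank functions and the bijection with faces -/

namespace OrderedPartition

theorem exists_index (P : OrderedPartition I) (i : I) :
    ∃ k, ∃ h : k < P.blocks.length, i ∈ P.blocks[k] := by
  obtain ⟨B, hB, hi⟩ := P.cover i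
  obtain ⟨k, hk, rfl⟩ := List.mem_iff_getElem.1 hB
  exact ⟨k, hk, hi⟩

/-- The index of the block containing an element. -/
noncomputable def rank (P : OrderedPartition I) (i : I) : ℕ := (P.exists_index i).choose

theorem rank_lt (P : OrderedPartition I) (i : I) : P.rank i < P.blocks.length :=
  (P.exists_index i).choose_spec.choose

theorem mem_rank (P : OrderedPartition I) (i : I) : i ∈ P.blocks[P.rank i]'(P.rank_lt i) :=
  (P.exists_index i).choose_spec.choose_spec

theorem mem_getElem_iff (P : OrderedPartition I) (i : I) {k : ℕ} (hk : k < P.blocks.length) :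
    i ∈ P.blocks[k] ↔ P.rank i = k := by
  constructor
  · intro hi
    have hd := List.pairwise_iff_getElem.1 P.disjoint
    rcases lt_trichotomy (P.rank i) k with h | h | h
    · exact absurd hi (Finset.disjoint_left.1 (hd _ _ (P.rank_lt i) hk h) (P.mem_rank i))
    · exact h
    · exact absurd (P.mem_rank i) (Finset.disjoint_left.1 (hd _ _ hk (P.rank_lt i) h) hi)
  · rintro rfl
    exact P.mem_rank i

theorem exists_rank_eq (P : OrderedPartition I) {k : ℕ} (hk : k < P.blocks.length) :
    ∃ i, P.rank i = k := by
  obtain ⟨i, hi⟩ := P.nonempty _ (List.getElem_mem hk)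
  exact ⟨i, (P.mem_getElem_iff i hk).1 hi⟩

theorem pairwise_iff (P : OrderedPartition I) (σ : I ≃ Fin (Nat.card I)) :
    (P.blocks.Pairwise fun B C => ∀ i ∈ B, ∀ j ∈ C, σ i < σ j) ↔ σ ∈ increasing P.rank := by
  rw [List.pairwise_iff_getElem]
  constructor
  · intro h i j hij
    exact h _ _ (P.rank_lt i) (P.rank_lt j) hij i (P.mem_rank i) j (P.mem_rank j)
  · intro h k l hk hl hkl i hi j hj
    rw [mem_getElem_iff] at hi hj
    exact h i j (by rw [hi, hj]; exact hkl)

theorem faceOf_eq (P : OrderedPartition I) :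
    faceOf P = convexHull ℝ (vertex '' increasing P.rank) := by
  simp only [faceOf, pairwise_iff, Set.ofPred_mem_eq]

theorem increasing_natCast (P : OrderedPartition I) :
    increasing (fun i => (P.rank i : ℝ)) = increasing P.rank := by
  simp [increasing]

/-- The order of the blocks is determined by the increasing numberings. -/
theorem rank_lt_rank_iff [Finite I] (P : OrderedPartition I) (i j : I) :
    P.rank i < P.rank j ↔ ∀ σ ∈ increasing P.rank, σ i < σ j := by
  classical
  refine ⟨fun h σ hσ => hσ i j h, fun h => ?_⟩
  by_contra hle
  rcases eq_or_ne i j with rfl | hij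
  · obtain ⟨σ, hσ⟩ := increasing_nonempty P.rank
    exact lt_irrefl _ (h σ hσ)
  -- Doubling the ranks leaves room to put `i` after the rest of its block but before the next
  -- block. A numbering increasing for this weight respects `P` and yet places `j` before `i`.
  · obtain ⟨σ, hσ⟩ := increasing_nonempty fun x => 2 * P.rank x + if x = i then 1 else 0
    refine lt_asymm (h σ fun x y hxy => hσ x y ?_) (hσ j i ?_)
    · dsimp only
      split_ifs <;> omega
    · dsimp only
      rw [if_pos rfl, if_neg hij.symm]
      omega

/-- No block is empty, so below an element of rank `k + 1` there is one of rank `k`; the `Q`-rank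
grows by at least one at each such step. -/
theorem rank_le_of_order {P Q : OrderedPartition I}
    (h : ∀ i j, P.rank i < P.rank j → Q.rank i < Q.rank j) (i : I) : P.rank i ≤ Q.rank i := by
  induction hk : P.rank i generalizing i with
  | zero => exact Nat.zero_le _
  | succ k ih =>
    have hlt := P.rank_lt i
    obtain ⟨j, hj⟩ := P.exists_rank_eq (k := k) (by omega)
    have h1 := ih j hj
    have h2 := h j i (by omega)
    omega

theorem length_le_of_rank_eq {P Q : OrderedPartition I} (h : P.rank = Q.rank) :
    P.blocks.length ≤ Q.blocks.length := by
  by_contra hlt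
  obtain ⟨i, hi⟩ := P.exists_rank_eq (k := Q.blocks.length) (by omega)
  have := Q.rank_lt i
  rw [← h, hi] at this
  exact lt_irrefl _ this

theorem eq_of_rank_eq {P Q : OrderedPartition I} (h : P.rank = Q.rank) : P = Q := by
  refine ext_blocks (List.ext_getElem ?_ fun k hP hQ => ?_)
  · exact le_antisymm (length_le_of_rank_eq h) (length_le_of_rank_eq h.symm)
  · ext i
    rw [mem_getElem_iff, mem_getElem_iff, h]

/-- The vertices in the face give the increasing numberings, these give the strict order between
blocks, and that order gives the ranks and hence the blocks. -/
theorem faceOf_injective [Finite I] : Function.Injective (faceOf (I := I)) := by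
  intro P Q h
  have hinc : increasing P.rank = increasing Q.rank := by
    ext σ
    rw [faceOf_eq, faceOf_eq, ← increasing_natCast, ← increasing_natCast Q] at h
    rw [← increasing_natCast, ← increasing_natCast Q, ← vertex_mem_iff, ← vertex_mem_iff, h]
  have hlt : ∀ i j, P.rank i < P.rank j ↔ Q.rank i < Q.rank j := fun i j => by
    rw [rank_lt_rank_iff, rank_lt_rank_iff, hinc]
  exact eq_of_rank_eq (funext fun i => le_antisymm
    (rank_le_of_order (fun i j => (hlt i j).1) i) (rank_le_of_order (fun i j => (hlt i j).2) i))

/-- The ordered partition into the level sets of a weight. -/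
noncomputable def ofWeight [Fintype I] (w : I → ℝ) : OrderedPartition I where
  blocks := (Finset.univ.image w).sort.map fun v => Finset.univ.filter fun i => w i = v
  nonempty := by
    intro B hB
    obtain ⟨v, hv, rfl⟩ := List.mem_map.1 hB
    obtain ⟨i, _, rfl⟩ := Finset.mem_image.1 ((Finset.mem_sort _).1 hv)
    exact ⟨i, by simp⟩
  disjoint := by
    refine List.pairwise_map.2 ((Finset.sort_nodup _ _).imp fun {v v'} hv => ?_)
    refine Finset.disjoint_left.2 fun i hi hi' => hv ?_
    rw [← (Finset.mem_filter.1 hi).2, (Finset.mem_filter.1 hi').2]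
  cover i := ⟨_, List.mem_map_of_mem ((Finset.mem_sort _).2
    (Finset.mem_image_of_mem w (Finset.mem_univ i))), by simp⟩

theorem faceOf_ofWeight [Fintype I] (w : I → ℝ) :
    faceOf (ofWeight w) = convexHull ℝ (vertex '' increasing w) := by
  unfold faceOf
  congr 2
  ext σ
  have hs : ((Finset.univ.image w).sort).Pairwise (· < ·) :=
    (Finset.sortedLT_sort _).pairwise
  simp only [ofWeight, Set.mem_ofPred_eq, List.pairwise_map, Finset.mem_filter, Finset.mem_univ,
    true_and]
  constructor
  · intro h i j hij
    have hmem : ∀ x, w x ∈ (Finset.univ.image w).sort := fun x =>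
      (Finset.mem_sort _).2 (Finset.mem_image_of_mem w (Finset.mem_univ x))
    obtain ⟨a, ha, hai⟩ := List.mem_iff_getElem.1 (hmem i)
    obtain ⟨b, hb, hbj⟩ := List.mem_iff_getElem.1 (hmem j)
    rw [List.pairwise_iff_getElem] at h hs
    rcases lt_trichotomy a b with hab | rfl | hab
    · exact h a b ha hb hab i hai.symm j hbj.symm
    · rw [← hai, ← hbj] at hij
      exact absurd hij (lt_irrefl _)
    · have := hs b a hb ha hab
      rw [hai, hbj] at this
      exact absurd hij this.not_gt
  · exact fun h => hs.imp fun {v v'} hv i hi j hj => h i j (by rw [hi, hj]; exact hv)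

theorem bijOn_faceOf [Finite I] : Set.BijOn faceOf (Set.univ : Set (OrderedPartition I))
    {F | F.Nonempty ∧ IsExposed ℝ (permutohedron I) F} := by
  classical
  have := Fintype.ofFinite I
  refine ⟨fun P _ => ⟨?_, fun _ => ?_⟩, faceOf_injective.injOn, ?_⟩
  · obtain ⟨σ, hσ⟩ := increasing_nonempty P.rank
    rw [faceOf_eq]
    exact ⟨_, subset_convexHull ℝ _ ⟨σ, hσ, rfl⟩⟩
  -- The block indices themselves serve as coefficients of a linear form exposing the face.
  · refine ⟨∑ i, (P.rank i : ℝ) • ContinuousLinearMap.proj i, ?_⟩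
    rw [faceOf_eq, ← increasing_natCast]
    refine (permutohedron_maximizers (fun i => (P.rank i : ℝ))
      ((∑ i, (P.rank i : ℝ) • ContinuousLinearMap.proj i : (I → ℝ) →L[ℝ] ℝ) : (I → ℝ) →ₗ[ℝ] ℝ)
      fun x => ?_).symm
    simp
  · rintro F ⟨hF, hexp⟩
    obtain ⟨l, rfl⟩ := hexp hF
    -- The weight of `i` is the coefficient of the exposing form at `i`, its value on the
    -- corresponding standard basis vector.
    refine ⟨ofWeight fun i => l fun j => if i = j then 1 else 0, trivial, ?_⟩
    rw [faceOf_ofWeight]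
    refine (permutohedron_maximizers _ (l : (I → ℝ) →ₗ[ℝ] ℝ) fun x => ?_).symm
    rw [LinearMap.pi_apply_eq_sum_univ]
    simp [mul_comm]

end OrderedPartition

end Permutohedron

end PermOperad

theorem mainTheorem1 :
    (∀ (I : Type u) [Finite I],
      ∃ b : Module.Basis (PermOperad.OrderedPartition I) ℤ (PermOperad.Perm I),
        ∀ e : PermOperad.Expr I, e.cls = b e.partition ∨ e.cls = -b e.partition) ∧
    (∀ (I : Type u) [Finite I],
      Set.BijOn PermOperad.faceOf (Set.univ : Set (PermOperad.OrderedPartition I))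
        {F | F.Nonempty ∧ IsExposed ℝ (PermOperad.permutohedron I) F}) ∧
    PermOperad.permOperad.{u}.IsDGOperad := by
  exact ⟨fun I _ => PermOperad.exists_basis I,
    fun _ _ => PermOperad.OrderedPartition.bijOn_faceOf, PermOperad.isDGOperad_permOperad⟩
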